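/- **Conventions.** Let $(\Sigma,g)$ be a compact Riemannian surface (without boundary) and $(N,h)$ a compact Riemannian manifold. For a map $u:\Sigma\to N$ write $e(u)=\tfrac12|du|^2$ for the energy density, $E(u,A)=\int_A e(u)\,dV_g$ for $A\subset\Sigma$, and $S(u)=\langle du\otimes du\rangle-\tfrac12|du|^2g$ for the stress-energy tensor. Let $B_r(p)$ be the open geodesic ball and $U^{r}_{s}(p)=B_r(p)\setminus\overline{B_s(p)}$ for $0<s<r$. For $\varepsilon,\rho>0$ and $p\in\Sigma$, the outer energy scale $\lambda_{\varepsilon,\rho,p}(u)$ is the infimum of all $\lambda\in[0,\rho]$ such that $$\sup_{\lambda<r<\rho}E\big(u,U^{r}_{r/2}(p)\big)<\varepsilon ,$$ where the supremum over the empty set is $0$. A classical solution of harmonic map flow on $[0,T)$, $0<T\le\infty$, is a smooth map $u:\Sigma\times[0,T)\to N$ with $\partial_t u=\operatorname{tr}_g\nabla du$; write $u(t)=u(\cdot,t)$. (The time $T$ need not be the maximal existence time.) **Theorem.** There is an absolute constant $C>0$, and for each compact Riemannian surface $(\Sigma,g)$ there is $R_0=R_0(\Sigma,g)>0$, with the following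 property. Let $(N,h)$ be a compact Riemannian manifold, let $u$ be a classical solution of harmonic map flow on $\Sigma\times[0,T)$, $0<T\le\infty$, and suppose that for some $q\in[1,\infty)$, $\sigma\ge 0$ and $0\le\tau<T$, $$\sup_{\tau\le t<T}\|S(u(t))\|_{L^q(\Sigma)}\le\sigma .$$ Let $\varepsilon>0$ and $p\in\Sigma$. 1. If $0<R\le\rho<R_0$ and $\tau\le t_1\le t_2<T$ satisfy $$\sup_{t_1\le t\le t_2}E\big(u(t),B_\rho(p)\big)\le E\big(u(t_2),B_R(p)\big)+\frac{\varepsilon}{2},$$ then for all $t_1\le t\le t_2$, $$\lambda_{\varepsilon,\rho,p}(u(t))\le\max\left[4R,\ \left(\frac{C\sigma(t_2-t)}{\varepsilon}\right)^{q/2}\right].$$ 2. If $T<\infty$, then there exists $0<\rho<R_0$ such that $\lambda_{\varepsilon,\rho,p}(u(t))=O\big((T-t)^{q/2}\big)$ as $t\nearrow T$. -/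

import Mathlib

open Bundle Set Filter MeasureTheory Manifold Asymptotics
open scoped ENNReal ContDiff Topology

noncomputable section

/-- The model space of an `m`-dimensional manifold. -/
abbrev ModelE (m : ℕ) : Type := EuclideanSpace ℝ (Fin m)

namespace HMFlow

universe u v

/-! ### A Riemannian manifold in local coordinates -/

section Riemannian

variable {m : ℕ} {M : Type u} [TopologicalSpace M] [ChartedSpace (ModelE m) M]
  [RiemannianBundle (fun x : M ↦ TangentSpace (𝓡 m) x)]

/-- The coordinate vector `∂ᵢ` of the chart at `x₀`, at the point with coordinates `y`. -/
def coordVec (x₀ : M) (y : ModelE m) (i : Fin m) :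
    TangentSpace (𝓡 m) ((extChartAt (𝓡 m) x₀).symm y) :=
  mfderiv (𝓡 m) (𝓡 m) (extChartAt (𝓡 m) x₀).symm y (EuclideanSpace.single i (1 : ℝ))

/-- The matrix `g_{ij} = ⟨∂ᵢ, ∂ⱼ⟩` of the metric in the chart at `x₀`, as a function of the
coordinates `y`. -/
def metricMatrix (x₀ : M) (y : ModelE m) : Matrix (Fin m) (Fin m) ℝ :=
  Matrix.of fun i j ↦ inner ℝ (coordVec x₀ y i) (coordVec x₀ y j)

/-- The partial derivative `∂ᵢ f` of a real function of the coordinates. -/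
def pderiv (i : Fin m) (f : ModelE m → ℝ) (y : ModelE m) : ℝ :=
  fderiv ℝ f y (EuclideanSpace.single i (1 : ℝ))

/-- The Christoffel symbols
`Γᵏᵢⱼ = ½ gᵏˡ (∂ᵢ g_{jl} + ∂ⱼ g_{il} - ∂ₗ g_{ij})` of the Levi-Civita connection, in the chart
at `x₀`. -/
def christoffel (x₀ : M) (y : ModelE m) (k i j : Fin m) : ℝ :=
  (1 / 2) * ∑ l, (metricMatrix x₀ y)⁻¹ k l *
    (pderiv i (fun z ↦ metricMatrix x₀ z j l) y + pderiv j (fun z ↦ metricMatrix x₀ z i l) y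
      - pderiv l (fun z ↦ metricMatrix x₀ z i j) y)

variable [MeasurableSpace M]

/-- The Riemannian measure on the domain of the chart at `x₀`: the image of
`√(det g_{ij}) dy` under the inverse of the chart. -/
def chartVolume (x₀ : M) : Measure M :=
  (((volume : Measure (ModelE m)).restrict (extChartAt (𝓡 m) x₀).target).withDensity
    fun y ↦ ENNReal.ofReal (Real.sqrt (metricMatrix x₀ y).det)).map (extChartAt (𝓡 m) x₀).symm

variable (m M) in
/-- The Riemannian volume measure `dV_g`. By the change of variables formula, the measures
`chartVolume x₀` agree on overlaps of chart domains, so that their supremum is the measure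
obtained by glueing them. -/
def riemannianVolume : Measure M := ⨆ x₀ : M, chartVolume (m := m) x₀

end Riemannian

/-! ### Energy density, stress-energy tensor and tension field of a map -/

section Maps

variable {m n : ℕ} {M : Type u} [TopologicalSpace M] [ChartedSpace (ModelE m) M]
  [RiemannianBundle (fun x : M ↦ TangentSpace (𝓡 m) x)]
  {N : Type v} [TopologicalSpace N] [ChartedSpace (ModelE n) N]
  [RiemannianBundle (fun y : N ↦ TangentSpace (𝓡 n) y)]

instance instFiniteDimensionalTangentSpace (x : M) : FiniteDimensional ℝ (TangentSpace (𝓡 m) x) :=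
  inferInstanceAs (FiniteDimensional ℝ (ModelE m))

/-- An orthonormal basis of the tangent space at `x`. The quantities below do not depend on the
choice of the orthonormal basis. -/
def tangentBasis (x : M) :
    OrthonormalBasis (Fin (Module.finrank ℝ (TangentSpace (𝓡 m) x))) ℝ (TangentSpace (𝓡 m) x) :=
  stdOrthonormalBasis ℝ (TangentSpace (𝓡 m) x)

variable (m n) in
/-- The squared norm `|du|²` of the differential at `x`. -/
def normSqDu (f : M → N) (x : M) : ℝ :=
  ∑ i, ‖mfderiv (𝓡 m) (𝓡 n) f x (tangentBasis x i)‖ ^ 2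

variable (m n) in
/-- The energy density `e(u) = ½ |du|²`. -/
def energyDensity (f : M → N) (x : M) : ℝ := (1 / 2) * normSqDu m n f x

variable (m n) in
/-- The stress-energy tensor `S(u) = ⟨du ⊗ du⟩ - ½ |du|² g`, a symmetric bilinear form on the
tangent space at `x`. -/
def stressEnergy (f : M → N) (x : M) (v w : TangentSpace (𝓡 m) x) : ℝ :=
  inner ℝ (mfderiv (𝓡 m) (𝓡 n) f x v) (mfderiv (𝓡 m) (𝓡 n) f x w)
    - (1 / 2) * normSqDu m n f x * inner ℝ v w

variable (m n) in
/-- The pointwise norm `|S(u)|` of the stress-energy tensor. -/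
def stressNorm (f : M → N) (x : M) : ℝ :=
  Real.sqrt (∑ i, ∑ j, stressEnergy m n f x (tangentBasis x i) (tangentBasis x j) ^ 2)

/-- The `a`-th component of a map, in the chart at `x₀` of the source and the chart at `y₀` of the
target. -/
def coordMap (f : M → N) (x₀ : M) (y₀ : N) (a : Fin n) (y : ModelE m) : ℝ :=
  (extChartAt (𝓡 n) y₀ (f ((extChartAt (𝓡 m) x₀).symm y))) a

/-- The components of the tension field `𝒯(u) = tr_g ∇du` at `x`, with respect to the chart at `x₀`
of the source and the chart at `y₀` of the target:
`gⁱʲ (∂ᵢ∂ⱼ uᵃ - Γᵏᵢⱼ ∂ₖ uᵃ + Γᵃ_{bc}(u) ∂ᵢ uᵇ ∂ⱼ uᶜ)`. -/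
def tension (f : M → N) (x₀ : M) (y₀ : N) (x : M) : ModelE n :=
  WithLp.toLp 2 fun a ↦
    ∑ i, ∑ j, (metricMatrix x₀ (extChartAt (𝓡 m) x₀ x))⁻¹ i j *
      (pderiv i (pderiv j (coordMap f x₀ y₀ a)) (extChartAt (𝓡 m) x₀ x)
        - ∑ k, christoffel x₀ (extChartAt (𝓡 m) x₀ x) k i j *
            pderiv k (coordMap f x₀ y₀ a) (extChartAt (𝓡 m) x₀ x)
        + ∑ b, ∑ c, christoffel y₀ (extChartAt (𝓡 n) y₀ (f x)) a b c *
            pderiv i (coordMap f x₀ y₀ b) (extChartAt (𝓡 m) x₀ x) *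
            pderiv j (coordMap f x₀ y₀ c) (extChartAt (𝓡 m) x₀ x))

/-- The time interval `[0, T)`, where `T` may be infinite. -/
def timeInterval (T : EReal) : Set ℝ := {t : ℝ | 0 ≤ t ∧ (t : EReal) < T}

variable (m n) in
/-- `u` is a classical solution of harmonic map flow `∂u/∂t = 𝒯(u)` on `M × [0, T)`: it is smooth
there, and the equation holds in all local coordinates. The values `u t` for `t` outside
`[0, T)` are irrelevant. -/
structure IsHarmonicMapFlow (u : ℝ → M → N) (T : EReal) : Prop where
  smooth : ContMDiffOn ((𝓡 m).prod 𝓘(ℝ, ℝ)) (𝓡 n) ∞ (fun z : M × ℝ ↦ u z.2 z.1)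
    (univ ×ˢ timeInterval T)
  equation : ∀ t ∈ timeInterval T, ∀ (x₀ : M) (y₀ : N) (x : M),
    x ∈ (extChartAt (𝓡 m) x₀).source → u t x ∈ (extChartAt (𝓡 n) y₀).source →
      HasDerivWithinAt (fun s : ℝ ↦ extChartAt (𝓡 n) y₀ (u s x)) (tension (m := m) (n := n) (u t) x₀ y₀ x)
        (timeInterval T) t

end Maps

/-! ### Energy on geodesic balls and annuli, and the outer energy scale -/

section Energy

variable {m n : ℕ} {M : Type u} [EMetricSpace M] [ChartedSpace (ModelE m) M]
  [RiemannianBundle (fun x : M ↦ TangentSpace (𝓡 m) x)] [MeasurableSpace M]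
  {N : Type v} [TopologicalSpace N] [ChartedSpace (ModelE n) N]
  [RiemannianBundle (fun y : N ↦ TangentSpace (𝓡 n) y)]

variable (m n) in
/-- The Dirichlet energy `E(u, A) = ∫_A e(u) dV_g` of `u` on a set `A`. -/
def energyOn (f : M → N) (A : Set M) : ℝ≥0∞ :=
  ∫⁻ x in A, ENNReal.ofReal (energyDensity m n f x) ∂(riemannianVolume m M)

variable (m n) in
/-- The norm `‖S(u)‖_{L^q}` over the whole manifold. -/
def stressLq (f : M → N) (q : ℝ) : ℝ≥0∞ :=
  eLpNorm (stressNorm m n f) (ENNReal.ofReal q) (riemannianVolume m M)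

/-- The geodesic ball `B_r(p)`. -/
def gball (p : M) (r : ℝ) : Set M := {x | edist x p < ENNReal.ofReal r}

/-- The annulus `U_r^R(p)`, the ball of radius `R` minus the closed ball of radius `r`. -/
def annulus (p : M) (r R : ℝ) : Set M :=
  gball p R \ {x | edist x p ≤ ENNReal.ofReal r}

variable (m n) in
/-- The outer energy scale `λ_{ε,ρ,p}(u)`: the infimum of all `l ∈ [0, ρ]` such that
`sup_{l < r < ρ} E(u, U_{r/2}^r(p)) < ε`. -/
def energyScale (ε ρ : ℝ) (p : M) (f : M → N) : ℝ :=
  sInf {l : ℝ | l ∈ Icc 0 ρ ∧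
    (⨆ r ∈ Ioo l ρ, energyOn m n f (annulus p (r / 2) r)) < ENNReal.ofReal ε}

end Energy

end HMFlow

end

/-! For a test function `φ` on the surface, a solution of the flow satisfies d/dt ∫ φ e(u) = −∫ φ
|∂ₜu|² + ∫ ⟨Hess φ, S(u)⟩. Indeed ∂ₜu is the tension field and ⟨∂ₜu, du⟩ = div S(u), so the two
derivatives that fall on S(u) can be moved to `φ`. If `φ` is a cutoff at scale r around p, its
Hessian is O(r⁻²) on a set of area O(r²). Hölder's inequality then bounds the last term by Cσ
r^(−2/q), and the first term has a sign. Hence the weighted energy F_r(t) grows at most at the rate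
Cσ r^(−2/q) (`exists_isBallWeight`). Over a time s it grows by at most ε/4 as soon as r ≥
(4Cσs/ε)^(q/2).

The cutoff is 1 on B_{r/4}(p) and is supported in the closed ball of radius r/2, hence away from the
annulus U^r_{r/2}(p). For r < ρ this gives E(u(t), U^r_{r/2}) + F_r(t) ≤ E(u(t), B_ρ)
(`energyOn_annulus_add_le`). In the first statement the right side is at most E(u(t₂), B_R) + ε/2 ≤
F_r(t₂) + ε/2 ≤ F_r(t) + 3ε/4 when r ≥ 4R, so the annulus carries at most 3ε/4.

For the second statement, F_r(t) + Cσ r^(−2/q)(T − t) is nonincreasing in t. Taking its infimum over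
all r and t, and then a pair (r₀, t₁) which almost attains it, shows that with ρ = r₀/4 the energy
of B_ρ exceeds F_r(t) by at most 3ε/8 for all later t and all admissible r < ρ. The concentrated
energy at p thus enters only as an infimum, and no limit of u at time T is used.

The energy identity is proved in coordinates, without connections on pulled back bundles. The only
unknowns are the components G(v, w) = ⟨du v, du w⟩ of the metric pulled back to space-time. By the
Koszul formula (`koszul_pullbackMetric`) the flow equation contracted with du becomes a relation
between the first derivatives of G (`IsHarmonicMapFlow.pullbackMetric_time`). The energy identity is
then a polynomial identity (`divergence_identity`) integrated over a chart. The absolute constant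
comes from cutoffs of the form η(|L(y − z)/r|²), where the linear map L makes the metric almost
Euclidean near a point (`IsChartFrame.isEnergyCutoff`, `exists_isEnergyCutoff`). -/

noncomputable section

namespace HMFlow

universe u v

/-! ### Metrics pulled back by a map. -/

section Pullback

variable {V : Type*} [NormedAddCommGroup V] [NormedSpace ℝ V]
  {n : ℕ} {N : Type v} [TopologicalSpace N] [ChartedSpace (ModelE n) N]

lemma contMDiffOn_mfderivWithin_apply_const [IsManifold (𝓡 n) ∞ N] {f : V → N} {s : Set V}
    (hs : UniqueDiffOn ℝ s) (hf : ContMDiffOn 𝓘(ℝ, V) (𝓡 n) ∞ f s) (v : V) :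
    ContMDiffOn 𝓘(ℝ, V) ((𝓡 n).prod 𝓘(ℝ, ModelE n)) ∞
      (fun z ↦ (⟨f z, mfderivWithin 𝓘(ℝ, V) (𝓡 n) f s z v⟩ :
        TotalSpace (ModelE n) (TangentSpace (𝓡 n) : N → Type _))) s := by
  have h1 := hf.contMDiffOn_tangentMapWithin (m := ∞) (by simp) hs.uniqueMDiffOn
  have h2 : ContMDiffOn 𝓘(ℝ, V) 𝓘(ℝ, V).tangent ∞
      (fun z ↦ (⟨z, v⟩ : TangentBundle 𝓘(ℝ, V) V)) s :=
    contMDiffOn_vectorSpace_iff_contDiffOn.2 contDiffOn_const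
  exact h1.comp h2 (fun z hz ↦ hz)

variable [RiemannianBundle (fun y : N ↦ TangentSpace (𝓡 n) y)]

variable (n) in
/-- The components of the metric pulled back by a map `f` on a subset of a normed space. -/
def pullbackMetric (f : V → N) (s : Set V) (v w z : V) : ℝ :=
  inner ℝ (mfderivWithin 𝓘(ℝ, V) (𝓡 n) f s z v) (mfderivWithin 𝓘(ℝ, V) (𝓡 n) f s z w)

lemma pullbackMetric_comm (f : V → N) (s : Set V) (v w : V) :
    pullbackMetric n f s v w = pullbackMetric n f s w v := by
  ext z
  exact real_inner_comm _ _

lemma pullbackMetric_congr {f g : V → N} {s : Set V} {z : V} (h : f =ᶠ[𝓝[s] z] g)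
    (hz : f z = g z) (v w : V) : pullbackMetric n f s v w z = pullbackMetric n g s v w z := by
  -- The two inner products live on the tangent spaces at `f z` and at `g z`. Seen as a function of
  -- the base point and of two vectors of the model space, the inner product can be rewritten along
  -- `hz`.
  let Φ : N → ModelE n → ModelE n → ℝ := fun y A B ↦
    inner ℝ (show TangentSpace (𝓡 n) y from A) (show TangentSpace (𝓡 n) y from B)
  have h1 : (mfderivWithin 𝓘(ℝ, V) (𝓡 n) f s z : V →L[ℝ] ModelE n) =
      mfderivWithin 𝓘(ℝ, V) (𝓡 n) g s z := h.mfderivWithin_eq hz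
  have h2 : ∀ v : V, (mfderivWithin 𝓘(ℝ, V) (𝓡 n) f s z v : ModelE n) =
      mfderivWithin 𝓘(ℝ, V) (𝓡 n) g s z v :=
    fun v ↦ congrArg (fun A : V →L[ℝ] ModelE n ↦ A v) h1
  change Φ _ _ _ = Φ _ _ _
  exact congr (congr (congrArg Φ hz) (h2 v)) (h2 w)

lemma contDiffOn_pullbackMetric [IsManifold (𝓡 n) ∞ N]
    [IsContMDiffRiemannianBundle (𝓡 n) ∞ (ModelE n) (fun y : N ↦ TangentSpace (𝓡 n) y)]
    {f : V → N} {s : Set V}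
    (hs : UniqueDiffOn ℝ s) (hf : ContMDiffOn 𝓘(ℝ, V) (𝓡 n) ∞ f s) (v w : V) :
    ContDiffOn ℝ ∞ (pullbackMetric n f s v w) s :=
  contMDiffOn_iff_contDiffOn.1
    ((contMDiffOn_mfderivWithin_apply_const hs hf v).inner_bundle
      (contMDiffOn_mfderivWithin_apply_const hs hf w))

end Pullback

/-! ### Differential of a chart and the metric in coordinates. -/

section Chart

variable {m : ℕ} {M : Type u} [TopologicalSpace M] [ChartedSpace (ModelE m) M]

lemma mfderivWithin_extChartAt_symm (x₀ : M) {y : ModelE m}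
    (hy : y ∈ (extChartAt (𝓡 m) x₀).target) :
    mfderivWithin (𝓡 m) (𝓡 m) (extChartAt (𝓡 m) x₀).symm (extChartAt (𝓡 m) x₀).target y =
      mfderiv (𝓡 m) (𝓡 m) (extChartAt (𝓡 m) x₀).symm y :=
  mfderivWithin_of_mem_nhds ((isOpen_extChartAt_target x₀).mem_nhds hy)

lemma mdifferentiableAt_extChartAt_symm [IsManifold (𝓡 m) ∞ M] (x₀ : M) {y : ModelE m}
    (hy : y ∈ (extChartAt (𝓡 m) x₀).target) :
    MDifferentiableAt (𝓡 m) (𝓡 m) (extChartAt (𝓡 m) x₀).symm y :=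
  ((contMDiffOn_extChartAt_symm (n := ∞) x₀).mdifferentiableOn (by simp) y hy).mdifferentiableAt
    ((isOpen_extChartAt_target x₀).mem_nhds hy)

lemma mdifferentiableAt_extChartAt_of_mem [IsManifold (𝓡 m) ∞ M] (x₀ : M) {x : M}
    (hx : x ∈ (extChartAt (𝓡 m) x₀).source) :
    MDifferentiableAt (𝓡 m) (𝓡 m) (extChartAt (𝓡 m) x₀) x :=
  (contMDiffAt_extChartAt' (n := ∞) (by simpa using hx)).mdifferentiableAt (by simp)

lemma mfderiv_extChartAt_comp_symm [IsManifold (𝓡 m) ∞ M] (x₀ : M) {y : ModelE m}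
    (hy : y ∈ (extChartAt (𝓡 m) x₀).target) (v : ModelE m) :
    mfderiv (𝓡 m) (𝓡 m) (extChartAt (𝓡 m) x₀) ((extChartAt (𝓡 m) x₀).symm y)
      (mfderiv (𝓡 m) (𝓡 m) (extChartAt (𝓡 m) x₀).symm y v) = v := by
  have h1 := mdifferentiableAt_extChartAt_symm x₀ hy
  have h2 := mdifferentiableAt_extChartAt_of_mem x₀ ((extChartAt (𝓡 m) x₀).map_target hy)
  have h3 := mfderiv_comp_apply y h2 h1 v
  rw [← h3]
  have h4 : (extChartAt (𝓡 m) x₀ ∘ (extChartAt (𝓡 m) x₀).symm) =ᶠ[𝓝 y] id := by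
    filter_upwards [(isOpen_extChartAt_target x₀).mem_nhds hy] with z hz
    exact (extChartAt (𝓡 m) x₀).right_inv hz
  rw [h4.mfderiv_eq, mfderiv_id]
  rfl

/-- In finite dimension a one-sided inverse is two-sided: the differential of the inverse chart is
injective by the previous lemma, hence surjective. -/
lemma mfderiv_extChartAt_symm_comp [IsManifold (𝓡 m) ∞ M] (x₀ : M) {y : ModelE m}
    (hy : y ∈ (extChartAt (𝓡 m) x₀).target)
    (v : TangentSpace (𝓡 m) ((extChartAt (𝓡 m) x₀).symm y)) :
    mfderiv (𝓡 m) (𝓡 m) (extChartAt (𝓡 m) x₀).symm y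
      (mfderiv (𝓡 m) (𝓡 m) (extChartAt (𝓡 m) x₀) ((extChartAt (𝓡 m) x₀).symm y) v) = v := by
  have hinj : Function.Injective (mfderiv (𝓡 m) (𝓡 m) (extChartAt (𝓡 m) x₀).symm y) :=
    Function.LeftInverse.injective (mfderiv_extChartAt_comp_symm x₀ hy)
  have hsurj : Function.Surjective (mfderiv (𝓡 m) (𝓡 m) (extChartAt (𝓡 m) x₀).symm y) :=
    let A : ModelE m →L[ℝ] ModelE m := mfderiv (𝓡 m) (𝓡 m) (extChartAt (𝓡 m) x₀).symm y
    LinearMap.surjective_of_injective (f := A.toLinearMap) hinj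
  obtain ⟨w, rfl⟩ := hsurj v
  exact congrArg (mfderiv (𝓡 m) (𝓡 m) (extChartAt (𝓡 m) x₀).symm y)
    (mfderiv_extChartAt_comp_symm x₀ hy w)

lemma mfderiv_extChartAt_symm_eq_sum (x₀ : M) (y v : ModelE m) :
    mfderiv (𝓡 m) (𝓡 m) (extChartAt (𝓡 m) x₀).symm y v = ∑ i, v i • coordVec x₀ y i := by
  have hv : v = ∑ i, v i • EuclideanSpace.single i (1 : ℝ) := by
    ext j
    simp [Pi.single_apply]
  conv_lhs => rw [hv]
  exact (map_sum (mfderiv (𝓡 m) (𝓡 m) (extChartAt (𝓡 m) x₀).symm y) _ _).trans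
    (Finset.sum_congr rfl fun i _ ↦ map_smul _ _ _)

variable [RiemannianBundle (fun x : M ↦ TangentSpace (𝓡 m) x)]

lemma inner_mfderiv_extChartAt_symm (x₀ : M) (y v w : ModelE m) :
    inner ℝ (mfderiv (𝓡 m) (𝓡 m) (extChartAt (𝓡 m) x₀).symm y v)
      (mfderiv (𝓡 m) (𝓡 m) (extChartAt (𝓡 m) x₀).symm y w) =
    ∑ i, ∑ j, metricMatrix x₀ y i j * v i * w j := by
  rw [mfderiv_extChartAt_symm_eq_sum, mfderiv_extChartAt_symm_eq_sum, sum_inner]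
  refine Finset.sum_congr rfl fun i _ ↦ ?_
  rw [inner_sum]
  refine Finset.sum_congr rfl fun j _ ↦ ?_
  rw [real_inner_smul_left, real_inner_smul_right]
  simp only [metricMatrix, Matrix.of_apply]
  ring

lemma metricMatrix_symm (x₀ : M) (y : ModelE m) (i j : Fin m) :
    metricMatrix x₀ y i j = metricMatrix x₀ y j i := by
  simp only [metricMatrix, Matrix.of_apply]
  exact real_inner_comm _ _

lemma metricMatrix_posDef [IsManifold (𝓡 m) ∞ M] (x₀ : M) {y : ModelE m}
    (hy : y ∈ (extChartAt (𝓡 m) x₀).target) : (metricMatrix x₀ y).PosDef := by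
  refine Matrix.PosDef.of_dotProduct_mulVec_pos ?_ ?_
  · ext i j
    exact metricMatrix_symm x₀ y j i
  · intro v hv
    have h := inner_mfderiv_extChartAt_symm x₀ y (WithLp.toLp 2 v) (WithLp.toLp 2 v)
    have h0 : mfderiv (𝓡 m) (𝓡 m) (extChartAt (𝓡 m) x₀).symm y (WithLp.toLp 2 v) ≠ 0 := by
      intro h0
      have := mfderiv_extChartAt_comp_symm x₀ hy (WithLp.toLp 2 v)
      rw [h0, map_zero] at this
      exact hv (congrArg WithLp.ofLp this.symm)
    have h1 := real_inner_self_pos.2 h0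
    rw [h] at h1
    simpa [dotProduct, Matrix.mulVec, Finset.mul_sum, mul_comm, mul_left_comm] using h1

lemma contDiffOn_metricMatrix [IsManifold (𝓡 m) ∞ M]
    [IsContMDiffRiemannianBundle (𝓡 m) ∞ (ModelE m) (fun x : M ↦ TangentSpace (𝓡 m) x)]
    (x₀ : M) (i j : Fin m) :
    ContDiffOn ℝ ∞ (fun y ↦ metricMatrix x₀ y i j) (extChartAt (𝓡 m) x₀).target := by
  have h := contDiffOn_pullbackMetric (n := m) (f := (extChartAt (𝓡 m) x₀).symm)
    (isOpen_extChartAt_target (I := 𝓡 m) x₀).uniqueDiffOn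
    (contMDiffOn_extChartAt_symm (n := ∞) x₀)
    (EuclideanSpace.single i (1 : ℝ)) (EuclideanSpace.single j (1 : ℝ))
  refine h.congr fun y hy ↦ ?_
  simp only [metricMatrix, Matrix.of_apply, pullbackMetric, coordVec]
  rw [mfderivWithin_extChartAt_symm x₀ hy]

end Chart

/-! ### The Koszul formula for a pulled back metric. -/

section Koszul

variable {n : ℕ}

lemma pderiv_sum_smul (h : ModelE n → ℝ) (y v : ModelE n) :
    fderiv ℝ h y v = ∑ c, pderiv c h y * v c := by
  have hv : v = ∑ i, v i • EuclideanSpace.single i (1 : ℝ) := by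
    ext j
    simp [Pi.single_apply]
  conv_lhs => rw [hv, map_sum]
  simp [pderiv, mul_comm]

variable {V : Type*} [NormedAddCommGroup V] [NormedSpace ℝ V]

/-- The algebra behind the Koszul formula for a pulled back metric. -/
lemma koszul_algebra (h : Fin n → Fin n → ℝ) (hs : ∀ a b, h a b = h b a)
    (dh : Fin n → Fin n → Fin n → ℝ)
    (Γ : Fin n → Fin n → Fin n → ℝ)
    (hΓ : ∀ d b c, ∑ a, h a d * Γ a b c = (1 / 2) * (dh b c d + dh c b d - dh d b c))
    (p q r Hpq Hpr Hqr : Fin n → ℝ) :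
    (1 / 2) * (
      (∑ a, ∑ b, ((∑ c, dh c a b * p c) * q a * r b + h a b * Hpq a * r b + h a b * q a * Hpr b))
      + (∑ a, ∑ b, ((∑ c, dh c a b * q c) * p a * r b + h a b * Hpq a * r b
          + h a b * p a * Hqr b))
      - (∑ a, ∑ b, ((∑ c, dh c a b * r c) * p a * q b + h a b * Hpr a * q b
          + h a b * p a * Hqr b))) =
    ∑ a, ∑ d, h a d * (Hpq a + ∑ b, ∑ c, Γ a b c * p b * q c) * r d := by
  -- Here `p`, `q`, `r` are the first derivatives of the map and `Hpq`, `Hpr`, `Hqr` its second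
  -- derivatives. In the alternating sum the terms with `Hpr` and `Hqr` cancel by symmetry of `h`,
  -- and those with `Hpq` occur twice.
  have e0 : ∑ a, ∑ b, h a b * q a * Hpr b = ∑ a, ∑ b, h a b * Hpr a * q b := by
    rw [Finset.sum_comm]
    refine Finset.sum_congr rfl fun a _ ↦ Finset.sum_congr rfl fun b _ ↦ ?_
    rw [hs b a]; ring
  have e1 : ∑ a, ∑ b, (∑ c, dh c a b * p c) * q a * r b =
      ∑ d, ∑ b, ∑ c, dh b c d * (p b * q c * r d) := by
    rw [Finset.sum_comm]
    refine Finset.sum_congr rfl fun d _ ↦ ?_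
    rw [Finset.sum_comm]
    refine Finset.sum_congr rfl fun b _ ↦ ?_
    rw [Finset.sum_mul, Finset.sum_mul]
    exact Finset.sum_congr rfl fun c _ ↦ by ring
  have e2 : ∑ a, ∑ b, (∑ c, dh c a b * q c) * p a * r b =
      ∑ d, ∑ b, ∑ c, dh c b d * (p b * q c * r d) := by
    rw [Finset.sum_comm]
    refine Finset.sum_congr rfl fun d _ ↦ Finset.sum_congr rfl fun b _ ↦ ?_
    rw [Finset.sum_mul, Finset.sum_mul]
    exact Finset.sum_congr rfl fun c _ ↦ by ring
  have e3 : ∑ a, ∑ b, (∑ c, dh c a b * r c) * p a * q b =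
      ∑ d, ∑ b, ∑ c, dh d b c * (p b * q c * r d) := by
    rw [Finset.sum_comm (γ := Fin n) (s := Finset.univ) (t := Finset.univ)
      (f := fun d b ↦ ∑ c, dh d b c * (p b * q c * r d))]
    refine Finset.sum_congr rfl fun b _ ↦ ?_
    rw [Finset.sum_comm]
    refine Finset.sum_congr rfl fun c _ ↦ ?_
    rw [Finset.sum_mul, Finset.sum_mul]
    exact Finset.sum_congr rfl fun c _ ↦ by ring
  have e4 : ∑ a, ∑ d, h a d * (∑ b, ∑ c, Γ a b c * p b * q c) * r d =
      ∑ d, ∑ b, ∑ c, (1 / 2) * (dh b c d + dh c b d - dh d b c) * (p b * q c * r d) := by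
    rw [Finset.sum_comm]
    refine Finset.sum_congr rfl fun d _ ↦ ?_
    simp only [Finset.mul_sum, Finset.sum_mul]
    rw [Finset.sum_comm]
    refine Finset.sum_congr rfl fun b _ ↦ ?_
    rw [Finset.sum_comm]
    refine Finset.sum_congr rfl fun c _ ↦ ?_
    rw [← hΓ, Finset.sum_mul]
    exact Finset.sum_congr rfl fun a _ ↦ by ring
  have e5 : ∑ d, ∑ b, ∑ c, (1 / 2) * (dh b c d + dh c b d - dh d b c) * (p b * q c * r d) =
      (1 / 2) * (∑ d, ∑ b, ∑ c, dh b c d * (p b * q c * r d)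
        + ∑ d, ∑ b, ∑ c, dh c b d * (p b * q c * r d)
        - ∑ d, ∑ b, ∑ c, dh d b c * (p b * q c * r d)) := by
    simp only [← Finset.sum_add_distrib, ← Finset.sum_sub_distrib, Finset.mul_sum]
    refine Finset.sum_congr rfl fun d _ ↦ Finset.sum_congr rfl fun b _ ↦
      Finset.sum_congr rfl fun c _ ↦ by ring
  simp only [mul_add, add_mul, Finset.sum_add_distrib]
  rw [e4, e5, e0, e1, e2, e3]
  ring

/-- The product and chain rules, with the result arranged like the brackets of `koszul_algebra`. -/
lemma hasFDerivAt_sum_metric {h : Fin n → Fin n → ModelE n → ℝ} {W : V → ModelE n} {z₀ : V}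
    (hh : ∀ a b, DifferentiableAt ℝ (h a b) (W z₀)) (hW : ContDiffAt ℝ 2 W z₀) (v w k : V) :
    fderiv ℝ (fun z ↦ ∑ a, ∑ b, h a b (W z) * fderiv ℝ (fun x ↦ W x a) z v *
        fderiv ℝ (fun x ↦ W x b) z w) z₀ k =
      ∑ a, ∑ b, ((∑ c, pderiv c (h a b) (W z₀) * fderiv ℝ (fun x ↦ W x c) z₀ k) *
          fderiv ℝ (fun x ↦ W x a) z₀ v * fderiv ℝ (fun x ↦ W x b) z₀ w
        + h a b (W z₀) * fderiv ℝ (fun z ↦ fderiv ℝ (fun x ↦ W x a) z v) z₀ k *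
          fderiv ℝ (fun x ↦ W x b) z₀ w
        + h a b (W z₀) * fderiv ℝ (fun x ↦ W x a) z₀ v *
          fderiv ℝ (fun z ↦ fderiv ℝ (fun x ↦ W x b) z w) z₀ k) := by
  have hWa : ∀ a, ContDiffAt ℝ 2 (fun x ↦ W x a) z₀ := fun a ↦
    (contDiffAt_piLp (p := 2)).1 hW a
  have hd : ∀ a v, DifferentiableAt ℝ (fun z ↦ fderiv ℝ (fun x ↦ W x a) z v) z₀ := fun a v ↦
    (((hWa a).fderiv_right (m := 1) (by norm_num)).differentiableAt (by simp)).clm_apply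
      (differentiableAt_const v)
  have hWd : DifferentiableAt ℝ W z₀ := hW.differentiableAt (by simp)
  have hhW : ∀ a b, HasFDerivAt (fun z ↦ h a b (W z))
      ((fderiv ℝ (h a b) (W z₀)).comp (fderiv ℝ W z₀)) z₀ := fun a b ↦
    (hh a b).hasFDerivAt.comp z₀ hWd.hasFDerivAt
  have hcomp : ∀ c, fderiv ℝ (fun x ↦ W x c) z₀ k = (fderiv ℝ W z₀ k) c := by
    intro c
    have := ((EuclideanSpace.proj c : ModelE n →L[ℝ] ℝ).hasFDerivAt.comp z₀ hWd.hasFDerivAt).fderiv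
    exact congrArg (fun A : V →L[ℝ] ℝ ↦ A k) this
  have key : HasFDerivAt (fun z ↦ ∑ a, ∑ b, h a b (W z) * fderiv ℝ (fun x ↦ W x a) z v *
      fderiv ℝ (fun x ↦ W x b) z w) _ z₀ := HasFDerivAt.fun_sum (u := Finset.univ) fun a _ ↦
    HasFDerivAt.fun_sum (u := Finset.univ) fun b _ ↦
      ((hhW a b).mul (hd a v).hasFDerivAt).mul (hd b w).hasFDerivAt
  rw [key.fderiv]
  simp only [_root_.sum_apply, _root_.add_apply,
    _root_.smul_apply, ContinuousLinearMap.comp_apply, smul_eq_mul, Pi.mul_apply]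
  refine Finset.sum_congr rfl fun a _ ↦ Finset.sum_congr rfl fun b _ ↦ ?_
  rw [pderiv_sum_smul (h a b)]
  simp only [hcomp]
  ring

/-- Lowering the upper index cancels the inverse metric. This is the form in which the Christoffel
symbols enter `koszul_algebra`. -/
lemma sum_metricMatrix_mul_christoffel {N : Type v} [TopologicalSpace N]
    [ChartedSpace (ModelE n) N] [IsManifold (𝓡 n) ∞ N]
    [RiemannianBundle (fun y : N ↦ TangentSpace (𝓡 n) y)] (y₀ : N) {y : ModelE n}
    (hy : y ∈ (extChartAt (𝓡 n) y₀).target) (d b c : Fin n) :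
    ∑ a, metricMatrix y₀ y a d * christoffel y₀ y a b c =
      (1 / 2) * (pderiv b (fun z ↦ metricMatrix y₀ z c d) y
        + pderiv c (fun z ↦ metricMatrix y₀ z b d) y
        - pderiv d (fun z ↦ metricMatrix y₀ z b c) y) := by
  have hu : IsUnit (metricMatrix y₀ y).det :=
    ((metricMatrix_posDef y₀ hy).det_pos.ne').isUnit
  have h1 : ∀ l, ∑ a, metricMatrix y₀ y d a * (metricMatrix y₀ y)⁻¹ a l =
      if d = l then 1 else 0 := by
    intro l
    rw [← Matrix.mul_apply, Matrix.mul_nonsing_inv _ hu, Matrix.one_apply]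
  simp only [christoffel, Finset.mul_sum]
  rw [Finset.sum_comm]
  have h2 : ∀ l, ∑ a, metricMatrix y₀ y a d * (1 / 2 * ((metricMatrix y₀ y)⁻¹ a l *
      (pderiv b (fun z ↦ metricMatrix y₀ z c l) y + pderiv c (fun z ↦ metricMatrix y₀ z b l) y
      - pderiv l (fun z ↦ metricMatrix y₀ z b c) y))) = if d = l then 
      (1 / 2) * (pderiv b (fun z ↦ metricMatrix y₀ z c d) y
        + pderiv c (fun z ↦ metricMatrix y₀ z b d) y
        - pderiv d (fun z ↦ metricMatrix y₀ z b c) y) else 0 := by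
    intro l
    have : ∀ a, metricMatrix y₀ y a d * (1 / 2 * ((metricMatrix y₀ y)⁻¹ a l *
      (pderiv b (fun z ↦ metricMatrix y₀ z c l) y + pderiv c (fun z ↦ metricMatrix y₀ z b l) y
      - pderiv l (fun z ↦ metricMatrix y₀ z b c) y))) =
      (metricMatrix y₀ y d a * (metricMatrix y₀ y)⁻¹ a l) * (1 / 2 * 
      (pderiv b (fun z ↦ metricMatrix y₀ z c l) y + pderiv c (fun z ↦ metricMatrix y₀ z b l) y
      - pderiv l (fun z ↦ metricMatrix y₀ z b c) y)) := by
      intro a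
      rw [metricMatrix_symm y₀ y a d]
      ring
    rw [Finset.sum_congr rfl fun a _ ↦ this a, ← Finset.sum_mul, h1]
    split_ifs with hdl
    · subst hdl; ring
    · ring
  rw [Finset.sum_congr rfl fun l _ ↦ h2 l]
  simp

end Koszul

/-! ### The Koszul formula in a chart of the target. -/

section PullbackChart

variable {V : Type*} [NormedAddCommGroup V] [NormedSpace ℝ V]
  {n : ℕ} {N : Type v} [TopologicalSpace N] [ChartedSpace (ModelE n) N] [IsManifold (𝓡 n) ∞ N]

lemma contDiffAt_extChartAt_comp {f : V → N} {z₀ : V} (y₀ : N)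
    (hf : ContMDiffAt 𝓘(ℝ, V) (𝓡 n) ∞ f z₀) (h0 : f z₀ ∈ (extChartAt (𝓡 n) y₀).source) :
    ContDiffAt ℝ ∞ (fun z ↦ extChartAt (𝓡 n) y₀ (f z)) z₀ :=
  contMDiffAt_iff_contDiffAt.1
    ((contMDiffAt_extChartAt' (n := ∞) (I := 𝓡 n) (x := y₀) (by simpa using h0)).comp z₀ hf)

lemma fderiv_component {W : V → ModelE n} {z : V} (hW : DifferentiableAt ℝ W z) (v : V)
    (a : Fin n) : fderiv ℝ (fun x ↦ W x a) z v = (fderiv ℝ W z v) a :=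
  congrArg (fun A : V →L[ℝ] ℝ ↦ A v)
    ((EuclideanSpace.proj a : ModelE n →L[ℝ] ℝ).hasFDerivAt.comp z hW.hasFDerivAt).fderiv

variable [RiemannianBundle (fun y : N ↦ TangentSpace (𝓡 n) y)]

/-- The pulled back metric in a chart of the target. -/
lemma pullbackMetric_eq_sum {f : V → N} {s : Set V} {z : V} (y₀ : N) (hs : s ∈ 𝓝 z)
    (hf : ContMDiffAt 𝓘(ℝ, V) (𝓡 n) ∞ f z) (h0 : f z ∈ (extChartAt (𝓡 n) y₀).source) (v w : V) :
    pullbackMetric n f s v w z = ∑ a, ∑ b,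
      metricMatrix y₀ (extChartAt (𝓡 n) y₀ (f z)) a b *
        fderiv ℝ (fun x ↦ extChartAt (𝓡 n) y₀ (f x) a) z v *
        fderiv ℝ (fun x ↦ extChartAt (𝓡 n) y₀ (f x) b) z w := by
  set W : V → ModelE n := fun z ↦ extChartAt (𝓡 n) y₀ (f z) with hWdef
  have hW : DifferentiableAt ℝ W z :=
    (contDiffAt_extChartAt_comp y₀ hf h0).differentiableAt (by simp)
  have ht : W z ∈ (extChartAt (𝓡 n) y₀).target := (extChartAt (𝓡 n) y₀).map_source h0
  have h1 : f =ᶠ[𝓝[s] z] (extChartAt (𝓡 n) y₀).symm ∘ W := by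
    filter_upwards [mem_nhdsWithin_of_mem_nhds (hf.continuousAt.preimage_mem_nhds
      ((isOpen_extChartAt_source (I := 𝓡 n) y₀).mem_nhds h0))] with x hx
    exact ((extChartAt (𝓡 n) y₀).left_inv hx).symm
  have h2 : ∀ u : V, mfderivWithin 𝓘(ℝ, V) (𝓡 n) ((extChartAt (𝓡 n) y₀).symm ∘ W) s z u =
      mfderiv (𝓡 n) (𝓡 n) (extChartAt (𝓡 n) y₀).symm (W z) (fderiv ℝ W z u) := by
    intro u
    rw [mfderivWithin_of_mem_nhds hs,
      mfderiv_comp_apply z (mdifferentiableAt_extChartAt_symm y₀ ht)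
      (mdifferentiableAt_iff_differentiableAt.2 hW) u, mfderiv_eq_fderiv]
    rfl
  have h3 := inner_mfderiv_extChartAt_symm y₀ (W z) (fderiv ℝ W z v) (fderiv ℝ W z w)
  rw [pullbackMetric_congr h1 ((extChartAt (𝓡 n) y₀).left_inv h0).symm, pullbackMetric, h2, h2]
  refine h3.trans ?_
  have h6 : ∀ a u, fderiv ℝ (fun x ↦ extChartAt (𝓡 n) y₀ (f x) a) z u = (fderiv ℝ W z u) a :=
    fun a u ↦ fderiv_component hW u a
  simp only [h6]
  rfl

/-- The Koszul formula for the pulled back metric, in a chart of the target. -/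
lemma koszul_pullbackMetric
    [IsContMDiffRiemannianBundle (𝓡 n) ∞ (ModelE n) (fun y : N ↦ TangentSpace (𝓡 n) y)]
    {f : V → N} {s : Set V} {z : V} (y₀ : N) (hs : s ∈ 𝓝 z)
    (hf : ∀ᶠ x in 𝓝 z, ContMDiffAt 𝓘(ℝ, V) (𝓡 n) ∞ f x)
    (h0 : f z ∈ (extChartAt (𝓡 n) y₀).source) (i j k : V) :
    (1 / 2) * (fderiv ℝ (pullbackMetric n f s j k) z i + fderiv ℝ (pullbackMetric n f s i k) z j
      - fderiv ℝ (pullbackMetric n f s i j) z k) =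
    ∑ a, ∑ d, metricMatrix y₀ (extChartAt (𝓡 n) y₀ (f z)) a d *
      (fderiv ℝ (fun x ↦ fderiv ℝ (fun x ↦ extChartAt (𝓡 n) y₀ (f x) a) x j) z i +
        ∑ b, ∑ c, christoffel y₀ (extChartAt (𝓡 n) y₀ (f z)) a b c *
          fderiv ℝ (fun x ↦ extChartAt (𝓡 n) y₀ (f x) b) z i *
          fderiv ℝ (fun x ↦ extChartAt (𝓡 n) y₀ (f x) c) z j) *
      fderiv ℝ (fun x ↦ extChartAt (𝓡 n) y₀ (f x) d) z k := by
  set W : V → ModelE n := fun z ↦ extChartAt (𝓡 n) y₀ (f z) with hWdef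
  have hW : ContDiffAt ℝ ∞ W z := contDiffAt_extChartAt_comp y₀ hf.self_of_nhds h0
  have hW2 : ContDiffAt ℝ 2 W z := hW.of_le ENat.LEInfty.out
  have ht : W z ∈ (extChartAt (𝓡 n) y₀).target := (extChartAt (𝓡 n) y₀).map_source h0
  have hh : ∀ a b, DifferentiableAt ℝ (fun y ↦ metricMatrix y₀ y a b) (W z) := fun a b ↦
    ((contDiffOn_metricMatrix y₀ a b).contDiffAt
      ((isOpen_extChartAt_target y₀).mem_nhds ht)).differentiableAt (by simp)
  have hG : ∀ v w, pullbackMetric n f s v w =ᶠ[𝓝 z] fun x ↦ ∑ a, ∑ b,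
      metricMatrix y₀ (W x) a b * fderiv ℝ (fun x ↦ W x a) x v * fderiv ℝ (fun x ↦ W x b) x w := by
    intro v w
    filter_upwards [hf, eventually_mem_nhds_iff.2 hs, hf.self_of_nhds.continuousAt.preimage_mem_nhds
      ((isOpen_extChartAt_source (I := 𝓡 n) y₀).mem_nhds h0)] with x h1 h2 h3
    exact pullbackMetric_eq_sum y₀ h2 h1 h3 v w
  have hsymm : ∀ a v w, fderiv ℝ (fun x ↦ fderiv ℝ (fun x ↦ W x a) x v) z w =
      fderiv ℝ (fun x ↦ fderiv ℝ (fun x ↦ W x a) x w) z v := by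
    intro a v w
    have hWa : ContDiffAt ℝ 2 (fun x ↦ W x a) z := (contDiffAt_piLp (p := 2)).1 hW2 a
    have hd := (hWa.fderiv_right (m := 1) (by norm_num)).differentiableAt (by simp)
    have e : ∀ v w, fderiv ℝ (fun x ↦ fderiv ℝ (fun x ↦ W x a) x v) z w =
        fderiv ℝ (fderiv ℝ (fun x ↦ W x a)) z w v := by
      intro v w
      rw [fderiv_clm_apply hd (differentiableAt_const v)]
      simp
    rw [e, e]
    exact hWa.isSymmSndFDerivAt (by simp) w v
  rw [(hG j k).fderiv_eq, (hG i k).fderiv_eq, (hG i j).fderiv_eq,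
    hasFDerivAt_sum_metric hh hW2, hasFDerivAt_sum_metric hh hW2, hasFDerivAt_sum_metric hh hW2]
  have key := koszul_algebra (fun a b ↦ metricMatrix y₀ (W z) a b)
    (fun a b ↦ metricMatrix_symm y₀ (W z) a b)
    (fun c a b ↦ pderiv c (fun y ↦ metricMatrix y₀ y a b) (W z))
    (christoffel y₀ (W z)) (fun d b c ↦ sum_metricMatrix_mul_christoffel y₀ ht d b c)
    (fun a ↦ fderiv ℝ (fun x ↦ W x a) z i) (fun a ↦ fderiv ℝ (fun x ↦ W x a) z j)
    (fun a ↦ fderiv ℝ (fun x ↦ W x a) z k)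
    (fun a ↦ fderiv ℝ (fun x ↦ fderiv ℝ (fun x ↦ W x a) x j) z i)
    (fun a ↦ fderiv ℝ (fun x ↦ fderiv ℝ (fun x ↦ W x a) x k) z i)
    (fun a ↦ fderiv ℝ (fun x ↦ fderiv ℝ (fun x ↦ W x a) x k) z j)
  simp only [hsymm _ i j, hsymm _ i k, hsymm _ j k] at key ⊢
  exact key

end PullbackChart

/-! ### Space-time slices and the time interval. -/

lemma isOpen_extChartAt_target_model {m : ℕ} {M : Type u} [TopologicalSpace M]
    [ChartedSpace (ModelE m) M] (x₀ : M) : IsOpen (extChartAt (𝓡 m) x₀).target :=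
  isOpen_extChartAt_target x₀

lemma fderiv_slice_left {E F G : Type*} [NormedAddCommGroup E] [NormedSpace ℝ E]
    [NormedAddCommGroup F] [NormedSpace ℝ F] [NormedAddCommGroup G] [NormedSpace ℝ G]
    {f : E × F → G} {y : E} {t : F} (hf : DifferentiableAt ℝ f (y, t)) (v : E) :
    fderiv ℝ (fun y' ↦ f (y', t)) y v = fderiv ℝ f (y, t) (v, 0) := by
  have h : HasFDerivAt (fun y' : E ↦ (y', t)) (ContinuousLinearMap.inl ℝ E F) y :=
    hasFDerivAt_prodMk_left y t
  have := (hf.hasFDerivAt.comp y h).fderiv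
  exact congrArg (fun A : E →L[ℝ] G ↦ A v) this

lemma hasDerivAt_slice_right {E G : Type*} [NormedAddCommGroup E] [NormedSpace ℝ E]
    [NormedAddCommGroup G] [NormedSpace ℝ G]
    {f : E × ℝ → G} {y : E} {t : ℝ} (hf : DifferentiableAt ℝ f (y, t)) :
    HasDerivAt (fun s ↦ f (y, s)) (fderiv ℝ f (y, t) (0, 1)) t := by
  have h : HasFDerivAt (fun s : ℝ ↦ (y, s)) (ContinuousLinearMap.inr ℝ E ℝ) t :=
    hasFDerivAt_prodMk_right y t
  have := (hf.hasFDerivAt.comp t h).hasDerivAt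
  simp only [ContinuousLinearMap.comp_apply, ContinuousLinearMap.inr_apply] at this
  exact this

/-- Contraction with `h` and `r` is a linear functional of the index `a`, so it passes through the
trace over `i` and `j`. The second derivatives `A` and the target Christoffel terms `B` are kept
together because `koszul_pullbackMetric` produces exactly their sum. -/
lemma sum_contract_tension {m n : ℕ} (h : Fin n → Fin n → ℝ) (r : Fin n → ℝ)
    (g : Fin m → Fin m → ℝ) (A B : Fin m → Fin m → Fin n → ℝ) (Γ : Fin m → Fin m → Fin m → ℝ)
    (P : Fin m → Fin n → ℝ) :
    ∑ a, ∑ b, h a b * (∑ i, ∑ j, g i j * (A i j a - ∑ k, Γ k i j * P k a + B i j a)) * r b =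
      ∑ i, ∑ j, g i j * (∑ a, ∑ b, h a b * (A i j a + B i j a) * r b
        - ∑ k, Γ k i j * ∑ a, ∑ b, h a b * P k a * r b) := by
  let φ : (Fin n → ℝ) →ₗ[ℝ] ℝ := ∑ a, (∑ b, h a b * r b) • LinearMap.proj a
  have hφ : ∀ X : Fin n → ℝ, ∑ a, ∑ b, h a b * X a * r b = φ X := by
    intro X
    simp only [φ, LinearMap.sum_apply, LinearMap.smul_apply, LinearMap.proj_apply, smul_eq_mul,
      Finset.sum_mul]
    exact Finset.sum_congr rfl fun a _ ↦ Finset.sum_congr rfl fun b _ ↦ by ring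
  have e1 : (fun a ↦ ∑ i, ∑ j, g i j * (A i j a - ∑ k, Γ k i j * P k a + B i j a)) =
      ∑ i, ∑ j, g i j • ((A i j + B i j) - ∑ k, Γ k i j • P k) := by
    ext a
    simp only [Finset.sum_apply, Pi.smul_apply, Pi.sub_apply, Pi.add_apply, smul_eq_mul]
    exact Finset.sum_congr rfl fun i _ ↦ Finset.sum_congr rfl fun j _ ↦ by ring
  have e2 : ∀ i j, ∑ a, ∑ b, h a b * (A i j a + B i j a) * r b = φ (A i j + B i j) :=
    fun i j ↦ hφ (A i j + B i j)
  simp only [e2, hφ]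
  rw [e1]
  simp only [map_sum, map_sub, map_smul, smul_eq_mul]

lemma convex_timeInterval (T : EReal) : Convex ℝ (timeInterval T) := by
  refine Set.OrdConnected.convex ⟨fun a ha b hb c hc ↦ ⟨ha.1.trans hc.1, ?_⟩⟩
  exact lt_of_le_of_lt (by exact_mod_cast hc.2) hb.2

lemma timeInterval_mem_nhds {T : EReal} {t : ℝ} (h0 : 0 < t) (hT : (t : EReal) < T) :
    timeInterval T ∈ 𝓝 t := by
  have h1 : ∀ᶠ s : ℝ in 𝓝 t, (s : EReal) < T :=
    (continuous_coe_real_ereal.tendsto t).eventually_lt_const hT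
  filter_upwards [h1, lt_mem_nhds h0] with s hs1 hs2 using ⟨hs2.le, hs1⟩

/-- Needed for derivatives within the interval at its left end `0`. For `T ≤ 0` the interval is
empty. -/
lemma uniqueDiffOn_timeInterval (T : EReal) : UniqueDiffOn ℝ (timeInterval T) := by
  by_cases h : 0 < T
  · refine uniqueDiffOn_convex (convex_timeInterval T) ?_
    obtain ⟨t, h0, hT⟩ := EReal.lt_iff_exists_real_btwn.1 h
    exact ⟨t, mem_interior_iff_mem_nhds.2 (timeInterval_mem_nhds (by exact_mod_cast h0) hT)⟩
  · have : timeInterval T = ∅ := by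
      ext t
      simp only [timeInterval, mem_ofPred_eq, mem_empty_iff_false, iff_false, not_and]
      intro h0 hT
      exact h (lt_of_le_of_lt (by exact_mod_cast h0) hT)
    rw [this]
    exact uniqueDiffOn_empty

/-! ### The flow equation in terms of the pulled back space-time metric. -/

section Flow

variable {m n : ℕ} {M : Type u} [TopologicalSpace M] [ChartedSpace (ModelE m) M]
  {N : Type v} [TopologicalSpace N] [ChartedSpace (ModelE n) N]

/-- A time-dependent map in a chart of the source, as a function of space and time. -/
def localMap (u : ℝ → M → N) (x₀ : M) (z : ModelE m × ℝ) : N :=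
  u z.2 ((extChartAt (𝓡 m) x₀).symm z.1)

variable (m) in
/-- The domain of a time-dependent map in a chart of the source. -/
def localDomain (x₀ : M) (T : EReal) : Set (ModelE m × ℝ) :=
  (extChartAt (𝓡 m) x₀).target ×ˢ timeInterval T

lemma uniqueDiffOn_localDomain (x₀ : M) (T : EReal) : UniqueDiffOn ℝ (localDomain m x₀ T) :=
  (isOpen_extChartAt_target_model x₀).uniqueDiffOn.prod (uniqueDiffOn_timeInterval T)

lemma localDomain_mem_nhds {x₀ : M} {T : EReal} {y : ModelE m} {t : ℝ}
    (hy : y ∈ (extChartAt (𝓡 m) x₀).target) (h0 : 0 < t) (hT : (t : EReal) < T) :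
    localDomain m x₀ T ∈ 𝓝 (y, t) :=
  prod_mem_nhds ((isOpen_extChartAt_target_model x₀).mem_nhds hy) (timeInterval_mem_nhds h0 hT)

variable [IsManifold (𝓡 m) ∞ M]

lemma contMDiffOn_localMap {u : ℝ → M → N} {T : EReal}
    (hu : ContMDiffOn ((𝓡 m).prod 𝓘(ℝ, ℝ)) (𝓡 n) ∞ (fun z : M × ℝ ↦ u z.2 z.1)
      (univ ×ˢ timeInterval T)) (x₀ : M) :
    ContMDiffOn 𝓘(ℝ, ModelE m × ℝ) (𝓡 n) ∞ (localMap u x₀) (localDomain m x₀ T) := by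
  have h1 : ContMDiffOn 𝓘(ℝ, ModelE m × ℝ) (𝓡 m) ∞
      (fun z : ModelE m × ℝ ↦ (extChartAt (𝓡 m) x₀).symm z.1) (localDomain m x₀ T) :=
    (contMDiffOn_extChartAt_symm (n := ∞) x₀).comp contDiff_fst.contMDiff.contMDiffOn
      (fun z hz ↦ hz.1)
  have h2 : ContMDiffOn 𝓘(ℝ, ModelE m × ℝ) 𝓘(ℝ, ℝ) ∞
      (fun z : ModelE m × ℝ ↦ z.2) (localDomain m x₀ T) :=
    contDiff_snd.contMDiff.contMDiffOn
  exact hu.comp (h1.prodMk h2) (fun z hz ↦ ⟨mem_univ _, hz.2⟩)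

variable [IsManifold (𝓡 n) ∞ N] [RiemannianBundle (fun x : M ↦ TangentSpace (𝓡 m) x)]
  [RiemannianBundle (fun y : N ↦ TangentSpace (𝓡 n) y)]

/-- The coordinate vector fields of space in space-time. -/
def spaceVec (i : Fin m) : ModelE m × ℝ := (EuclideanSpace.single i (1 : ℝ), 0)

/-- The harmonic map flow equation, contracted with the differential of the solution. -/
lemma IsHarmonicMapFlow.pullbackMetric_time
    [IsContMDiffRiemannianBundle (𝓡 n) ∞ (ModelE n) (fun y : N ↦ TangentSpace (𝓡 n) y)]
    {u : ℝ → M → N} {T : EReal} (hu : IsHarmonicMapFlow m n u T) (x₀ : M)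
    {y : ModelE m} {t : ℝ} (hy : y ∈ (extChartAt (𝓡 m) x₀).target) (h0 : 0 < t)
    (hT : (t : EReal) < T) (γ : ModelE m × ℝ) :
    pullbackMetric n (localMap u x₀) (localDomain m x₀ T) (0, 1) γ (y, t) =
      ∑ i, ∑ j, (metricMatrix x₀ y)⁻¹ i j * (
        (1 / 2) * (
          fderiv ℝ (pullbackMetric n (localMap u x₀) (localDomain m x₀ T) (spaceVec j) γ) (y, t)
            (spaceVec i)
          + fderiv ℝ (pullbackMetric n (localMap u x₀) (localDomain m x₀ T) (spaceVec i) γ) (y, t)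
            (spaceVec j)
          - fderiv ℝ (pullbackMetric n (localMap u x₀) (localDomain m x₀ T) (spaceVec i)
            (spaceVec j)) (y, t) γ)
        - ∑ k, christoffel x₀ y k i j *
          pullbackMetric n (localMap u x₀) (localDomain m x₀ T) (spaceVec k) γ (y, t)) := by
  set f : ModelE m × ℝ → N := localMap u x₀ with hfdef
  set s : Set (ModelE m × ℝ) := localDomain m x₀ T with hsdef
  set x := (extChartAt (𝓡 m) x₀).symm y with hx
  -- The target chart centred at the value `u t x` contains the nearby values. It drops out of the
  -- final formula, which mentions only the pulled back metric.
  set y₀ : N := u t x with hy₀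
  have hs : s ∈ 𝓝 (y, t) := localDomain_mem_nhds hy h0 hT
  have hsm : ∀ᶠ z in 𝓝 (y, t), ContMDiffAt 𝓘(ℝ, ModelE m × ℝ) (𝓡 n) ∞ f z := by
    filter_upwards [eventually_mem_nhds_iff.2 hs] with z hz
    exact (contMDiffOn_localMap hu.smooth x₀).contMDiffAt hz
  have hsrc : f (y, t) ∈ (extChartAt (𝓡 n) y₀).source := mem_extChartAt_source y₀
  have hsrc' : ∀ᶠ z in 𝓝 (y, t), f z ∈ (extChartAt (𝓡 n) y₀).source :=
    hsm.self_of_nhds.continuousAt.preimage_mem_nhds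
      ((isOpen_extChartAt_source (I := 𝓡 n) y₀).mem_nhds hsrc)
  set w : Fin n → ModelE m × ℝ → ℝ := fun a z ↦ extChartAt (𝓡 n) y₀ (f z) a with hw
  have hW : ∀ᶠ z in 𝓝 (y, t), ContDiffAt ℝ ∞ (fun z ↦ extChartAt (𝓡 n) y₀ (f z)) z := by
    filter_upwards [hsm, hsrc'] with z h1 h2
    exact contDiffAt_extChartAt_comp y₀ h1 h2
  have hwa : ∀ a, ∀ᶠ z in 𝓝 (y, t), ContDiffAt ℝ ∞ (w a) z := by
    intro a
    filter_upwards [hW] with z hz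
    exact (contDiffAt_piLp (p := 2)).1 hz a
  have hslice : Tendsto (fun y' : ModelE m ↦ (y', t)) (𝓝 y) (𝓝 (y, t)) :=
    (Continuous.prodMk_left t).tendsto y
  have hc : ∀ a, coordMap (u t) x₀ y₀ a = fun y' ↦ w a (y', t) := fun a ↦ rfl
  have hp1 : ∀ a j, pderiv j (coordMap (u t) x₀ y₀ a) =ᶠ[𝓝 y]
      fun y' ↦ fderiv ℝ (w a) (y', t) (spaceVec j) := by
    intro a j
    filter_upwards [hslice.eventually (hwa a)] with y' hy'
    rw [hc]
    exact fderiv_slice_left (hy'.differentiableAt (by simp)) _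
  have hp2 : ∀ a i j, pderiv i (pderiv j (coordMap (u t) x₀ y₀ a)) y =
      fderiv ℝ (fun z ↦ fderiv ℝ (w a) z (spaceVec j)) (y, t) (spaceVec i) := by
    intro a i j
    have h1 : DifferentiableAt ℝ (fun z ↦ fderiv ℝ (w a) z (spaceVec j)) (y, t) :=
      (((hwa a).self_of_nhds.fderiv_right (m := 1) (by norm_cast)).differentiableAt
        (by simp)).clm_apply (differentiableAt_const _)
    rw [pderiv, (hp1 a j).fderiv_eq]
    exact fderiv_slice_left h1 _
  have hxy : extChartAt (𝓡 m) x₀ x = y := (extChartAt (𝓡 m) x₀).right_inv hy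
  have heq : ∀ a, fderiv ℝ (w a) (y, t) (0, 1) = ∑ i, ∑ j, (metricMatrix x₀ y)⁻¹ i j *
      (fderiv ℝ (fun z ↦ fderiv ℝ (w a) z (spaceVec j)) (y, t) (spaceVec i)
        - ∑ k, christoffel x₀ y k i j * fderiv ℝ (w a) (y, t) (spaceVec k)
        + ∑ b, ∑ c, christoffel y₀ (extChartAt (𝓡 n) y₀ (f (y, t))) a b c *
            fderiv ℝ (w b) (y, t) (spaceVec i) * fderiv ℝ (w c) (y, t) (spaceVec j)) := by
    intro a
    have h1 := (hu.equation t ⟨h0.le, hT⟩ x₀ y₀ x ((extChartAt (𝓡 m) x₀).map_target hy)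
      (mem_extChartAt_source y₀)).hasDerivAt (timeInterval_mem_nhds h0 hT)
    have h2 : HasDerivAt (fun s ↦ w a (y, s)) (tension (m := m) (n := n) (u t) x₀ y₀ x a) t :=
      (EuclideanSpace.proj a : ModelE n →L[ℝ] ℝ).hasFDerivAt.comp_hasDerivAt t h1
    -- The time derivative is computed once from the flow equation and once from joint
    -- differentiability. At the interior time `t` both are ordinary derivatives and must agree.
    have h3 := hasDerivAt_slice_right ((hwa a).self_of_nhds.differentiableAt (by simp))
    rw [h3.unique h2]
    simp only [tension, hxy, hp2, fun a j ↦ (hp1 a j).self_of_nhds]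
    rfl
  have hkos := koszul_pullbackMetric y₀ hs hsm hsrc
  have hG := fun v w ↦ pullbackMetric_eq_sum y₀ hs hsm.self_of_nhds hsrc v w
  simp only [hkos]
  simp only [hG]
  change ∑ a, ∑ b, metricMatrix y₀ (extChartAt (𝓡 n) y₀ (f (y, t))) a b *
      fderiv ℝ (w a) (y, t) (0, 1) * fderiv ℝ (w b) (y, t) γ = _
  simp only [heq]
  exact sum_contract_tension _ _ _ _ _ _ _

end Flow

/-! ### Partial derivatives and the divergence identity. -/

section PDeriv

variable {m : ℕ} {f g : ModelE m → ℝ} {y : ModelE m}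

lemma pderiv_fun_add (k : Fin m) (hf : DifferentiableAt ℝ f y) (hg : DifferentiableAt ℝ g y) :
    pderiv k (fun y ↦ f y + g y) y = pderiv k f y + pderiv k g y := by
  simp only [pderiv]
  rw [fderiv_fun_add hf hg]
  rfl

lemma pderiv_fun_sub (k : Fin m) (hf : DifferentiableAt ℝ f y) (hg : DifferentiableAt ℝ g y) :
    pderiv k (fun y ↦ f y - g y) y = pderiv k f y - pderiv k g y := by
  simp only [pderiv]
  rw [fderiv_fun_sub hf hg]
  rfl

lemma pderiv_fun_mul (k : Fin m) (hf : DifferentiableAt ℝ f y) (hg : DifferentiableAt ℝ g y) :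
    pderiv k (fun y ↦ f y * g y) y = pderiv k f y * g y + f y * pderiv k g y := by
  simp only [pderiv]
  rw [fderiv_fun_mul hf hg]
  simp only [_root_.add_apply, _root_.smul_apply, smul_eq_mul]
  ring

lemma pderiv_fun_const (k : Fin m) (c : ℝ) : pderiv k (fun _ ↦ c) y = 0 := by
  simp [pderiv]

lemma pderiv_comp {h : ℝ → ℝ} {h' : ℝ} (k : Fin m) (hh : HasDerivAt h h' (f y))
    (hf : DifferentiableAt ℝ f y) :
    pderiv k (fun y ↦ h (f y)) y = h' * pderiv k f y := by
  simp only [pderiv]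
  have := (hh.comp_hasFDerivAt y hf.hasFDerivAt).fderiv
  exact congrArg (fun A : ModelE m →L[ℝ] ℝ ↦ A _) this

end PDeriv

/-- The divergence identity for the harmonic map flow on a surface. Here `A, B, C` are the
components of the inverse metric, `w` is the volume density, `φ` is a test function with partial
derivatives `f₀, f₁`, `G` is the pulled back metric, and `X` its mixed space-time components. -/
lemma divergence_identity {A B C w φ f₀ f₁ G₀₀ G₀₁ G₁₁ X₀ X₁ : ModelE 2 → ℝ} {y : ModelE 2}
    (hA : DifferentiableAt ℝ A y) (hB : DifferentiableAt ℝ B y) (hC : DifferentiableAt ℝ C y)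
    (hw : DifferentiableAt ℝ w y) (hφ : DifferentiableAt ℝ φ y)
    (hf₀ : DifferentiableAt ℝ f₀ y) (hf₁ : DifferentiableAt ℝ f₁ y)
    (hG₀₀ : DifferentiableAt ℝ G₀₀ y) (hG₀₁ : DifferentiableAt ℝ G₀₁ y)
    (hG₁₁ : DifferentiableAt ℝ G₁₁ y)
    (hX₀ : DifferentiableAt ℝ X₀ y) (hX₁ : DifferentiableAt ℝ X₁ y)
    (Γ : Fin 2 → Fin 2 → Fin 2 → ℝ) (hΓ : ∀ k, Γ k 1 0 = Γ k 0 1)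
    (dA : ∀ k, pderiv k A y = -2 * (Γ 0 k 0 * A y + Γ 0 k 1 * B y))
    (dB : ∀ k, pderiv k B y =
      -(Γ 0 k 0 * B y + Γ 0 k 1 * C y) - (Γ 1 k 0 * A y + Γ 1 k 1 * B y))
    (dC : ∀ k, pderiv k C y = -2 * (Γ 1 k 0 * B y + Γ 1 k 1 * C y))
    (dw : ∀ k, pderiv k w y = w y * (Γ 0 k 0 + Γ 1 k 1))
    (dφ₀ : pderiv 0 φ y = f₀ y) (dφ₁ : pderiv 1 φ y = f₁ y) (dφ : pderiv 1 f₀ y = pderiv 0 f₁ y)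
    {T₀₀ T₀₁ T₁₁ τ : ℝ}
    (hτ : τ = A y * (pderiv 0 X₀ y - (1 / 2) * T₀₀ - (Γ 0 0 0 * X₀ y + Γ 1 0 0 * X₁ y))
      + B y * (pderiv 0 X₁ y + pderiv 1 X₀ y - T₀₁ - 2 * (Γ 0 0 1 * X₀ y + Γ 1 0 1 * X₁ y))
      + C y * (pderiv 1 X₁ y - (1 / 2) * T₁₁ - (Γ 0 1 1 * X₀ y + Γ 1 1 1 * X₁ y)))
    (hX₀τ : X₀ y = A y * ((1 / 2) * pderiv 0 G₀₀ y - (Γ 0 0 0 * G₀₀ y + Γ 1 0 0 * G₀₁ y))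
      + B y * (pderiv 1 G₀₀ y - 2 * (Γ 0 0 1 * G₀₀ y + Γ 1 0 1 * G₀₁ y))
      + C y * (pderiv 1 G₀₁ y - (1 / 2) * pderiv 0 G₁₁ y - (Γ 0 1 1 * G₀₀ y + Γ 1 1 1 * G₀₁ y)))
    (hX₁τ : X₁ y = A y * (pderiv 0 G₀₁ y - (1 / 2) * pderiv 1 G₀₀ y
        - (Γ 0 0 0 * G₀₁ y + Γ 1 0 0 * G₁₁ y))
      + B y * (pderiv 0 G₁₁ y - 2 * (Γ 0 0 1 * G₀₁ y + Γ 1 0 1 * G₁₁ y))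
      + C y * ((1 / 2) * pderiv 1 G₁₁ y - (Γ 0 1 1 * G₀₁ y + Γ 1 1 1 * G₁₁ y)))
    {H₀₀ H₀₁ H₁₁ e : ℝ}
    (hH₀₀ : H₀₀ = pderiv 0 f₀ y - (Γ 0 0 0 * f₀ y + Γ 1 0 0 * f₁ y))
    (hH₀₁ : H₀₁ = pderiv 0 f₁ y - (Γ 0 0 1 * f₀ y + Γ 1 0 1 * f₁ y))
    (hH₁₁ : H₁₁ = pderiv 1 f₁ y - (Γ 0 1 1 * f₀ y + Γ 1 1 1 * f₁ y))
    (he : e = (1 / 2) * (A y * G₀₀ y + 2 * (B y * G₀₁ y) + C y * G₁₁ y)) :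
    pderiv 0 (fun y ↦ w y * (φ y * (A y * X₀ y + B y * X₁ y)
        - ((A y * f₀ y + B y * f₁ y) * (A y * G₀₀ y + B y * G₀₁ y)
          + (B y * f₀ y + C y * f₁ y) * (A y * G₀₁ y + B y * G₁₁ y))
        + (A y * f₀ y + B y * f₁ y) *
          ((1 / 2) * (A y * G₀₀ y + 2 * (B y * G₀₁ y) + C y * G₁₁ y)))) y
      + pderiv 1 (fun y ↦ w y * (φ y * (B y * X₀ y + C y * X₁ y)
        - ((A y * f₀ y + B y * f₁ y) * (B y * G₀₀ y + C y * G₀₁ y)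
          + (B y * f₀ y + C y * f₁ y) * (B y * G₀₁ y + C y * G₁₁ y))
        + (B y * f₀ y + C y * f₁ y) *
          ((1 / 2) * (A y * G₀₀ y + 2 * (B y * G₀₁ y) + C y * G₁₁ y)))) y =
      φ y * ((1 / 2) * (A y * T₀₀ + 2 * B y * T₀₁ + C y * T₁₁) + τ) * w y
      - w y * ((A y ^ 2 * H₀₀ + 2 * A y * B y * H₀₁ + B y ^ 2 * H₁₁) * G₀₀ y
        + 2 * (A y * B y * H₀₀ + (A y * C y + B y ^ 2) * H₀₁ + B y * C y * H₁₁) * G₀₁ y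
        + (B y ^ 2 * H₀₀ + 2 * B y * C y * H₀₁ + C y ^ 2 * H₁₁) * G₁₁ y
        - e * (A y * H₀₀ + 2 * B y * H₀₁ + C y * H₁₁)) := by
  simp (disch := fun_prop) only [pderiv_fun_mul, pderiv_fun_add, pderiv_fun_sub, pderiv_fun_const]
  simp only [dA, dB, dC, dw, hΓ, dφ₀, dφ₁, dφ]
  subst hH₀₀ hH₀₁ hH₁₁ he
  -- The flux is the density times φX − S(∇φ), where X is dual to ⟨∂ₜu, du⟩. Its divergence uses the
  -- flow equation contracted with ∂ₜ, weighted by `φ`, and the two spatial contractions, which say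
  -- X = div S, weighted by the components of ∇φ.
  linear_combination (w y * φ y) * (-hτ) + w y * (A y * f₀ y + B y * f₁ y) * hX₀τ
    + w y * (B y * f₀ y + C y * f₁ y) * hX₁τ

/-! ### Inverse metric, volume density and Christoffel symbols on a surface. -/

section SurfaceMetric

variable {M : Type u} [TopologicalSpace M] [ChartedSpace (ModelE 2) M]
  [RiemannianBundle (fun x : M ↦ TangentSpace (𝓡 2) x)]

lemma inv_metricMatrix_zero_zero (x₀ : M) (y : ModelE 2) :
    (metricMatrix x₀ y)⁻¹ 0 0 = (metricMatrix x₀ y 0 0 * metricMatrix x₀ y 1 1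
      - metricMatrix x₀ y 0 1 * metricMatrix x₀ y 0 1)⁻¹ * metricMatrix x₀ y 1 1 := by
  rw [Matrix.inv_def, Matrix.det_fin_two, Matrix.adjugate_fin_two, Ring.inverse_eq_inv,
    metricMatrix_symm x₀ y 1 0]
  simp

lemma inv_metricMatrix_zero_one (x₀ : M) (y : ModelE 2) :
    (metricMatrix x₀ y)⁻¹ 0 1 = -((metricMatrix x₀ y 0 0 * metricMatrix x₀ y 1 1
      - metricMatrix x₀ y 0 1 * metricMatrix x₀ y 0 1)⁻¹ * metricMatrix x₀ y 0 1) := by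
  rw [Matrix.inv_def, Matrix.det_fin_two, Matrix.adjugate_fin_two, Ring.inverse_eq_inv,
    metricMatrix_symm x₀ y 1 0]
  simp

lemma inv_metricMatrix_one_zero (x₀ : M) (y : ModelE 2) :
    (metricMatrix x₀ y)⁻¹ 1 0 = (metricMatrix x₀ y)⁻¹ 0 1 := by
  rw [inv_metricMatrix_zero_one, Matrix.inv_def, Matrix.det_fin_two, Matrix.adjugate_fin_two,
    Ring.inverse_eq_inv, metricMatrix_symm x₀ y 1 0]
  simp

lemma inv_metricMatrix_one_one (x₀ : M) (y : ModelE 2) :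
    (metricMatrix x₀ y)⁻¹ 1 1 = (metricMatrix x₀ y 0 0 * metricMatrix x₀ y 1 1
      - metricMatrix x₀ y 0 1 * metricMatrix x₀ y 0 1)⁻¹ * metricMatrix x₀ y 0 0 := by
  rw [Matrix.inv_def, Matrix.det_fin_two, Matrix.adjugate_fin_two, Ring.inverse_eq_inv,
    metricMatrix_symm x₀ y 1 0]
  simp

lemma det_metricMatrix (x₀ : M) (y : ModelE 2) :
    (metricMatrix x₀ y).det = metricMatrix x₀ y 0 0 * metricMatrix x₀ y 1 1
      - metricMatrix x₀ y 0 1 * metricMatrix x₀ y 0 1 := by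
  rw [Matrix.det_fin_two, metricMatrix_symm x₀ y 1 0]

lemma christoffel_surface (x₀ : M) (y : ModelE 2) (k i j : Fin 2) :
    christoffel x₀ y k i j = (1 / 2) * (
      (metricMatrix x₀ y)⁻¹ k 0 * (pderiv i (fun z ↦ metricMatrix x₀ z j 0) y
        + pderiv j (fun z ↦ metricMatrix x₀ z i 0) y
        - pderiv 0 (fun z ↦ metricMatrix x₀ z i j) y)
      + (metricMatrix x₀ y)⁻¹ k 1 * (pderiv i (fun z ↦ metricMatrix x₀ z j 1) y
        + pderiv j (fun z ↦ metricMatrix x₀ z i 1) y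
        - pderiv 1 (fun z ↦ metricMatrix x₀ z i j) y)) := by
  simp only [christoffel, Fin.sum_univ_two]

lemma metricMatrix_one_zero_fun (x₀ : M) :
    (fun z ↦ metricMatrix (m := 2) x₀ z 1 0) = fun z ↦ metricMatrix x₀ z 0 1 :=
  funext fun z ↦ metricMatrix_symm x₀ z 1 0

variable [IsManifold (𝓡 2) ∞ M]

lemma det_metricMatrix_pos (x₀ : M) {y : ModelE 2} (hy : y ∈ (extChartAt (𝓡 2) x₀).target) :
    0 < metricMatrix x₀ y 0 0 * metricMatrix x₀ y 1 1
      - metricMatrix x₀ y 0 1 * metricMatrix x₀ y 0 1 :=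
  det_metricMatrix x₀ y ▸ (metricMatrix_posDef x₀ hy).det_pos

/-- The density of the Riemannian volume in a chart. -/
def volumeDensity (x₀ : M) (y : ModelE 2) : ℝ := Real.sqrt (metricMatrix x₀ y).det

lemma volumeDensity_pos (x₀ : M) {y : ModelE 2} (hy : y ∈ (extChartAt (𝓡 2) x₀).target) :
    0 < volumeDensity x₀ y :=
  Real.sqrt_pos.2 (metricMatrix_posDef x₀ hy).det_pos

lemma christoffel_symm {m : ℕ} {M : Type u} [TopologicalSpace M] [ChartedSpace (ModelE m) M]
    [RiemannianBundle (fun x : M ↦ TangentSpace (𝓡 m) x)] (x₀ : M) (y : ModelE m) (k i j : Fin m) :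
    christoffel x₀ y k i j = christoffel x₀ y k j i := by
  simp only [christoffel]
  congr 1
  refine Finset.sum_congr rfl fun l _ ↦ ?_
  have : (fun z ↦ metricMatrix x₀ z i j) = fun z ↦ metricMatrix x₀ z j i :=
    funext fun z ↦ metricMatrix_symm x₀ z i j
  rw [this]
  ring

variable [IsContMDiffRiemannianBundle (𝓡 2) ∞ (ModelE 2) (fun x : M ↦ TangentSpace (𝓡 2) x)]

lemma contDiffAt_metricMatrix (x₀ : M) {y : ModelE 2} (hy : y ∈ (extChartAt (𝓡 2) x₀).target)
    (i j : Fin 2) : ContDiffAt ℝ ∞ (fun y ↦ metricMatrix x₀ y i j) y :=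
  (contDiffOn_metricMatrix x₀ i j).contDiffAt ((isOpen_extChartAt_target_model x₀).mem_nhds hy)

lemma contDiffAt_det_metricMatrix (x₀ : M) {y : ModelE 2}
    (hy : y ∈ (extChartAt (𝓡 2) x₀).target) :
    ContDiffAt ℝ ∞ (fun y ↦ metricMatrix x₀ y 0 0 * metricMatrix x₀ y 1 1
      - metricMatrix x₀ y 0 1 * metricMatrix x₀ y 0 1) y :=
  ((contDiffAt_metricMatrix x₀ hy 0 0).mul (contDiffAt_metricMatrix x₀ hy 1 1)).sub
    ((contDiffAt_metricMatrix x₀ hy 0 1).mul (contDiffAt_metricMatrix x₀ hy 0 1))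

lemma contDiffAt_inv_metricMatrix (x₀ : M) {y : ModelE 2}
    (hy : y ∈ (extChartAt (𝓡 2) x₀).target) (i j : Fin 2) :
    ContDiffAt ℝ ∞ (fun y ↦ (metricMatrix x₀ y)⁻¹ i j) y := by
  have hD := (contDiffAt_det_metricMatrix x₀ hy).inv (det_metricMatrix_pos x₀ hy).ne'
  have h01 : ContDiffAt ℝ ∞ (fun y ↦ (metricMatrix x₀ y)⁻¹ 0 1) y := by
    simp only [inv_metricMatrix_zero_one]
    exact (hD.mul (contDiffAt_metricMatrix x₀ hy 0 1)).neg
  fin_cases i <;> fin_cases j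
  · simp only [Fin.zero_eta, inv_metricMatrix_zero_zero]
    exact hD.mul (contDiffAt_metricMatrix x₀ hy 1 1)
  · exact h01
  · simpa only [Fin.zero_eta, Fin.mk_one, inv_metricMatrix_one_zero] using h01
  · simp only [Fin.mk_one, inv_metricMatrix_one_one]
    exact hD.mul (contDiffAt_metricMatrix x₀ hy 0 0)

lemma contDiffAt_volumeDensity (x₀ : M) {y : ModelE 2}
    (hy : y ∈ (extChartAt (𝓡 2) x₀).target) : ContDiffAt ℝ ∞ (volumeDensity x₀) y := by
  unfold volumeDensity
  simp only [det_metricMatrix]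
  exact (contDiffAt_det_metricMatrix x₀ hy).sqrt (det_metricMatrix_pos x₀ hy).ne'

lemma differentiableAt_inv_det_metricMatrix (x₀ : M) {y : ModelE 2}
    (hy : y ∈ (extChartAt (𝓡 2) x₀).target) :
    DifferentiableAt ℝ (fun y ↦ (metricMatrix x₀ y 0 0 * metricMatrix x₀ y 1 1
      - metricMatrix x₀ y 0 1 * metricMatrix x₀ y 0 1)⁻¹) y :=
  ((contDiffAt_det_metricMatrix x₀ hy).inv
    (det_metricMatrix_pos x₀ hy).ne').differentiableAt (by simp)

lemma pderiv_inv_det_metricMatrix (x₀ : M) {y : ModelE 2}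
    (hy : y ∈ (extChartAt (𝓡 2) x₀).target) (k : Fin 2) :
    pderiv k (fun y ↦ (metricMatrix x₀ y 0 0 * metricMatrix x₀ y 1 1
      - metricMatrix x₀ y 0 1 * metricMatrix x₀ y 0 1)⁻¹) y =
    -((metricMatrix x₀ y 0 0 * metricMatrix x₀ y 1 1
      - metricMatrix x₀ y 0 1 * metricMatrix x₀ y 0 1) ^ 2)⁻¹ *
      (pderiv k (fun y ↦ metricMatrix x₀ y 0 0) y * metricMatrix x₀ y 1 1
        + metricMatrix x₀ y 0 0 * pderiv k (fun y ↦ metricMatrix x₀ y 1 1) y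
        - 2 * (metricMatrix x₀ y 0 1 * pderiv k (fun y ↦ metricMatrix x₀ y 0 1) y)) := by
  have h := fun i j ↦ (contDiffAt_metricMatrix x₀ hy i j).differentiableAt (by simp)
  have h00 := h 0 0
  have h01 := h 0 1
  have h11 := h 1 1
  have hD := (contDiffAt_det_metricMatrix x₀ hy).differentiableAt (by simp)
  rw [pderiv_comp k (hasDerivAt_inv (det_metricMatrix_pos x₀ hy).ne') hD]
  simp (disch := fun_prop) only [pderiv_fun_mul, pderiv_fun_sub]
  ring

/-- This and the next two lemmas say in coordinates that the inverse metric is parallel. They follow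
from the explicit formulas for the inverse of a 2 × 2 matrix. -/
lemma pderiv_inv_metricMatrix_zero_zero (x₀ : M) {y : ModelE 2}
    (hy : y ∈ (extChartAt (𝓡 2) x₀).target) (k : Fin 2) :
    pderiv k (fun y ↦ (metricMatrix x₀ y)⁻¹ 0 0) y =
      -2 * (christoffel x₀ y 0 k 0 * (metricMatrix x₀ y)⁻¹ 0 0
        + christoffel x₀ y 0 k 1 * (metricMatrix x₀ y)⁻¹ 0 1) := by
  have h11 := (contDiffAt_metricMatrix x₀ hy 1 1).differentiableAt (by simp)
  have hD := differentiableAt_inv_det_metricMatrix x₀ hy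
  have hp := (det_metricMatrix_pos x₀ hy).ne'
  simp only [christoffel_surface, inv_metricMatrix_zero_zero, inv_metricMatrix_zero_one]
  rw [pderiv_fun_mul k hD h11, pderiv_inv_det_metricMatrix x₀ hy]
  fin_cases k <;> simp only [Fin.zero_eta, Fin.mk_one, metricMatrix_one_zero_fun] <;>
    field_simp <;> ring

lemma pderiv_inv_metricMatrix_zero_one (x₀ : M) {y : ModelE 2}
    (hy : y ∈ (extChartAt (𝓡 2) x₀).target) (k : Fin 2) :
    pderiv k (fun y ↦ (metricMatrix x₀ y)⁻¹ 0 1) y =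
      -(christoffel x₀ y 0 k 0 * (metricMatrix x₀ y)⁻¹ 0 1
        + christoffel x₀ y 0 k 1 * (metricMatrix x₀ y)⁻¹ 1 1)
      - (christoffel x₀ y 1 k 0 * (metricMatrix x₀ y)⁻¹ 0 0
        + christoffel x₀ y 1 k 1 * (metricMatrix x₀ y)⁻¹ 0 1) := by
  have h01 := (contDiffAt_metricMatrix x₀ hy 0 1).differentiableAt (by simp)
  have hD := differentiableAt_inv_det_metricMatrix x₀ hy
  have hp := (det_metricMatrix_pos x₀ hy).ne'
  have hneg : ∀ a b : ℝ, -(a * b) = a * (-1 * b) := fun a b ↦ by ring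
  simp only [christoffel_surface, inv_metricMatrix_zero_zero, inv_metricMatrix_zero_one,
    inv_metricMatrix_one_zero, inv_metricMatrix_one_one]
  simp only [hneg]
  rw [pderiv_fun_mul k hD (h01.const_mul (-1)), pderiv_inv_det_metricMatrix x₀ hy,
    pderiv_fun_mul k (differentiableAt_const _) h01, pderiv_fun_const]
  fin_cases k <;> simp only [Fin.zero_eta, Fin.mk_one, metricMatrix_one_zero_fun] <;>
    field_simp <;> ring

lemma pderiv_inv_metricMatrix_one_one (x₀ : M) {y : ModelE 2}
    (hy : y ∈ (extChartAt (𝓡 2) x₀).target) (k : Fin 2) :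
    pderiv k (fun y ↦ (metricMatrix x₀ y)⁻¹ 1 1) y =
      -2 * (christoffel x₀ y 1 k 0 * (metricMatrix x₀ y)⁻¹ 0 1
        + christoffel x₀ y 1 k 1 * (metricMatrix x₀ y)⁻¹ 1 1) := by
  have h00 := (contDiffAt_metricMatrix x₀ hy 0 0).differentiableAt (by simp)
  have hD := differentiableAt_inv_det_metricMatrix x₀ hy
  have hp := (det_metricMatrix_pos x₀ hy).ne'
  simp only [christoffel_surface, inv_metricMatrix_zero_one, inv_metricMatrix_one_zero,
    inv_metricMatrix_one_one]
  rw [pderiv_fun_mul k hD h00, pderiv_inv_det_metricMatrix x₀ hy]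
  fin_cases k <;> simp only [Fin.zero_eta, Fin.mk_one, metricMatrix_one_zero_fun] <;>
    field_simp <;> ring

/-- The logarithmic derivative of √det g is half the trace of g⁻¹∂g, which is the trace of the
Christoffel symbols. -/
lemma pderiv_volumeDensity (x₀ : M) {y : ModelE 2}
    (hy : y ∈ (extChartAt (𝓡 2) x₀).target) (k : Fin 2) :
    pderiv k (volumeDensity x₀) y = volumeDensity x₀ y *
      (christoffel x₀ y 0 k 0 + christoffel x₀ y 1 k 1) := by
  have h := fun i j ↦ (contDiffAt_metricMatrix x₀ hy i j).differentiableAt (by simp)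
  have h00 := h 0 0
  have h01 := h 0 1
  have h11 := h 1 1
  have hD := (contDiffAt_det_metricMatrix x₀ hy).differentiableAt (by simp)
  have hpos := det_metricMatrix_pos x₀ hy
  have hp := hpos.ne'
  have hsq := Real.sq_sqrt hpos.le
  have hs := (Real.sqrt_pos.2 hpos).ne'
  unfold volumeDensity
  simp only [det_metricMatrix]
  rw [pderiv_comp k (Real.hasDerivAt_sqrt hp) hD]
  simp (disch := fun_prop) only [pderiv_fun_mul, pderiv_fun_sub]
  simp only [christoffel_surface, inv_metricMatrix_zero_zero, inv_metricMatrix_zero_one,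
    inv_metricMatrix_one_zero, inv_metricMatrix_one_one]
  set D := metricMatrix x₀ y 0 0 * metricMatrix x₀ y 1 1
      - metricMatrix x₀ y 0 1 * metricMatrix x₀ y 0 1
  -- With the derivative of the root written as √D/(2D), the factor `D⁻¹` matches the one in the
  -- inverse metric, and no relation between √D and D remains to be used.
  have e : (1 : ℝ) / (2 * √D) = √D * (1 / 2 * D⁻¹) := by
    field_simp
    rw [hsq]
  rw [e]
  fin_cases k <;> simp only [Fin.zero_eta, Fin.mk_one, metricMatrix_one_zero_fun] <;> ring

end SurfaceMetric

/-! ### Regularity of the space-time metric of a flow. -/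

section LocalFlow

variable {m n : ℕ} {M : Type u} [TopologicalSpace M] [ChartedSpace (ModelE m) M]
  {N : Type v} [TopologicalSpace N] [ChartedSpace (ModelE n) N]
  [RiemannianBundle (fun y : N ↦ TangentSpace (𝓡 n) y)]

/-- The pulled back metric of a time-dependent map, in a chart of the source. -/
def spaceTimeMetric (n : ℕ) {N : Type v} [TopologicalSpace N] [ChartedSpace (ModelE n) N]
    [RiemannianBundle (fun y : N ↦ TangentSpace (𝓡 n) y)]
    (u : ℝ → M → N) (x₀ : M) (T : EReal) (v w : ModelE m × ℝ) :
    ModelE m × ℝ → ℝ :=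
  pullbackMetric n (localMap u x₀) (localDomain m x₀ T) v w

lemma spaceTimeMetric_comm (u : ℝ → M → N) (x₀ : M) (T : EReal) (v w : ModelE m × ℝ) :
    spaceTimeMetric n u x₀ T v w = spaceTimeMetric n u x₀ T w v :=
  pullbackMetric_comm _ _ _ _

variable [IsManifold (𝓡 m) ∞ M] [IsManifold (𝓡 n) ∞ N]
  [IsContMDiffRiemannianBundle (𝓡 n) ∞ (ModelE n) (fun y : N ↦ TangentSpace (𝓡 n) y)]

lemma IsHarmonicMapFlow.contDiffOn_spaceTimeMetric
    [RiemannianBundle (fun x : M ↦ TangentSpace (𝓡 m) x)] {u : ℝ → M → N} {T : EReal}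
    (hu : IsHarmonicMapFlow m n u T) (x₀ : M) (v w : ModelE m × ℝ) :
    ContDiffOn ℝ ∞ (spaceTimeMetric n u x₀ T v w) (localDomain m x₀ T) :=
  contDiffOn_pullbackMetric (uniqueDiffOn_localDomain x₀ T) (contMDiffOn_localMap hu.smooth x₀) v w

lemma IsHarmonicMapFlow.contDiffAt_spaceTimeMetric
    [RiemannianBundle (fun x : M ↦ TangentSpace (𝓡 m) x)] {u : ℝ → M → N} {T : EReal}
    (hu : IsHarmonicMapFlow m n u T) (x₀ : M) (v w : ModelE m × ℝ) {y : ModelE m} {t : ℝ}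
    (hy : y ∈ (extChartAt (𝓡 m) x₀).target) (h0 : 0 < t) (hT : (t : EReal) < T) :
    ContDiffAt ℝ ∞ (spaceTimeMetric n u x₀ T v w) (y, t) :=
  (hu.contDiffOn_spaceTimeMetric x₀ v w).contDiffAt (localDomain_mem_nhds hy h0 hT)

lemma IsHarmonicMapFlow.continuousOn_spaceTimeMetric_slice
    [RiemannianBundle (fun x : M ↦ TangentSpace (𝓡 m) x)] {u : ℝ → M → N} {T : EReal}
    (hu : IsHarmonicMapFlow m n u T) (x₀ : M) (v w : ModelE m × ℝ) {t : ℝ}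
    (ht : t ∈ timeInterval T) :
    ContinuousOn (fun y ↦ spaceTimeMetric n u x₀ T v w (y, t)) (extChartAt (𝓡 m) x₀).target :=
  (hu.contDiffOn_spaceTimeMetric x₀ v w).continuousOn.comp
    (by fun_prop : Continuous fun y : ModelE m ↦ (y, t)).continuousOn (fun _ hy ↦ ⟨hy, ht⟩)

end LocalFlow

/-! ### The local energy identity in divergence form. -/

section Surface

variable {n : ℕ} {M : Type u} [TopologicalSpace M] [ChartedSpace (ModelE 2) M]
  [RiemannianBundle (fun x : M ↦ TangentSpace (𝓡 2) x)]
  {N : Type v} [TopologicalSpace N] [ChartedSpace (ModelE n) N]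
  [RiemannianBundle (fun y : N ↦ TangentSpace (𝓡 n) y)]

/-- The trace of a symmetric form with components `a, b, c` on a surface. -/
def surfaceTrace (x₀ : M) (a b c : ℝ) (y : ModelE 2) : ℝ :=
  (metricMatrix x₀ y)⁻¹ 0 0 * a + 2 * ((metricMatrix x₀ y)⁻¹ 0 1 * b) + (metricMatrix x₀ y)⁻¹ 1 1 * c

/-- The inner product of two symmetric forms on a surface. -/
def surfaceInner (x₀ : M) (a b c a' b' c' : ℝ) (y : ModelE 2) : ℝ :=
  ((metricMatrix x₀ y)⁻¹ 0 0 ^ 2 * a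
      + 2 * (metricMatrix x₀ y)⁻¹ 0 0 * (metricMatrix x₀ y)⁻¹ 0 1 * b
      + (metricMatrix x₀ y)⁻¹ 0 1 ^ 2 * c) * a'
    + 2 * ((metricMatrix x₀ y)⁻¹ 0 0 * (metricMatrix x₀ y)⁻¹ 0 1 * a
      + ((metricMatrix x₀ y)⁻¹ 0 0 * (metricMatrix x₀ y)⁻¹ 1 1 + (metricMatrix x₀ y)⁻¹ 0 1 ^ 2) * b
      + (metricMatrix x₀ y)⁻¹ 0 1 * (metricMatrix x₀ y)⁻¹ 1 1 * c) * b'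
    + ((metricMatrix x₀ y)⁻¹ 0 1 ^ 2 * a
      + 2 * (metricMatrix x₀ y)⁻¹ 0 1 * (metricMatrix x₀ y)⁻¹ 1 1 * b
      + (metricMatrix x₀ y)⁻¹ 1 1 ^ 2 * c) * c'

/-- The components of the Hessian of a function in a chart of a surface. -/
def hessian (x₀ : M) (φ : ModelE 2 → ℝ) (i j : Fin 2) (y : ModelE 2) : ℝ :=
  pderiv i (pderiv j φ) y
    - (christoffel x₀ y 0 i j * pderiv 0 φ y + christoffel x₀ y 1 i j * pderiv 1 φ y)

/-- The energy density of a time-dependent map in a chart of the source surface. -/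
def localEnergy (n : ℕ) {N : Type v} [TopologicalSpace N] [ChartedSpace (ModelE n) N]
    [RiemannianBundle (fun y : N ↦ TangentSpace (𝓡 n) y)]
    (u : ℝ → M → N) (x₀ : M) (T : EReal) (t : ℝ) (y : ModelE 2) : ℝ :=
  (1 / 2) * surfaceTrace x₀ (spaceTimeMetric n u x₀ T (spaceVec 0) (spaceVec 0) (y, t))
    (spaceTimeMetric n u x₀ T (spaceVec 0) (spaceVec 1) (y, t))
    (spaceTimeMetric n u x₀ T (spaceVec 1) (spaceVec 1) (y, t)) y

/-- The time derivative of the energy density. -/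
def localEnergyDeriv (n : ℕ) {N : Type v} [TopologicalSpace N] [ChartedSpace (ModelE n) N]
    [RiemannianBundle (fun y : N ↦ TangentSpace (𝓡 n) y)]
    (u : ℝ → M → N) (x₀ : M) (T : EReal) (t : ℝ) (y : ModelE 2) : ℝ :=
  (1 / 2) * surfaceTrace x₀
    (fderiv ℝ (spaceTimeMetric n u x₀ T (spaceVec 0) (spaceVec 0)) (y, t) (0, 1))
    (fderiv ℝ (spaceTimeMetric n u x₀ T (spaceVec 0) (spaceVec 1)) (y, t) (0, 1))
    (fderiv ℝ (spaceTimeMetric n u x₀ T (spaceVec 1) (spaceVec 1)) (y, t) (0, 1)) y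

/-- The pairing of the Hessian of a function with the stress-energy tensor. -/
def hessianStress (n : ℕ) {N : Type v} [TopologicalSpace N] [ChartedSpace (ModelE n) N]
    [RiemannianBundle (fun y : N ↦ TangentSpace (𝓡 n) y)]
    (u : ℝ → M → N) (x₀ : M) (T : EReal) (φ : ModelE 2 → ℝ) (t : ℝ) (y : ModelE 2) : ℝ :=
  surfaceInner x₀ (hessian x₀ φ 0 0 y) (hessian x₀ φ 0 1 y) (hessian x₀ φ 1 1 y)
    (spaceTimeMetric n u x₀ T (spaceVec 0) (spaceVec 0) (y, t))
    (spaceTimeMetric n u x₀ T (spaceVec 0) (spaceVec 1) (y, t))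
    (spaceTimeMetric n u x₀ T (spaceVec 1) (spaceVec 1) (y, t)) y
  - localEnergy n u x₀ T t y *
    surfaceTrace x₀ (hessian x₀ φ 0 0 y) (hessian x₀ φ 0 1 y) (hessian x₀ φ 1 1 y) y

/-- The components of the vector field whose divergence governs the evolution of the local
energy. -/
def energyFlux (n : ℕ) {N : Type v} [TopologicalSpace N] [ChartedSpace (ModelE n) N]
    [RiemannianBundle (fun y : N ↦ TangentSpace (𝓡 n) y)]
    (u : ℝ → M → N) (x₀ : M) (T : EReal) (φ : ModelE 2 → ℝ) (t : ℝ) (k : Fin 2) (y : ModelE 2) :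
    ℝ :=
  volumeDensity x₀ y * (φ y * ((metricMatrix x₀ y)⁻¹ 0 k *
        spaceTimeMetric n u x₀ T (spaceVec 0) (0, 1) (y, t)
      + (metricMatrix x₀ y)⁻¹ k 1 * spaceTimeMetric n u x₀ T (spaceVec 1) (0, 1) (y, t))
    - (((metricMatrix x₀ y)⁻¹ 0 0 * pderiv 0 φ y + (metricMatrix x₀ y)⁻¹ 0 1 * pderiv 1 φ y) *
        ((metricMatrix x₀ y)⁻¹ 0 k * spaceTimeMetric n u x₀ T (spaceVec 0) (spaceVec 0) (y, t)
          + (metricMatrix x₀ y)⁻¹ k 1 * spaceTimeMetric n u x₀ T (spaceVec 0) (spaceVec 1) (y, t))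
      + ((metricMatrix x₀ y)⁻¹ 0 1 * pderiv 0 φ y + (metricMatrix x₀ y)⁻¹ 1 1 * pderiv 1 φ y) *
        ((metricMatrix x₀ y)⁻¹ 0 k * spaceTimeMetric n u x₀ T (spaceVec 0) (spaceVec 1) (y, t)
          + (metricMatrix x₀ y)⁻¹ k 1 * spaceTimeMetric n u x₀ T (spaceVec 1) (spaceVec 1) (y, t)))
    + ((metricMatrix x₀ y)⁻¹ 0 k * pderiv 0 φ y + (metricMatrix x₀ y)⁻¹ k 1 * pderiv 1 φ y) *
      ((1 / 2) * ((metricMatrix x₀ y)⁻¹ 0 0 *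
          spaceTimeMetric n u x₀ T (spaceVec 0) (spaceVec 0) (y, t)
        + 2 * ((metricMatrix x₀ y)⁻¹ 0 1 *
          spaceTimeMetric n u x₀ T (spaceVec 0) (spaceVec 1) (y, t))
        + (metricMatrix x₀ y)⁻¹ 1 1 *
          spaceTimeMetric n u x₀ T (spaceVec 1) (spaceVec 1) (y, t))))

lemma contDiff_pderiv {m : ℕ} {φ : ModelE m → ℝ} (hφ : ContDiff ℝ ∞ φ) (i : Fin m) :
    ContDiff ℝ ∞ (pderiv i φ) :=
  (hφ.fderiv_right (m := ∞) (by simp)).clm_apply contDiff_const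

lemma pderiv_pderiv_comm {m : ℕ} {φ : ModelE m → ℝ} (hφ : ContDiff ℝ ∞ φ) (i j : Fin m)
    (y : ModelE m) : pderiv i (pderiv j φ) y = pderiv j (pderiv i φ) y := by
  have hd := ((hφ.fderiv_right (m := ∞) (by simp)).differentiable (by simp)) y
  have e : ∀ i j : Fin m, pderiv i (pderiv j φ) y = fderiv ℝ (fderiv ℝ φ) y
      (EuclideanSpace.single i (1 : ℝ)) (EuclideanSpace.single j (1 : ℝ)) := by
    intro i j
    have : pderiv j φ = fun y ↦ fderiv ℝ φ y (EuclideanSpace.single j (1 : ℝ)) := rfl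
    rw [pderiv, this, fderiv_clm_apply hd (differentiableAt_const _)]
    simp
  rw [e, e]
  exact (hφ.contDiffAt.of_le (m := 2) ENat.LEInfty.out).isSymmSndFDerivAt (by simp) _ _

variable [IsManifold (𝓡 2) ∞ M] [IsManifold (𝓡 n) ∞ N]
  [IsContMDiffRiemannianBundle (𝓡 2) ∞ (ModelE 2) (fun x : M ↦ TangentSpace (𝓡 2) x)]
  [IsContMDiffRiemannianBundle (𝓡 n) ∞ (ModelE n) (fun y : N ↦ TangentSpace (𝓡 n) y)]

/-- The local energy identity for the harmonic map flow, in divergence form. -/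
lemma IsHarmonicMapFlow.divergence_energyFlux {u : ℝ → M → N} {T : EReal}
    (hu : IsHarmonicMapFlow 2 n u T) (x₀ : M) {φ : ModelE 2 → ℝ} (hφ : ContDiff ℝ ∞ φ)
    {y : ModelE 2} {t : ℝ} (hy : y ∈ (extChartAt (𝓡 2) x₀).target) (h0 : 0 < t)
    (hT : (t : EReal) < T) :
    pderiv 0 (energyFlux n u x₀ T φ t 0) y + pderiv 1 (energyFlux n u x₀ T φ t 1) y =
      φ y * (localEnergyDeriv n u x₀ T t y + spaceTimeMetric n u x₀ T (0, 1) (0, 1) (y, t)) *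
        volumeDensity x₀ y
      - volumeDensity x₀ y * hessianStress n u x₀ T φ t y := by
  have hgi := fun i j ↦ (contDiffAt_inv_metricMatrix x₀ hy i j).differentiableAt (by simp)
  have hG := fun v w ↦ (hu.contDiffAt_spaceTimeMetric x₀ v w hy h0 hT).differentiableAt (by simp)
  have hGy : ∀ v w, DifferentiableAt ℝ (fun y ↦ spaceTimeMetric n u x₀ T v w (y, t)) y :=
    fun v w ↦ (hG v w).comp y (by fun_prop)
  have hdG : ∀ v w i, fderiv ℝ (spaceTimeMetric n u x₀ T v w) (y, t) (spaceVec i) =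
      pderiv i (fun y ↦ spaceTimeMetric n u x₀ T v w (y, t)) y :=
    fun v w i ↦ (fderiv_slice_left (hG v w) _).symm
  have hflow : ∀ γ, spaceTimeMetric n u x₀ T (0, 1) γ (y, t) =
      ∑ i, ∑ j, (metricMatrix x₀ y)⁻¹ i j * ((1 / 2) * (
          fderiv ℝ (spaceTimeMetric n u x₀ T (spaceVec j) γ) (y, t) (spaceVec i)
          + fderiv ℝ (spaceTimeMetric n u x₀ T (spaceVec i) γ) (y, t) (spaceVec j)
          - fderiv ℝ (spaceTimeMetric n u x₀ T (spaceVec i) (spaceVec j)) (y, t) γ)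
        - ∑ k, christoffel x₀ y k i j * spaceTimeMetric n u x₀ T (spaceVec k) γ (y, t)) :=
    hu.pullbackMetric_time x₀ hy h0 hT
  have hf := fun i ↦ (contDiff_pderiv hφ i).differentiable (by simp) y
  have hc10 : spaceTimeMetric n u x₀ T (spaceVec (m := 2) 1) (spaceVec 0) =
    spaceTimeMetric n u x₀ T (spaceVec 0) (spaceVec 1) := spaceTimeMetric_comm _ _ _ _ _
  refine (divergence_identity (hgi 0 0) (hgi 0 1) (hgi 1 1)
    ((contDiffAt_volumeDensity x₀ hy).differentiableAt (by simp))
    (hφ.differentiable (by simp) y) (hf 0) (hf 1)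
    (hGy (spaceVec 0) (spaceVec 0)) (hGy (spaceVec 0) (spaceVec 1))
    (hGy (spaceVec 1) (spaceVec 1)) (hGy (spaceVec 0) (0, 1)) (hGy (spaceVec 1) (0, 1))
    (christoffel x₀ y) (fun k ↦ christoffel_symm x₀ y k 1 0)
    (pderiv_inv_metricMatrix_zero_zero x₀ hy) (pderiv_inv_metricMatrix_zero_one x₀ hy)
    (pderiv_inv_metricMatrix_one_one x₀ hy) (pderiv_volumeDensity x₀ hy) rfl rfl
    (pderiv_pderiv_comm hφ 1 0 y)
    (T₀₀ := fderiv ℝ (spaceTimeMetric n u x₀ T (spaceVec 0) (spaceVec 0)) (y, t) (0, 1))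
    (T₀₁ := fderiv ℝ (spaceTimeMetric n u x₀ T (spaceVec 0) (spaceVec 1)) (y, t) (0, 1))
    (T₁₁ := fderiv ℝ (spaceTimeMetric n u x₀ T (spaceVec 1) (spaceVec 1)) (y, t) (0, 1))
    (τ := spaceTimeMetric n u x₀ T (0, 1) (0, 1) (y, t)) ?_ ?_ ?_ rfl rfl rfl rfl).trans ?_
  -- The three relations required by `divergence_identity` are the flow equation contracted with ∂ₜ,
  -- ∂₀ and ∂₁ in turn.
  · rw [hflow]
    simp only [Fin.sum_univ_two, inv_metricMatrix_one_zero, hdG, hc10, christoffel_symm x₀ y _ 1 0]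
    ring
  · rw [spaceTimeMetric_comm, hflow]
    simp only [Fin.sum_univ_two, inv_metricMatrix_one_zero, hdG, hc10, christoffel_symm x₀ y _ 1 0]
    ring
  · rw [spaceTimeMetric_comm, hflow]
    simp only [Fin.sum_univ_two, inv_metricMatrix_one_zero, hdG, hc10, christoffel_symm x₀ y _ 1 0]
    ring
  · simp only [localEnergyDeriv, hessianStress, localEnergy, surfaceTrace, surfaceInner, hessian]
    ring

end Surface

/-! ### Functions supported in a compact part of a chart. -/

section Support

variable {E : Type*} [NormedAddCommGroup E] {D K : Set E}

/-- Quantities in a chart are controlled only on the chart target `D`. Multiplied by a function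
supported in a closed `K ⊆ D`, they become regular on the whole coordinate space, since the
complement of `K` and `D` cover it. -/
lemma continuous_of_eq_zero_of_notMem (hD : IsOpen D) (hK : IsClosed K) (hKD : K ⊆ D) {f : E → ℝ}
    (h : ContinuousOn f D) (h0 : ∀ y ∉ K, f y = 0) : Continuous f := by
  rw [continuous_iff_continuousAt]
  intro y
  by_cases hy : y ∈ D
  · exact h.continuousAt (hD.mem_nhds hy)
  · have : f =ᶠ[𝓝 y] fun _ ↦ 0 := by
      filter_upwards [hK.isOpen_compl.mem_nhds fun h ↦ hy (hKD h)] with z hz using h0 z hz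
    exact continuousAt_const.congr this.symm

lemma continuousOn_prod_univ_of_eq_zero_of_notMem (hD : IsOpen D) (hK : IsClosed K) (hKD : K ⊆ D)
    {I : Set ℝ} {f : ℝ → E → ℝ} (h : ContinuousOn f.uncurry (I ×ˢ D))
    (h0 : ∀ t, ∀ y ∉ K, f t y = 0) : ContinuousOn f.uncurry (I ×ˢ univ) := by
  rintro ⟨t, y⟩ ⟨ht, -⟩
  by_cases hy : y ∈ D
  · refine (h (t, y) ⟨ht, hy⟩).mono_of_mem_nhdsWithin ?_
    rw [nhdsWithin_prod_eq, nhdsWithin_univ]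
    exact prod_mem_prod self_mem_nhdsWithin (hD.mem_nhds hy)
  · have : f.uncurry =ᶠ[𝓝 (t, y)] fun _ ↦ 0 := by
      filter_upwards [(hK.isOpen_compl.preimage continuous_snd).mem_nhds
        (fun h ↦ hy (hKD h) : (t, y) ∈ Prod.snd ⁻¹' Kᶜ)] with z hz using h0 z.1 z.2 hz
    exact (continuousAt_const.congr this.symm).continuousWithinAt

variable [NormedSpace ℝ E]

lemma contDiff_of_eq_zero_of_notMem (hK : IsClosed K) (hKD : K ⊆ D) {f : E → ℝ}
    {k : WithTop ℕ∞} (h : ∀ y ∈ D, ContDiffAt ℝ k f y) (h0 : ∀ y ∉ K, f y = 0) :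
    ContDiff ℝ k f := by
  rw [contDiff_iff_contDiffAt]
  intro y
  by_cases hy : y ∈ D
  · exact h y hy
  · have : f =ᶠ[𝓝 y] fun _ ↦ 0 := by
      filter_upwards [hK.isOpen_compl.mem_nhds fun h ↦ hy (hKD h)] with z hz using h0 z hz
    exact contDiffAt_const.congr_of_eventuallyEq this

/-- Integration by parts against the constant function 1. -/
lemma integral_fderiv_eq_zero [FiniteDimensional ℝ E] [MeasurableSpace E] [BorelSpace E]
    (μ : Measure E) [μ.IsAddHaarMeasure] {f : E → ℝ} (hf : ContDiff ℝ 1 f)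
    (hc : HasCompactSupport f) (v : E) : ∫ y, fderiv ℝ f y v ∂μ = 0 := by
  have hd : Integrable (fun y ↦ fderiv ℝ f y v) μ :=
    ((hf.continuous_fderiv (by simp)).clm_apply continuous_const).integrable_of_hasCompactSupport
      (hc.fderiv_apply ℝ v)
  have := integral_mul_fderiv_eq_neg_fderiv_mul_of_integrable (μ := μ) (f := fun _ : E ↦ (1 : ℝ))
    (g := f) (v := v) (by simp) (by simpa using hd)
    (by simpa using hf.continuous.integrable_of_hasCompactSupport hc)
    (fun x _ ↦ differentiableAt_const _) (fun x _ ↦ hf.differentiable (by simp) x)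
  simpa using this

/-- Differentiation under the integral sign for an integrand supported in a fixed compact set. -/
lemma hasDerivAt_integral_of_eq_zero_of_notMem [FiniteDimensional ℝ E] [MeasurableSpace E]
    [BorelSpace E] (μ : Measure E) [IsFiniteMeasureOnCompacts μ] (hD : IsOpen D)
    (hK : IsCompact K) (hKD : K ⊆ D)
    {J : Set ℝ} (hJ : IsOpen J) {f f' : ℝ → E → ℝ} (hf : ∀ t ∈ J, ContinuousOn (f t) D)
    (hf' : ContinuousOn f'.uncurry (J ×ˢ D))
    (h0 : ∀ t, ∀ y ∉ K, f t y = 0) (h0' : ∀ t, ∀ y ∉ K, f' t y = 0)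
    (hd : ∀ t ∈ J, ∀ y ∈ D, HasDerivAt (fun s ↦ f s y) (f' t y) t) {t : ℝ} (ht : t ∈ J) :
    Integrable (f' t) μ ∧ HasDerivAt (fun s ↦ ∫ y, f s y ∂μ) (∫ y, f' t y ∂μ) t := by
  obtain ⟨δ, hδ, hball⟩ := Metric.nhds_basis_closedBall.mem_iff.1 (hJ.mem_nhds ht)
  -- Compactness of the time interval times `K` bounds `f'`. The indicator of `K` times this bound
  -- is the dominating function.
  obtain ⟨C, hC⟩ := ((isCompact_closedBall t δ).prod hK).exists_bound_of_continuousOn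
    (hf'.mono (prod_mono hball hKD))
  have hcont : ∀ s ∈ J, Continuous (f s) := fun s hs ↦
    continuous_of_eq_zero_of_notMem hD hK.isClosed hKD (hf s hs) (h0 s)
  have hcont' : Continuous (f' t) := by
    refine continuous_of_eq_zero_of_notMem hD hK.isClosed hKD ?_ (h0' t)
    exact hf'.comp (by fun_prop : Continuous fun y : E ↦ (t, y)).continuousOn
      (fun y hy ↦ ⟨ht, hy⟩)
  refine hasDerivAt_integral_of_dominated_loc_of_deriv_le (F := f) (F' := f')
    (bound := K.indicator fun _ ↦ C) (Metric.closedBall_mem_nhds t hδ) ?_ ?_ ?_ ?_ ?_ ?_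
  · filter_upwards [hJ.mem_nhds ht] with s hs using (hcont s hs).aestronglyMeasurable
  · exact (hcont t ht).integrable_of_hasCompactSupport (HasCompactSupport.intro hK (h0 t))
  · exact hcont'.aestronglyMeasurable
  · refine ae_of_all _ fun y s hs ↦ ?_
    by_cases hy : y ∈ K
    · rw [indicator_of_mem hy]
      exact hC (s, y) ⟨hs, hy⟩
    · rw [indicator_of_notMem hy, h0' s y hy, norm_zero]
  · exact (integrable_indicator_iff hK.measurableSet).2 (integrableOn_const hK.measure_ne_top)
  · refine ae_of_all _ fun y s hs ↦ ?_
    by_cases hy : y ∈ K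
    · exact hd s (hball hs) y (hKD hy)
    · rw [h0' s y hy]
      exact (hasDerivAt_const s (0 : ℝ)).congr_of_eventuallyEq
        (Eventually.of_forall fun r ↦ h0 r y hy)

end Support

lemma continuousOn_inner_polynomial {X : Type*} [TopologicalSpace X] {D : Set X}
    {A B C a b c a' b' c' : X → ℝ} (hA : ContinuousOn A D) (hB : ContinuousOn B D)
    (hC : ContinuousOn C D) (ha : ContinuousOn a D) (hb : ContinuousOn b D) (hc : ContinuousOn c D)
    (ha' : ContinuousOn a' D) (hb' : ContinuousOn b' D) (hc' : ContinuousOn c' D) :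
    ContinuousOn (fun y ↦ (A y ^ 2 * a y + 2 * A y * B y * b y + B y ^ 2 * c y) * a' y
      + 2 * (A y * B y * a y + (A y * C y + B y ^ 2) * b y + B y * C y * c y) * b' y
      + (B y ^ 2 * a y + 2 * B y * C y * b y + C y ^ 2 * c y) * c' y) D := by
  fun_prop

lemma contDiffAt_flux_polynomial {E : Type*} [NormedAddCommGroup E] [NormedSpace ℝ E]
    {A B C D D' w φ f₀ f₁ G₀₀ G₀₁ G₁₁ X₀ X₁ : E → ℝ} {y : E} (hA : ContDiffAt ℝ 1 A y)
    (hB : ContDiffAt ℝ 1 B y) (hC : ContDiffAt ℝ 1 C y) (hD : ContDiffAt ℝ 1 D y)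
    (hD' : ContDiffAt ℝ 1 D' y) (hw : ContDiffAt ℝ 1 w y) (hφ : ContDiffAt ℝ 1 φ y)
    (hf₀ : ContDiffAt ℝ 1 f₀ y) (hf₁ : ContDiffAt ℝ 1 f₁ y) (hG₀₀ : ContDiffAt ℝ 1 G₀₀ y)
    (hG₀₁ : ContDiffAt ℝ 1 G₀₁ y) (hG₁₁ : ContDiffAt ℝ 1 G₁₁ y) (hX₀ : ContDiffAt ℝ 1 X₀ y)
    (hX₁ : ContDiffAt ℝ 1 X₁ y) :
    ContDiffAt ℝ 1 (fun y ↦ w y * (φ y * (D y * X₀ y + D' y * X₁ y)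
      - ((A y * f₀ y + B y * f₁ y) * (D y * G₀₀ y + D' y * G₀₁ y)
        + (B y * f₀ y + C y * f₁ y) * (D y * G₀₁ y + D' y * G₁₁ y))
      + (D y * f₀ y + D' y * f₁ y) *
        ((1 / 2) * (A y * G₀₀ y + 2 * (B y * G₀₁ y) + C y * G₁₁ y)))) y := by
  fun_prop

/-! ### Evolution of the weighted energy. -/

section Surface

variable {n : ℕ} {M : Type u} [TopologicalSpace M] [ChartedSpace (ModelE 2) M]
  [RiemannianBundle (fun x : M ↦ TangentSpace (𝓡 2) x)]
  {N : Type v} [TopologicalSpace N] [ChartedSpace (ModelE n) N]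
  [RiemannianBundle (fun y : N ↦ TangentSpace (𝓡 n) y)]

lemma pderiv_eq_zero_of_notMem_tsupport {m : ℕ} {φ : ModelE m → ℝ} (i : Fin m) {y : ModelE m}
    (hy : y ∉ tsupport φ) : pderiv i φ y = 0 := by
  have : fderiv ℝ φ y = 0 := by
    by_contra h
    exact hy (support_fderiv_subset ℝ h)
  simp [pderiv, this]

lemma pderiv_pderiv_eq_zero_of_notMem_tsupport {m : ℕ} {φ : ModelE m → ℝ} (i j : Fin m)
    {y : ModelE m} (hy : y ∉ tsupport φ) : pderiv i (pderiv j φ) y = 0 :=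
  pderiv_eq_zero_of_notMem_tsupport i fun h ↦ hy (tsupport_fderiv_apply_subset ℝ _ h)

lemma energyFlux_eq_zero (u : ℝ → M → N) (x₀ : M) (T : EReal) {φ : ModelE 2 → ℝ} (t : ℝ)
    (k : Fin 2) {y : ModelE 2} (hy : y ∉ tsupport φ) : energyFlux n u x₀ T φ t k y = 0 := by
  simp [energyFlux, pderiv_eq_zero_of_notMem_tsupport _ hy, image_eq_zero_of_notMem_tsupport hy]

lemma hessian_eq_zero (x₀ : M) {φ : ModelE 2 → ℝ} (i j : Fin 2) {y : ModelE 2}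
    (hy : y ∉ tsupport φ) : hessian x₀ φ i j y = 0 := by
  simp [hessian, pderiv_eq_zero_of_notMem_tsupport _ hy,
    pderiv_pderiv_eq_zero_of_notMem_tsupport _ _ hy]

lemma hessianStress_eq_zero (u : ℝ → M → N) (x₀ : M) (T : EReal) {φ : ModelE 2 → ℝ} (t : ℝ)
    {y : ModelE 2} (hy : y ∉ tsupport φ) : hessianStress n u x₀ T φ t y = 0 := by
  simp [hessianStress, surfaceInner, surfaceTrace, hessian_eq_zero _ _ _ hy]

variable [IsManifold (𝓡 2) ∞ M]
  [IsContMDiffRiemannianBundle (𝓡 2) ∞ (ModelE 2) (fun x : M ↦ TangentSpace (𝓡 2) x)]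

lemma continuousOn_inv_metricMatrix (x₀ : M) (i j : Fin 2) :
    ContinuousOn (fun y ↦ (metricMatrix x₀ y)⁻¹ i j) (extChartAt (𝓡 2) x₀).target :=
  fun _ hy ↦ (contDiffAt_inv_metricMatrix x₀ hy i j).continuousAt.continuousWithinAt

lemma continuousOn_surfaceTrace (x₀ : M) {a b c : ModelE 2 → ℝ}
    (ha : ContinuousOn a (extChartAt (𝓡 2) x₀).target)
    (hb : ContinuousOn b (extChartAt (𝓡 2) x₀).target)
    (hc : ContinuousOn c (extChartAt (𝓡 2) x₀).target) :
    ContinuousOn (fun y ↦ surfaceTrace x₀ (a y) (b y) (c y) y) (extChartAt (𝓡 2) x₀).target :=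
  (((continuousOn_inv_metricMatrix x₀ 0 0).mul ha).add
    (continuousOn_const.mul ((continuousOn_inv_metricMatrix x₀ 0 1).mul hb))).add
    ((continuousOn_inv_metricMatrix x₀ 1 1).mul hc)

lemma continuousOn_surfaceInner (x₀ : M) {a b c a' b' c' : ModelE 2 → ℝ}
    (ha : ContinuousOn a (extChartAt (𝓡 2) x₀).target)
    (hb : ContinuousOn b (extChartAt (𝓡 2) x₀).target)
    (hc : ContinuousOn c (extChartAt (𝓡 2) x₀).target)
    (ha' : ContinuousOn a' (extChartAt (𝓡 2) x₀).target)
    (hb' : ContinuousOn b' (extChartAt (𝓡 2) x₀).target)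
    (hc' : ContinuousOn c' (extChartAt (𝓡 2) x₀).target) :
    ContinuousOn (fun y ↦ surfaceInner x₀ (a y) (b y) (c y) (a' y) (b' y) (c' y) y)
      (extChartAt (𝓡 2) x₀).target :=
  continuousOn_inner_polynomial (continuousOn_inv_metricMatrix x₀ 0 0)
    (continuousOn_inv_metricMatrix x₀ 0 1) (continuousOn_inv_metricMatrix x₀ 1 1) ha hb hc ha' hb' hc'

lemma continuousOn_volumeDensity (x₀ : M) :
    ContinuousOn (volumeDensity x₀) (extChartAt (𝓡 2) x₀).target :=
  fun _ hy ↦ (contDiffAt_volumeDensity x₀ hy).continuousAt.continuousWithinAt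

lemma contDiffAt_pderiv {m : ℕ} {f : ModelE m → ℝ} {y : ModelE m} (hf : ContDiffAt ℝ ∞ f y)
    (i : Fin m) : ContDiffAt ℝ ∞ (pderiv i f) y :=
  (hf.fderiv_right (m := ∞) (by simp)).clm_apply contDiffAt_const

lemma continuousOn_christoffel (x₀ : M) (k i j : Fin 2) :
    ContinuousOn (fun y ↦ christoffel x₀ y k i j) (extChartAt (𝓡 2) x₀).target := by
  intro y hy
  have h : ∀ a b c, ContinuousAt (fun y ↦ pderiv a (fun z ↦ metricMatrix x₀ z b c) y) y :=
    fun a b c ↦ (contDiffAt_pderiv (contDiffAt_metricMatrix x₀ hy b c) a).continuousAt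
  have hg := fun a b ↦ (contDiffAt_inv_metricMatrix x₀ hy a b).continuousAt
  simp only [christoffel_surface]
  exact (continuousAt_const.mul (((hg k 0).mul (((h i j 0).add (h j i 0)).sub (h 0 i j))).add
    ((hg k 1).mul (((h i j 1).add (h j i 1)).sub (h 1 i j))))).continuousWithinAt

lemma continuousOn_hessian (x₀ : M) {φ : ModelE 2 → ℝ} (hφ : ContDiff ℝ ∞ φ) (i j : Fin 2) :
    ContinuousOn (hessian x₀ φ i j) (extChartAt (𝓡 2) x₀).target := by
  have h1 := (contDiff_pderiv (contDiff_pderiv hφ j) i).continuous.continuousOn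
    (s := (extChartAt (𝓡 2) x₀).target)
  have h2 := fun i ↦ (contDiff_pderiv hφ i).continuous.continuousOn
    (s := (extChartAt (𝓡 2) x₀).target)
  exact h1.sub (((continuousOn_christoffel x₀ 0 i j).mul (h2 0)).add
    ((continuousOn_christoffel x₀ 1 i j).mul (h2 1)))

variable [IsManifold (𝓡 n) ∞ N]
  [IsContMDiffRiemannianBundle (𝓡 n) ∞ (ModelE n) (fun y : N ↦ TangentSpace (𝓡 n) y)]
  {u : ℝ → M → N} {T : EReal}

lemma IsHarmonicMapFlow.continuousOn_localEnergy (hu : IsHarmonicMapFlow 2 n u T) (x₀ : M) :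
    ContinuousOn (Function.uncurry (localEnergy n u x₀ T))
      (timeInterval T ×ˢ (extChartAt (𝓡 2) x₀).target) := by
  have hG : ∀ v w : ModelE 2 × ℝ, ContinuousOn (fun z : ℝ × ModelE 2 ↦ spaceTimeMetric n u x₀ T v w (z.2, z.1))
      (timeInterval T ×ˢ (extChartAt (𝓡 2) x₀).target) := fun v w ↦
    (hu.contDiffOn_spaceTimeMetric x₀ v w).continuousOn.comp
      (by fun_prop : Continuous fun z : ℝ × ModelE 2 ↦ (z.2, z.1)).continuousOn
      (fun _ hz ↦ ⟨hz.2, hz.1⟩)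
  have hg : ∀ i j, ContinuousOn (fun z : ℝ × ModelE 2 ↦ (metricMatrix x₀ z.2)⁻¹ i j)
      (timeInterval T ×ˢ (extChartAt (𝓡 2) x₀).target) := fun i j ↦
    (continuousOn_inv_metricMatrix x₀ i j).comp continuousOn_snd (fun _ hz ↦ hz.2)
  exact continuousOn_const.mul ((((hg 0 0).mul (hG _ _)).add
    (continuousOn_const.mul ((hg 0 1).mul (hG _ _)))).add ((hg 1 1).mul (hG _ _)))

lemma IsHarmonicMapFlow.continuousOn_localEnergy_slice (hu : IsHarmonicMapFlow 2 n u T) (x₀ : M)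
    {t : ℝ} (ht : t ∈ timeInterval T) :
    ContinuousOn (localEnergy n u x₀ T t) (extChartAt (𝓡 2) x₀).target :=
  ContinuousOn.comp (g := Function.uncurry (localEnergy n u x₀ T)) (f := fun y ↦ (t, y))
    (hu.continuousOn_localEnergy x₀) (by fun_prop) (fun _ hy ↦ ⟨ht, hy⟩)

lemma IsHarmonicMapFlow.continuousOn_hessianStress (hu : IsHarmonicMapFlow 2 n u T) (x₀ : M)
    {φ : ModelE 2 → ℝ} (hφ : ContDiff ℝ ∞ φ) {t : ℝ} (ht : t ∈ timeInterval T) :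
    ContinuousOn (hessianStress n u x₀ T φ t) (extChartAt (𝓡 2) x₀).target := by
  have hH := continuousOn_hessian x₀ hφ
  have hG := fun v w ↦ hu.continuousOn_spaceTimeMetric_slice x₀ v w ht
  exact (continuousOn_surfaceInner x₀ (hH 0 0) (hH 0 1) (hH 1 1) (hG _ _) (hG _ _) (hG _ _)).sub
    ((hu.continuousOn_localEnergy_slice x₀ ht).mul
      (continuousOn_surfaceTrace x₀ (hH 0 0) (hH 0 1) (hH 1 1)))

variable {φ : ModelE 2 → ℝ}

/-- The evolution inequality for the energy of a harmonic map flow, weighted by a test function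
supported in a chart. -/
lemma IsHarmonicMapFlow.exists_hasDerivAt_integral_localEnergy (hu : IsHarmonicMapFlow 2 n u T)
    (x₀ : M) (hφ : ContDiff ℝ ∞ φ) (hφ0 : ∀ y, 0 ≤ φ y) (hc : HasCompactSupport φ)
    (hsupp : tsupport φ ⊆ (extChartAt (𝓡 2) x₀).target) {t : ℝ} (h0 : 0 < t)
    (hT : (t : EReal) < T) :
    ∃ F' : ℝ, HasDerivAt (fun t ↦ ∫ y, φ y * localEnergy n u x₀ T t y * volumeDensity x₀ y) F' t ∧
      F' ≤ ∫ y, volumeDensity x₀ y * hessianStress n u x₀ T φ t y := by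
  have hD := isOpen_extChartAt_target_model (m := 2) x₀
  have hK := isClosed_tsupport φ
  have htI : t ∈ timeInterval T := ⟨h0.le, hT⟩
  have hw := continuousOn_volumeDensity x₀
  have hderiv : Integrable (fun y ↦ φ y * localEnergyDeriv n u x₀ T t y * volumeDensity x₀ y) ∧
      HasDerivAt (fun t ↦ ∫ y, φ y * localEnergy n u x₀ T t y * volumeDensity x₀ y)
        (∫ y, φ y * localEnergyDeriv n u x₀ T t y * volumeDensity x₀ y) t := by
    -- Only positive times are treated here, as differentiability at time 0 is one-sided. Continuity
    -- up to time 0 is supplied by `continuousOn_integral_localEnergy`.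
    have hJ : IsOpen {s : ℝ | 0 < s ∧ (s : EReal) < T} :=
      isOpen_Ioi.inter (isOpen_Iio.preimage continuous_coe_real_ereal)
    refine hasDerivAt_integral_of_eq_zero_of_notMem volume hD hc hsupp hJ
      (f := fun t y ↦ φ y * localEnergy n u x₀ T t y * volumeDensity x₀ y)
      (f' := fun t y ↦ φ y * localEnergyDeriv n u x₀ T t y * volumeDensity x₀ y)
      ?_ ?_ ?_ ?_ ?_ ⟨h0, hT⟩
    · intro s hs
      exact (hφ.continuous.continuousOn.mul
        (hu.continuousOn_localEnergy_slice x₀ ⟨hs.1.le, hs.2⟩)).mul hw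
    · have hdG : ∀ v w : ModelE 2 × ℝ, ContinuousOn (fun z : ℝ × ModelE 2 ↦
          fderiv ℝ (spaceTimeMetric n u x₀ T v w) (z.2, z.1) (0, 1))
          ({s : ℝ | 0 < s ∧ (s : EReal) < T} ×ˢ (extChartAt (𝓡 2) x₀).target) := by
        intro v w z hz
        have h1 := ((hu.contDiffAt_spaceTimeMetric x₀ v w hz.2 hz.1.1 hz.1.2).fderiv_right
          (m := ∞) (by simp)).continuousAt
        have h2 : ContinuousAt (fun z : ℝ × ModelE 2 ↦
            fderiv ℝ (spaceTimeMetric n u x₀ T v w) (z.2, z.1)) z :=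
          ContinuousAt.comp (f := fun z : ℝ × ModelE 2 ↦ (z.2, z.1)) h1 (by fun_prop)
        exact (h2.clm_apply continuousAt_const).continuousWithinAt
      have hg : ∀ i j, ContinuousOn (fun z : ℝ × ModelE 2 ↦ (metricMatrix x₀ z.2)⁻¹ i j)
          ({s : ℝ | 0 < s ∧ (s : EReal) < T} ×ˢ (extChartAt (𝓡 2) x₀).target) := fun i j ↦
        (continuousOn_inv_metricMatrix x₀ i j).comp continuousOn_snd (fun _ hz ↦ hz.2)
      have hφ' : ContinuousOn (fun z : ℝ × ModelE 2 ↦ φ z.2)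
          ({s : ℝ | 0 < s ∧ (s : EReal) < T} ×ˢ (extChartAt (𝓡 2) x₀).target) :=
        (hφ.continuous.comp continuous_snd).continuousOn
      exact (hφ'.mul (continuousOn_const.mul ((((hg 0 0).mul (hdG _ _)).add
        (continuousOn_const.mul ((hg 0 1).mul (hdG _ _)))).add ((hg 1 1).mul (hdG _ _))))).mul
        (hw.comp continuousOn_snd (fun _ hz ↦ hz.2))
    · intro s y hy
      simp [image_eq_zero_of_notMem_tsupport hy]
    · intro s y hy
      simp [image_eq_zero_of_notMem_tsupport hy]
    · intro s hs y hy
      have hG : ∀ v w : ModelE 2 × ℝ, HasDerivAt (fun r ↦ spaceTimeMetric n u x₀ T v w (y, r))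
          (fderiv ℝ (spaceTimeMetric n u x₀ T v w) (y, s) (0, 1)) s := fun v w ↦
        hasDerivAt_slice_right
          ((hu.contDiffAt_spaceTimeMetric x₀ v w hy hs.1 hs.2).differentiableAt (by simp))
      exact ((((((hG _ _).const_mul _).add (((hG _ _).const_mul _).const_mul _)).add
        ((hG _ _).const_mul _)).const_mul _).const_mul _).mul_const _
  refine ⟨∫ y, φ y * localEnergyDeriv n u x₀ T t y * volumeDensity x₀ y, hderiv.2, ?_⟩
  · have hflux : ∀ k, ContDiff ℝ 1 (energyFlux n u x₀ T φ t k) := by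
      intro k
      refine contDiff_of_eq_zero_of_notMem hK hsupp (fun y hy ↦ ?_)
        (fun y hy ↦ energyFlux_eq_zero u x₀ T t k hy)
      have hG : ∀ v w : ModelE 2 × ℝ, ContDiffAt ℝ 1 (fun y ↦ spaceTimeMetric n u x₀ T v w (y, t)) y :=
        fun v w ↦ ((hu.contDiffAt_spaceTimeMetric x₀ v w hy h0 hT).of_le
          ENat.LEInfty.out).comp y (by fun_prop)
      have hgi : ∀ i j, ContDiffAt ℝ 1 (fun y ↦ (metricMatrix x₀ y)⁻¹ i j) y :=
        fun i j ↦ (contDiffAt_inv_metricMatrix x₀ hy i j).of_le ENat.LEInfty.out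
      have hpd := fun i ↦ (contDiff_pderiv hφ i).contDiffAt (x := y)
      exact contDiffAt_flux_polynomial (hgi 0 0) (hgi 0 1) (hgi 1 1) (hgi 0 k) (hgi k 1)
        ((contDiffAt_volumeDensity x₀ hy).of_le ENat.LEInfty.out)
        (hφ.contDiffAt.of_le ENat.LEInfty.out) ((hpd 0).of_le ENat.LEInfty.out)
        ((hpd 1).of_le ENat.LEInfty.out) (hG (spaceVec 0) (spaceVec 0))
        (hG (spaceVec 0) (spaceVec 1)) (hG (spaceVec 1) (spaceVec 1)) (hG (spaceVec 0) (0, 1))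
        (hG (spaceVec 1) (0, 1))
    have hfc : ∀ k, HasCompactSupport (energyFlux n u x₀ T φ t k) := fun k ↦
      HasCompactSupport.intro hc fun y hy ↦ energyFlux_eq_zero u x₀ T t k hy
    have hint : ∀ k, Integrable (pderiv k (energyFlux n u x₀ T φ t k)) := fun k ↦
      (((hflux k).continuous_fderiv (by simp)).clm_apply
        continuous_const).integrable_of_hasCompactSupport ((hfc k).fderiv_apply ℝ _)
    have hzero : ∀ k, ∫ y, pderiv k (energyFlux n u x₀ T φ t k) y = 0 := fun k ↦
      integral_fderiv_eq_zero volume (hflux k) (hfc k) _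
    have hS : Integrable (fun y ↦ volumeDensity x₀ y * hessianStress n u x₀ T φ t y) := by
      refine (continuous_of_eq_zero_of_notMem hD hK hsupp
        (hw.mul (hu.continuousOn_hessianStress x₀ hφ htI)) ?_).integrable_of_hasCompactSupport
        (HasCompactSupport.intro hc ?_)
      all_goals
        intro y hy
        simp [hessianStress_eq_zero u x₀ T t hy]
    have hpt : ∀ y, φ y * localEnergyDeriv n u x₀ T t y * volumeDensity x₀ y ≤
        volumeDensity x₀ y * hessianStress n u x₀ T φ t y
          + (pderiv 0 (energyFlux n u x₀ T φ t 0) y + pderiv 1 (energyFlux n u x₀ T φ t 1) y) := by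
      intro y
      by_cases hy : y ∈ (extChartAt (𝓡 2) x₀).target
      · rw [hu.divergence_energyFlux x₀ hφ hy h0 hT]
        -- This is |∂ₜu|². It enters with the favourable sign and is dropped, which turns the
        -- identity into an inequality.
        have h1 : 0 ≤ spaceTimeMetric n u x₀ T (0, 1) (0, 1) (y, t) := real_inner_self_nonneg
        have h2 := mul_nonneg (mul_nonneg (hφ0 y) h1) (volumeDensity_pos x₀ hy).le
        linarith
      · have hy' : y ∉ tsupport φ := fun h ↦ hy (hsupp h)
        have hz : ∀ k, pderiv k (energyFlux n u x₀ T φ t k) y = 0 := fun k ↦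
          pderiv_eq_zero_of_notMem_tsupport k fun h ↦ hy' (closure_minimal (fun z hz ↦ by
            by_contra h'
            exact hz (energyFlux_eq_zero u x₀ T t k h')) hK h)
        rw [hz, hz, image_eq_zero_of_notMem_tsupport hy', hessianStress_eq_zero u x₀ T t hy']
        simp
    have hsum : ∫ y, (volumeDensity x₀ y * hessianStress n u x₀ T φ t y
          + (pderiv 0 (energyFlux n u x₀ T φ t 0) y + pderiv 1 (energyFlux n u x₀ T φ t 1) y)) =
        ∫ y, volumeDensity x₀ y * hessianStress n u x₀ T φ t y := by
      have h1 : ∫ y, (pderiv 0 (energyFlux n u x₀ T φ t 0) y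
          + pderiv 1 (energyFlux n u x₀ T φ t 1) y) = 0 := by
        rw [integral_add (hint 0) (hint 1), hzero, hzero, add_zero]
      refine (integral_add hS ((hint 0).add (hint 1))).trans ?_
      exact (congrArg _ h1).trans (add_zero _)
    rw [← hsum]
    exact integral_mono hderiv.1 (hS.add ((hint 0).add (hint 1))) hpt

/-- The energy of a harmonic map flow weighted by a test function is continuous in time. -/
lemma IsHarmonicMapFlow.continuousOn_integral_localEnergy (hu : IsHarmonicMapFlow 2 n u T)
    (x₀ : M) (hφ : ContDiff ℝ ∞ φ) (hc : HasCompactSupport φ)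
    (hsupp : tsupport φ ⊆ (extChartAt (𝓡 2) x₀).target) :
    ContinuousOn (fun t ↦ ∫ y, φ y * localEnergy n u x₀ T t y * volumeDensity x₀ y)
      (timeInterval T) := by
  refine continuousOn_integral_of_compact_support (k := tsupport φ) hc ?_ ?_
  · refine continuousOn_prod_univ_of_eq_zero_of_notMem (isOpen_extChartAt_target_model (m := 2) x₀)
      (isClosed_tsupport φ) hsupp ?_ ?_
    · exact ((hφ.continuous.comp continuous_snd).continuousOn.mul
        (hu.continuousOn_localEnergy x₀)).mul
        ((continuousOn_volumeDensity x₀).comp continuousOn_snd (fun _ hz ↦ hz.2))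
    · intro t y hy
      simp [image_eq_zero_of_notMem_tsupport hy]
  · intro t y _ hy
    simp [image_eq_zero_of_notMem_tsupport hy]

end Surface

/-! ### Bilinear forms in orthonormal bases and in charts. -/

section Forms

variable {m : ℕ} {M : Type u} [TopologicalSpace M] [ChartedSpace (ModelE m) M]

/-- The components of a tangent vector in a chart. -/
def chartCoord (x₀ : M)
    (y : ModelE m) : TangentSpace (𝓡 m) ((extChartAt (𝓡 m) x₀).symm y) →L[ℝ] ModelE m :=
  mfderiv (𝓡 m) (𝓡 m) (extChartAt (𝓡 m) x₀) ((extChartAt (𝓡 m) x₀).symm y)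

/-- The bilinear form on a tangent space with given components in a chart. -/
def chartForm (x₀ : M) (y : ModelE m) (B : Fin m → Fin m → ℝ) :
    LinearMap.BilinForm ℝ (TangentSpace (𝓡 m) ((extChartAt (𝓡 m) x₀).symm y)) :=
  LinearMap.mk₂ ℝ (fun v w ↦ ∑ i, ∑ j, B i j * (chartCoord x₀ y v i * chartCoord x₀ y w j))
    (fun v v' w ↦ by
      simp only [← Finset.sum_add_distrib]
      refine Finset.sum_congr rfl fun i _ ↦ Finset.sum_congr rfl fun j _ ↦ ?_
      rw [map_add, PiLp.add_apply]; ring)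
    (fun c v w ↦ by
      simp only [Finset.smul_sum]
      refine Finset.sum_congr rfl fun i _ ↦ Finset.sum_congr rfl fun j _ ↦ ?_
      rw [map_smul, PiLp.smul_apply, smul_eq_mul, smul_eq_mul]; ring)
    (fun v w w' ↦ by
      simp only [← Finset.sum_add_distrib]
      refine Finset.sum_congr rfl fun i _ ↦ Finset.sum_congr rfl fun j _ ↦ ?_
      rw [map_add, PiLp.add_apply]; ring)
    (fun c v w ↦ by
      simp only [Finset.smul_sum]
      refine Finset.sum_congr rfl fun i _ ↦ Finset.sum_congr rfl fun j _ ↦ ?_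
      rw [map_smul, PiLp.smul_apply, smul_eq_mul, smul_eq_mul]; ring)

variable [IsManifold (𝓡 m) ∞ M]

lemma chartForm_apply_symm (x₀ : M) {y : ModelE m} (hy : y ∈ (extChartAt (𝓡 m) x₀).target)
    (B : Fin m → Fin m → ℝ) (v w : ModelE m) :
    chartForm x₀ y B (mfderiv (𝓡 m) (𝓡 m) (extChartAt (𝓡 m) x₀).symm y v)
      (mfderiv (𝓡 m) (𝓡 m) (extChartAt (𝓡 m) x₀).symm y w) =
      ∑ i, ∑ j, B i j * (v i * w j) := by
  have h : ∀ v : ModelE m, chartCoord x₀ y (mfderiv (𝓡 m) (𝓡 m) (extChartAt (𝓡 m) x₀).symm y v) =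
    v := fun v ↦ mfderiv_extChartAt_comp_symm x₀ hy v
  simp only [chartForm, LinearMap.mk₂_apply, h]

lemma chartForm_coordVec (x₀ : M) {y : ModelE m} (hy : y ∈ (extChartAt (𝓡 m) x₀).target)
    (B : Fin m → Fin m → ℝ) (i j : Fin m) :
    chartForm x₀ y B (coordVec x₀ y i) (coordVec x₀ y j) = B i j := by
  refine (chartForm_apply_symm x₀ hy B _ _).trans ?_
  simp

variable [RiemannianBundle (fun x : M ↦ TangentSpace (𝓡 m) x)]

/-- The inverse metric recovers the components of a vector from its inner products with the
coordinate frame. This is the bridge between charts and the orthonormal bases in the definitions. -/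
lemma sum_inv_metricMatrix_smul_coordVec (x₀ : M) {y : ModelE m}
    (hy : y ∈ (extChartAt (𝓡 m) x₀).target)
    (v : TangentSpace (𝓡 m) ((extChartAt (𝓡 m) x₀).symm y)) :
    v = ∑ i, ∑ j, ((metricMatrix x₀ y)⁻¹ i j * inner ℝ v (coordVec x₀ y i)) • coordVec x₀ y j := by
  obtain ⟨a, ha⟩ : ∃ a : ModelE m, v = ∑ k, a k • coordVec x₀ y k :=
    ⟨_, (mfderiv_extChartAt_symm_comp x₀ hy v).symm.trans (mfderiv_extChartAt_symm_eq_sum x₀ y _)⟩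
  have hu : IsUnit (metricMatrix x₀ y).det :=
    ((metricMatrix_posDef x₀ hy).det_pos.ne').isUnit
  have h1 : ∀ i, inner ℝ v (coordVec x₀ y i) = ∑ k, a k * metricMatrix x₀ y k i := by
    intro i
    rw [ha, sum_inner]
    exact Finset.sum_congr rfl fun k _ ↦ by
      rw [real_inner_smul_left]; rfl
  have h2 : ∀ j, ∑ i, (metricMatrix x₀ y)⁻¹ i j * inner ℝ v (coordVec x₀ y i) = a j := by
    intro j
    simp only [h1, Finset.mul_sum]
    rw [Finset.sum_comm]
    have h3 : ∀ k, ∑ i, (metricMatrix x₀ y)⁻¹ i j * (a k * metricMatrix x₀ y k i) =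
        a k * (1 : Matrix (Fin m) (Fin m) ℝ) k j := by
      intro k
      rw [← Matrix.mul_nonsing_inv _ hu, Matrix.mul_apply, Finset.mul_sum]
      exact Finset.sum_congr rfl fun i _ ↦ by ring
    simp only [h3, Matrix.one_apply]
    simp
  rw [Finset.sum_comm]
  simp only [← Finset.sum_smul, h2]
  exact ha

/-- The trace of a bilinear form, in an orthonormal basis and in a chart. -/
lemma sum_tangentBasis_bilin (x₀ : M) {y : ModelE m} (hy : y ∈ (extChartAt (𝓡 m) x₀).target)
    (β : LinearMap.BilinForm ℝ (TangentSpace (𝓡 m) ((extChartAt (𝓡 m) x₀).symm y))) :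
    ∑ a, β (tangentBasis _ a) (tangentBasis _ a) =
      ∑ i, ∑ j, (metricMatrix x₀ y)⁻¹ i j * β (coordVec x₀ y i) (coordVec x₀ y j) := by
  have h1 : ∀ v, β v v = ∑ i, ∑ j, (metricMatrix x₀ y)⁻¹ i j *
      (inner ℝ v (coordVec x₀ y i) * β v (coordVec x₀ y j)) := by
    intro v
    conv_lhs => rw [sum_inv_metricMatrix_smul_coordVec x₀ hy v]
    have : (β v) (∑ i, ∑ j, ((metricMatrix x₀ y)⁻¹ i j * inner ℝ v (coordVec x₀ y i)) •
        coordVec x₀ y j) = ∑ i, ∑ j, (metricMatrix x₀ y)⁻¹ i j *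
        (inner ℝ v (coordVec x₀ y i) * β v (coordVec x₀ y j)) := by
      simp only [map_sum, map_smul, smul_eq_mul, mul_assoc]
    rw [← sum_inv_metricMatrix_smul_coordVec x₀ hy v] at this ⊢
    exact this
  -- Only one slot is expanded in the coordinate frame. Summing over the orthonormal basis then
  -- reassembles `coordVec x₀ y i` in the other slot.
  have h2 : ∀ i j, ∑ a, inner ℝ (tangentBasis _ a) (coordVec x₀ y i) *
      β (tangentBasis _ a) (coordVec x₀ y j) = β (coordVec x₀ y i) (coordVec x₀ y j) := by
    intro i j
    conv_rhs => rw [← (tangentBasis _).sum_repr' (coordVec x₀ y i)]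
    simp only [map_sum, map_smul, LinearMap.sum_apply, LinearMap.smul_apply, smul_eq_mul]
  simp only [h1]
  rw [Finset.sum_comm]
  refine Finset.sum_congr rfl fun i _ ↦ ?_
  rw [Finset.sum_comm]
  refine Finset.sum_congr rfl fun j _ ↦ ?_
  rw [← Finset.mul_sum, h2]

/-- The inner product of bilinear forms, in an orthonormal basis and in a chart. -/
lemma sum_tangentBasis_bilin_mul (x₀ : M) {y : ModelE m} (hy : y ∈ (extChartAt (𝓡 m) x₀).target)
    (α β : LinearMap.BilinForm ℝ (TangentSpace (𝓡 m) ((extChartAt (𝓡 m) x₀).symm y))) :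
    ∑ a, ∑ b, α (tangentBasis _ a) (tangentBasis _ b) * β (tangentBasis _ a) (tangentBasis _ b) =
      ∑ i, ∑ k, (metricMatrix x₀ y)⁻¹ i k * ∑ j, ∑ l, (metricMatrix x₀ y)⁻¹ j l *
        (α (coordVec x₀ y j) (coordVec x₀ y i) * β (coordVec x₀ y l) (coordVec x₀ y k)) := by
  -- For a fixed vector in the first slot the product of `α` and `β` is a bilinear form in the
  -- second, so the trace formula applies. It is then applied once more to the first slot.
  have h1 : ∀ v, ∑ b, α v (tangentBasis _ b) * β v (tangentBasis _ b) =
      ∑ i, ∑ k, (metricMatrix x₀ y)⁻¹ i k * (α v (coordVec x₀ y i) * β v (coordVec x₀ y k)) :=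
    fun v ↦ sum_tangentBasis_bilin x₀ hy ((LinearMap.mul ℝ ℝ).compl₁₂ (α v) (β v))
  have h2 : ∀ w w', ∑ a, α (tangentBasis _ a) w * β (tangentBasis _ a) w' =
      ∑ j, ∑ l, (metricMatrix x₀ y)⁻¹ j l * (α (coordVec x₀ y j) w * β (coordVec x₀ y l) w') :=
    fun w w' ↦ sum_tangentBasis_bilin x₀ hy
      ((LinearMap.mul ℝ ℝ).compl₁₂ (α.flip w) (β.flip w'))
  simp only [h1]
  rw [Finset.sum_comm]
  refine Finset.sum_congr rfl fun i _ ↦ ?_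
  rw [Finset.sum_comm]
  refine Finset.sum_congr rfl fun k _ ↦ ?_
  rw [← Finset.mul_sum, h2]

lemma chartForm_le {x₀ : M} {y : ModelE m} (hy : y ∈ (extChartAt (𝓡 m) x₀).target)
    {B : Fin m → Fin m → ℝ} {κ : ℝ}
    (h : ∀ v w : ModelE m, |∑ i, ∑ j, B i j * (v i * w j)| ≤
      κ * (‖mfderiv (𝓡 m) (𝓡 m) (extChartAt (𝓡 m) x₀).symm y v‖ *
        ‖mfderiv (𝓡 m) (𝓡 m) (extChartAt (𝓡 m) x₀).symm y w‖))
    (v w : TangentSpace (𝓡 m) ((extChartAt (𝓡 m) x₀).symm y)) :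
    |chartForm x₀ y B v w| ≤ κ * (‖v‖ * ‖w‖) := by
  have h1 := h (mfderiv (𝓡 m) (𝓡 m) (extChartAt (𝓡 m) x₀) ((extChartAt (𝓡 m) x₀).symm y) v)
    (mfderiv (𝓡 m) (𝓡 m) (extChartAt (𝓡 m) x₀) ((extChartAt (𝓡 m) x₀).symm y) w)
  rw [mfderiv_extChartAt_symm_comp x₀ hy, mfderiv_extChartAt_symm_comp x₀ hy] at h1
  exact h1

end Forms

/-! ### Spatial slices of the space-time map. -/

section Slices

variable {m n : ℕ} {M : Type u} [TopologicalSpace M] [ChartedSpace (ModelE m) M]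
  {N : Type v} [TopologicalSpace N] [ChartedSpace (ModelE n) N]
  {u : ℝ → M → N} {T : EReal}

lemma contMDiff_slice
    (hu : ContMDiffOn ((𝓡 m).prod 𝓘(ℝ, ℝ)) (𝓡 n) ∞ (fun z : M × ℝ ↦ u z.2 z.1)
      (univ ×ˢ timeInterval T)) {t : ℝ} (ht : t ∈ timeInterval T) :
    ContMDiff (𝓡 m) (𝓡 n) ∞ (u t) := by
  rw [← contMDiffOn_univ]
  exact hu.comp (contMDiffOn_id.prodMk (contMDiffOn_const (c := t)))
    (fun x _ ↦ ⟨mem_univ _, ht⟩)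

/-- The chain rule along `y ↦ (y, t)`, which stays in the space-time domain. It therefore holds also
at `t = 0`, where that domain is not a neighbourhood. -/
lemma mfderivWithin_localMap [IsManifold (𝓡 m) ∞ M] [IsManifold (𝓡 n) ∞ N]
    (hu : ContMDiffOn ((𝓡 m).prod 𝓘(ℝ, ℝ)) (𝓡 n) ∞ (fun z : M × ℝ ↦ u z.2 z.1)
      (univ ×ˢ timeInterval T)) (x₀ : M) {t : ℝ} (ht : t ∈ timeInterval T) {y : ModelE m}
    (hy : y ∈ (extChartAt (𝓡 m) x₀).target) (v : ModelE m) :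
    (mfderivWithin 𝓘(ℝ, ModelE m × ℝ) (𝓡 n) (localMap u x₀) (localDomain m x₀ T) (y, t) (v, 0) :
      ModelE n) = mfderiv (𝓡 m) (𝓡 n) (u t) ((extChartAt (𝓡 m) x₀).symm y)
        (mfderiv (𝓡 m) (𝓡 m) (extChartAt (𝓡 m) x₀).symm y v) := by
  have h1 : MDifferentiableWithinAt 𝓘(ℝ, ModelE m × ℝ) (𝓡 n) (localMap u x₀)
      (localDomain m x₀ T) (y, t) :=
    (contMDiffOn_localMap hu x₀).mdifferentiableOn (by simp) _ ⟨hy, ht⟩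
  have h2 : HasFDerivAt (fun y' : ModelE m ↦ (y', t)) (ContinuousLinearMap.inl ℝ (ModelE m) ℝ) y :=
    hasFDerivAt_prodMk_left y t
  have hD := (isOpen_extChartAt_target_model (m := m) x₀).mem_nhds hy
  have h3 := congrArg (fun A ↦ A v) (mfderivWithin_comp (I := 𝓡 m) (I' := 𝓘(ℝ, ModelE m × ℝ)) (I'' := 𝓡 n)
    (f := fun y' : ModelE m ↦ (y', t)) (g := localMap u x₀) (s := (extChartAt (𝓡 m) x₀).target)
    (u := localDomain m x₀ T) y h1
    h2.differentiableAt.differentiableWithinAt.mdifferentiableWithinAt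
    (fun z hz ↦ ⟨hz, ht⟩)
    ((isOpen_extChartAt_target_model (m := m) x₀).uniqueDiffOn.uniqueMDiffOn y hy))
  rw [mfderivWithin_of_mem_nhds hD, mfderivWithin_of_mem_nhds hD, mfderiv_eq_fderiv,
    h2.fderiv] at h3
  refine h3.symm.trans ?_
  exact mfderiv_comp_apply y ((contMDiff_slice hu ht).mdifferentiableAt (by simp))
    (mdifferentiableAt_extChartAt_symm x₀ hy) v

variable [RiemannianBundle (fun y : N ↦ TangentSpace (𝓡 n) y)]

/-- The metric pulled back by a map, as a bilinear form on a tangent space. -/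
def pullbackForm (n : ℕ) {N : Type v} [TopologicalSpace N] [ChartedSpace (ModelE n) N]
    [RiemannianBundle (fun y : N ↦ TangentSpace (𝓡 n) y)] (f : M → N) (x : M) :
    LinearMap.BilinForm ℝ (TangentSpace (𝓡 m) x) :=
  (innerₗ (TangentSpace (𝓡 n) (f x))).compl₁₂ (mfderiv (𝓡 m) (𝓡 n) f x).toLinearMap
    (mfderiv (𝓡 m) (𝓡 n) f x).toLinearMap

lemma pullbackForm_apply (f : M → N) (x : M) (v w : TangentSpace (𝓡 m) x) :
    pullbackForm n f x v w = inner ℝ (mfderiv (𝓡 m) (𝓡 n) f x v) (mfderiv (𝓡 m) (𝓡 n) f x w) :=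
  rfl

lemma pullbackForm_comm (f : M → N) (x : M) (v w : TangentSpace (𝓡 m) x) :
    pullbackForm n f x v w = pullbackForm n f x w v := by
  rw [pullbackForm_apply, pullbackForm_apply]
  exact real_inner_comm _ _

lemma normSqDu_eq_sum_pullbackForm [RiemannianBundle (fun x : M ↦ TangentSpace (𝓡 m) x)] (f : M → N) (x : M) :
    normSqDu m n f x =
      ∑ a, pullbackForm n f x (tangentBasis (m := m) x a) (tangentBasis (m := m) x a) := by
  simp only [normSqDu, pullbackForm_apply, real_inner_self_eq_norm_sq]

lemma spaceTimeMetric_eq_pullbackForm [IsManifold (𝓡 m) ∞ M] [IsManifold (𝓡 n) ∞ N]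
    (hu : ContMDiffOn ((𝓡 m).prod 𝓘(ℝ, ℝ)) (𝓡 n) ∞ (fun z : M × ℝ ↦ u z.2 z.1)
      (univ ×ˢ timeInterval T)) (x₀ : M) {t : ℝ} (ht : t ∈ timeInterval T) {y : ModelE m}
    (hy : y ∈ (extChartAt (𝓡 m) x₀).target) (i j : Fin m) :
    spaceTimeMetric n u x₀ T (spaceVec i) (spaceVec j) (y, t) =
      pullbackForm n (u t) ((extChartAt (𝓡 m) x₀).symm y) (coordVec x₀ y i) (coordVec x₀ y j) := by
  let Φ : ModelE n → ModelE n → ℝ := fun A B ↦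
    inner ℝ (show TangentSpace (𝓡 n) (u t ((extChartAt (𝓡 m) x₀).symm y)) from A)
      (show TangentSpace (𝓡 n) (u t ((extChartAt (𝓡 m) x₀).symm y)) from B)
  exact congrArg₂ Φ (mfderivWithin_localMap hu x₀ ht hy _) (mfderivWithin_localMap hu x₀ ht hy _)

end Slices

/-! ### Chart quantities compared with the energy density and the stress-energy tensor. -/

section Surface

variable {n : ℕ} {M : Type u} [TopologicalSpace M] [ChartedSpace (ModelE 2) M]
  [IsManifold (𝓡 2) ∞ M] [RiemannianBundle (fun x : M ↦ TangentSpace (𝓡 2) x)]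
  {N : Type v} [TopologicalSpace N] [ChartedSpace (ModelE n) N] [IsManifold (𝓡 n) ∞ N]
  [RiemannianBundle (fun y : N ↦ TangentSpace (𝓡 n) y)] {u : ℝ → M → N} {T : EReal}

lemma IsHarmonicMapFlow.energyDensity_eq_localEnergy (hu : IsHarmonicMapFlow 2 n u T) (x₀ : M)
    {t : ℝ} (ht : t ∈ timeInterval T) {y : ModelE 2} (hy : y ∈ (extChartAt (𝓡 2) x₀).target) :
    energyDensity 2 n (u t) ((extChartAt (𝓡 2) x₀).symm y) = localEnergy n u x₀ T t y := by
  have h10 : pullbackForm n (u t) ((extChartAt (𝓡 2) x₀).symm y) (coordVec x₀ y 1)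
      (coordVec x₀ y 0) = pullbackForm n (u t) ((extChartAt (𝓡 2) x₀).symm y) (coordVec x₀ y 0)
      (coordVec x₀ y 1) := pullbackForm_comm _ _ _ _
  rw [energyDensity, normSqDu_eq_sum_pullbackForm, sum_tangentBasis_bilin x₀ hy, localEnergy]
  simp only [spaceTimeMetric_eq_pullbackForm hu.smooth x₀ ht hy, Fin.sum_univ_two, surfaceTrace,
    h10, inv_metricMatrix_one_zero]
  ring

lemma hessian_symm [IsContMDiffRiemannianBundle (𝓡 2) ∞ (ModelE 2)
    (fun x : M ↦ TangentSpace (𝓡 2) x)] (x₀ : M) {φ : ModelE 2 → ℝ} (hφ : ContDiff ℝ ∞ φ)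
    (y : ModelE 2) : hessian x₀ φ 1 0 y = hessian x₀ φ 0 1 y := by
  simp only [hessian, christoffel_symm x₀ y _ 1 0, pderiv_pderiv_comm hφ 1 0]

/-- The pairing of the Hessian with the stress-energy tensor is bounded by the pointwise norm of
the latter. -/
lemma IsHarmonicMapFlow.abs_hessianStress_le [IsContMDiffRiemannianBundle (𝓡 2) ∞ (ModelE 2)
    (fun x : M ↦ TangentSpace (𝓡 2) x)] (hu : IsHarmonicMapFlow 2 n u T) (x₀ : M)
    {φ : ModelE 2 → ℝ} (hφ : ContDiff ℝ ∞ φ) {t : ℝ} (ht : t ∈ timeInterval T) {y : ModelE 2}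
    (hy : y ∈ (extChartAt (𝓡 2) x₀).target) {κ : ℝ} (hκ : 0 ≤ κ)
    (h : ∀ v w : ModelE 2, |∑ i, ∑ j, hessian x₀ φ i j y * (v i * w j)| ≤
      κ * (‖mfderiv (𝓡 2) (𝓡 2) (extChartAt (𝓡 2) x₀).symm y v‖ *
        ‖mfderiv (𝓡 2) (𝓡 2) (extChartAt (𝓡 2) x₀).symm y w‖)) :
    |hessianStress n u x₀ T φ t y| ≤
      2 * κ * stressNorm 2 n (u t) ((extChartAt (𝓡 2) x₀).symm y) := by
  set H := chartForm x₀ y (fun i j ↦ hessian x₀ φ i j y) with hH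
  -- In an orthonormal basis the pairing is the plain sum of products of entries: the part −e(u)g of
  -- the stress-energy tensor contributes −e(u) times the trace of the Hessian.
  have hHS : hessianStress n u x₀ T φ t y =
      ∑ a, ∑ b, H (tangentBasis ((extChartAt (𝓡 2) x₀).symm y) a) (tangentBasis ((extChartAt (𝓡 2) x₀).symm y) b) *
        stressEnergy 2 n (u t) ((extChartAt (𝓡 2) x₀).symm y) (tangentBasis ((extChartAt (𝓡 2) x₀).symm y) a) (tangentBasis ((extChartAt (𝓡 2) x₀).symm y) b) := by
    have h10 : pullbackForm n (u t) ((extChartAt (𝓡 2) x₀).symm y) (coordVec x₀ y 1)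
      (coordVec x₀ y 0) = pullbackForm n (u t) ((extChartAt (𝓡 2) x₀).symm y) (coordVec x₀ y 0)
      (coordVec x₀ y 1) := pullbackForm_comm _ _ _ _
    have h1 : ∀ a b, H (tangentBasis ((extChartAt (𝓡 2) x₀).symm y) a) (tangentBasis ((extChartAt (𝓡 2) x₀).symm y) b) *
        stressEnergy 2 n (u t) ((extChartAt (𝓡 2) x₀).symm y) (tangentBasis ((extChartAt (𝓡 2) x₀).symm y) a) (tangentBasis ((extChartAt (𝓡 2) x₀).symm y) b) =
        H (tangentBasis ((extChartAt (𝓡 2) x₀).symm y) a) (tangentBasis ((extChartAt (𝓡 2) x₀).symm y) b) *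
          pullbackForm n (u t) ((extChartAt (𝓡 2) x₀).symm y) (tangentBasis ((extChartAt (𝓡 2) x₀).symm y) a) (tangentBasis ((extChartAt (𝓡 2) x₀).symm y) b) -
        energyDensity 2 n (u t) ((extChartAt (𝓡 2) x₀).symm y) * if a = b then H (tangentBasis ((extChartAt (𝓡 2) x₀).symm y) a) (tangentBasis ((extChartAt (𝓡 2) x₀).symm y) b) else 0 := by
      intro a b
      rw [stressEnergy, pullbackForm_apply, (tangentBasis ((extChartAt (𝓡 2) x₀).symm y)).inner_eq_ite, energyDensity]
      split_ifs <;> ring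
    simp only [h1, Finset.sum_sub_distrib, ← Finset.mul_sum, Finset.sum_ite_eq, Finset.mem_univ,
      if_true]
    rw [sum_tangentBasis_bilin_mul x₀ hy, sum_tangentBasis_bilin x₀ hy,
      hu.energyDensity_eq_localEnergy x₀ ht hy]
    simp only [hessianStress, spaceTimeMetric_eq_pullbackForm hu.smooth x₀ ht hy,
      Fin.sum_univ_two, surfaceTrace, surfaceInner, hH, chartForm_coordVec x₀ hy, h10,
      inv_metricMatrix_one_zero, hessian_symm x₀ hφ]
    ring
  have hHb : ∀ a b, H (tangentBasis ((extChartAt (𝓡 2) x₀).symm y) a) (tangentBasis ((extChartAt (𝓡 2) x₀).symm y) b) ^ 2 ≤ κ ^ 2 := by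
    intro a b
    have := chartForm_le hy h (tangentBasis ((extChartAt (𝓡 2) x₀).symm y) a) (tangentBasis ((extChartAt (𝓡 2) x₀).symm y) b)
    rw [(tangentBasis ((extChartAt (𝓡 2) x₀).symm y)).norm_eq_one, (tangentBasis ((extChartAt (𝓡 2) x₀).symm y)).norm_eq_one] at this
    exact sq_le_sq' (by linarith [(abs_le.1 this).1]) (by linarith [(abs_le.1 this).2])
  have hcard : Fintype.card (Fin (Module.finrank ℝ (TangentSpace (𝓡 2) ((extChartAt (𝓡 2) x₀).symm y)))) = 2 := by
    rw [Fintype.card_fin]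
    exact finrank_euclideanSpace_fin
  rw [hHS, stressNorm, ← Real.sqrt_sq_eq_abs]
  rw [← Finset.sum_product', ← Finset.sum_product']
  have hcs := Finset.sum_mul_sq_le_sq_mul_sq
    (Finset.univ ×ˢ Finset.univ : Finset (_ × _))
    (fun p ↦ H (tangentBasis ((extChartAt (𝓡 2) x₀).symm y) p.1) (tangentBasis ((extChartAt (𝓡 2) x₀).symm y) p.2))
    (fun p ↦ stressEnergy 2 n (u t) ((extChartAt (𝓡 2) x₀).symm y) (tangentBasis ((extChartAt (𝓡 2) x₀).symm y) p.1) (tangentBasis ((extChartAt (𝓡 2) x₀).symm y) p.2))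
  -- The Hessian has four entries, each bounded by `κ`, so its Hilbert–Schmidt norm is at most `2 *
  -- κ`. Cauchy–Schwarz does the rest.
  have hsum : ∑ p ∈ (Finset.univ ×ˢ Finset.univ : Finset (_ × _)),
      H (tangentBasis ((extChartAt (𝓡 2) x₀).symm y) p.1) (tangentBasis ((extChartAt (𝓡 2) x₀).symm y) p.2) ^ 2 ≤ (2 * κ) ^ 2 := by
    refine (Finset.sum_le_card_nsmul _ _ (κ ^ 2) fun p _ ↦ hHb p.1 p.2).trans ?_
    rw [Finset.card_product, Finset.card_univ, hcard]
    simp only [nsmul_eq_mul]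
    push_cast
    nlinarith
  have h2 : (2 * κ) * √(∑ p ∈ (Finset.univ ×ˢ Finset.univ : Finset (_ × _)),
      stressEnergy 2 n (u t) ((extChartAt (𝓡 2) x₀).symm y) (tangentBasis ((extChartAt (𝓡 2) x₀).symm y) p.1) (tangentBasis ((extChartAt (𝓡 2) x₀).symm y) p.2) ^ 2) =
      √((2 * κ) ^ 2 * ∑ p ∈ (Finset.univ ×ˢ Finset.univ : Finset (_ × _)),
      stressEnergy 2 n (u t) ((extChartAt (𝓡 2) x₀).symm y) (tangentBasis ((extChartAt (𝓡 2) x₀).symm y) p.1) (tangentBasis ((extChartAt (𝓡 2) x₀).symm y) p.2) ^ 2) := by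
    rw [Real.sqrt_mul (sq_nonneg _), Real.sqrt_sq (by linarith)]
  rw [h2]
  exact Real.sqrt_le_sqrt (hcs.trans (mul_le_mul_of_nonneg_right hsum
    (Finset.sum_nonneg fun p _ ↦ sq_nonneg _)))

end Surface

/-! ### Transition maps and the volume density. -/

section Transition

variable {M : Type u} [TopologicalSpace M] [ChartedSpace (ModelE 2) M]
  [IsManifold (𝓡 2) ∞ M]

/-- The transition map between two charts. -/
def transition (x₀ x₁ : M) (y : ModelE 2) : ModelE 2 :=
  extChartAt (𝓡 2) x₁ ((extChartAt (𝓡 2) x₀).symm y)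

lemma mdifferentiableAt_transition (x₀ x₁ : M) {y : ModelE 2} (hy : y ∈ (extChartAt (𝓡 2) x₀).target)
    (hy₁ : (extChartAt (𝓡 2) x₀).symm y ∈ (extChartAt (𝓡 2) x₁).source) :
    MDifferentiableAt (𝓡 2) (𝓡 2) (transition x₀ x₁) y :=
  (mdifferentiableAt_extChartAt_of_mem x₁ hy₁).comp y (mdifferentiableAt_extChartAt_symm x₀ hy)

lemma mfderiv_extChartAt_symm_eq_comp_transition (x₀ x₁ : M) {y : ModelE 2}
    (hy : y ∈ (extChartAt (𝓡 2) x₀).target)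
    (hy₁ : (extChartAt (𝓡 2) x₀).symm y ∈ (extChartAt (𝓡 2) x₁).source) (v : ModelE 2) :
    (mfderiv (𝓡 2) (𝓡 2) (extChartAt (𝓡 2) x₀).symm y v : ModelE 2) =
      mfderiv (𝓡 2) (𝓡 2) (extChartAt (𝓡 2) x₁).symm (transition x₀ x₁ y)
        (fderiv ℝ (transition x₀ x₁) y v) := by
  have h0 : transition x₀ x₁ y ∈ (extChartAt (𝓡 2) x₁).target :=
    (extChartAt (𝓡 2) x₁).map_source hy₁
  have h1 := mfderiv_comp_apply y (mdifferentiableAt_extChartAt_symm x₁ h0)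
    (mdifferentiableAt_transition x₀ x₁ hy hy₁) v
  have h2 : (extChartAt (𝓡 2) x₁).symm ∘ transition x₀ x₁ =ᶠ[𝓝 y] (extChartAt (𝓡 2) x₀).symm := by
    have h3 := (continuousAt_extChartAt_symm'' hy).preimage_mem_nhds
      ((isOpen_extChartAt_source (I := 𝓡 2) x₁).mem_nhds hy₁)
    filter_upwards [h3] with z hz
    exact (extChartAt (𝓡 2) x₁).left_inv hz
  rw [h2.mfderiv_eq] at h1
  rw [mfderiv_eq_fderiv] at h1
  exact h1

variable [RiemannianBundle (fun x : M ↦ TangentSpace (𝓡 2) x)]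

/-- With J the matrix of the differential of the transition map, the two metric matrices satisfy g₀
= Jᵀ g₁ J. The lemma is the root of the determinant of this relation. -/
lemma volumeDensity_eq_abs_det_mul (x₀ x₁ : M) {y : ModelE 2}
    (hy : y ∈ (extChartAt (𝓡 2) x₀).target)
    (hy₁ : (extChartAt (𝓡 2) x₀).symm y ∈ (extChartAt (𝓡 2) x₁).source) :
    volumeDensity x₀ y =
      |(fderiv ℝ (transition x₀ x₁) y).det| * volumeDensity x₁ (transition x₀ x₁ y) := by
  set A := fderiv ℝ (transition x₀ x₁) y with hA
  let b := (EuclideanSpace.basisFun (Fin 2) ℝ).toBasis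
  set J := LinearMap.toMatrix b b (A : ModelE 2 →ₗ[ℝ] ModelE 2) with hJ
  have h0 : transition x₀ x₁ y ∈ (extChartAt (𝓡 2) x₁).target :=
    (extChartAt (𝓡 2) x₁).map_source hy₁
  have hx : (extChartAt (𝓡 2) x₁).symm (transition x₀ x₁ y) = (extChartAt (𝓡 2) x₀).symm y :=
    (extChartAt (𝓡 2) x₁).left_inv hy₁
  have hG : metricMatrix x₀ y = J.transpose * metricMatrix x₁ (transition x₀ x₁ y) * J := by
    ext i j
    let Φ : M → ModelE 2 → ModelE 2 → ℝ := fun x A B ↦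
      inner ℝ (show TangentSpace (𝓡 2) x from A) (show TangentSpace (𝓡 2) x from B)
    have h1 : metricMatrix x₀ y i j = Φ ((extChartAt (𝓡 2) x₀).symm y)
        (mfderiv (𝓡 2) (𝓡 2) (extChartAt (𝓡 2) x₀).symm y (EuclideanSpace.single i (1 : ℝ)))
        (mfderiv (𝓡 2) (𝓡 2) (extChartAt (𝓡 2) x₀).symm y (EuclideanSpace.single j (1 : ℝ))) := rfl
    rw [h1, ← hx]
    have h2 := inner_mfderiv_extChartAt_symm x₁ (transition x₀ x₁ y)
      (A (EuclideanSpace.single i (1 : ℝ))) (A (EuclideanSpace.single j (1 : ℝ)))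
    have h3 := congrArg₂ (Φ ((extChartAt (𝓡 2) x₁).symm (transition x₀ x₁ y)))
      (mfderiv_extChartAt_symm_eq_comp_transition x₀ x₁ hy hy₁ (EuclideanSpace.single i (1 : ℝ)))
      (mfderiv_extChartAt_symm_eq_comp_transition x₀ x₁ hy hy₁ (EuclideanSpace.single j (1 : ℝ)))
    refine h3.trans (h2.trans ?_)
    simp only [Matrix.mul_apply, Fin.sum_univ_two, Matrix.transpose_apply, hJ,
      LinearMap.toMatrix_apply, b, OrthonormalBasis.coe_toBasis, EuclideanSpace.basisFun_apply,
      OrthonormalBasis.coe_toBasis_repr_apply, EuclideanSpace.basisFun_repr,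
      ContinuousLinearMap.coe_coe]
    ring
  have hdet : J.det = A.det := LinearMap.det_toMatrix b _
  rw [volumeDensity, hG, Matrix.det_mul, Matrix.det_mul, Matrix.det_transpose, hdet, volumeDensity,
    ← Real.sqrt_sq_eq_abs, ← Real.sqrt_mul (sq_nonneg _)]
  congr 1
  ring

end Transition

/-! ### The Riemannian measure in a chart. -/

section Volume

variable {M : Type u} [TopologicalSpace M] [ChartedSpace (ModelE 2) M]
  [MeasurableSpace M]

lemma measurable_indicator_extChartAt [BorelSpace M] {β : Type*} [MeasurableSpace β] [Zero β]
    [TopologicalSpace β] [BorelSpace β] (x₀ : M)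
    {f : ModelE 2 → β} (hf : ContinuousOn f (extChartAt (𝓡 2) x₀).target) :
    Measurable ((extChartAt (𝓡 2) x₀).source.indicator fun x ↦ f (extChartAt (𝓡 2) x₀ x)) := by
  classical
  rw [← piecewise_eq_indicator]
  exact ContinuousOn.measurable_piecewise (hf.comp (continuousOn_extChartAt x₀)
    (extChartAt (𝓡 2) x₀).mapsTo) continuousOn_const
    (isOpen_extChartAt_source (I := 𝓡 2) x₀).measurableSet

lemma aemeasurable_extChartAt_symm [BorelSpace M] (x₀ : M) :
    AEMeasurable (extChartAt (𝓡 2) x₀).symm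
      ((volume : Measure (ModelE 2)).restrict (extChartAt (𝓡 2) x₀).target) :=
  (continuousOn_extChartAt_symm x₀).aemeasurable
    (isOpen_extChartAt_target_model (m := 2) x₀).measurableSet

variable [RiemannianBundle (fun x : M ↦ TangentSpace (𝓡 2) x)]

lemma chartVolume_eq_map (x₀ : M) : chartVolume (m := 2) x₀ =
    (((volume : Measure (ModelE 2)).restrict (extChartAt (𝓡 2) x₀).target).withDensity
      fun y ↦ ENNReal.ofReal (volumeDensity x₀ y)).map (extChartAt (𝓡 2) x₀).symm := rfl

lemma chartVolume_apply [BorelSpace M] (x₀ : M) {s : Set M} (hs : MeasurableSet s) :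
    chartVolume (m := 2) x₀ s =
      ∫⁻ y in (extChartAt (𝓡 2) x₀).target ∩ (extChartAt (𝓡 2) x₀).symm ⁻¹' s,
        ENNReal.ofReal (volumeDensity x₀ y) := by
  have hD := (isOpen_extChartAt_target_model (m := 2) x₀).measurableSet
  have hac := withDensity_absolutelyContinuous
    ((volume : Measure (ModelE 2)).restrict (extChartAt (𝓡 2) x₀).target)
    (fun y ↦ ENNReal.ofReal (volumeDensity x₀ y))
  have hm := aemeasurable_extChartAt_symm x₀
  have hns := hm.nullMeasurableSet_preimage hs
  rw [chartVolume_eq_map, Measure.map_apply_of_aemeasurable (hm.mono_ac hac) hs]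
  rw [withDensity_apply₀ _ hns, Measure.restrict_restrict₀ hns, inter_comm]

lemma lintegral_chartVolume [BorelSpace M] [IsManifold (𝓡 2) ∞ M] [IsContMDiffRiemannianBundle (𝓡 2) ∞ (ModelE 2)
    (fun x : M ↦ TangentSpace (𝓡 2) x)] (x₀ : M) {f : M → ℝ≥0∞} (hf : Measurable f) :
    ∫⁻ x, f x ∂(chartVolume (m := 2) x₀) = ∫⁻ y in (extChartAt (𝓡 2) x₀).target,
      ENNReal.ofReal (volumeDensity x₀ y) * f ((extChartAt (𝓡 2) x₀).symm y) := by
  have hD := (isOpen_extChartAt_target_model (m := 2) x₀).measurableSet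
  have hac := withDensity_absolutelyContinuous
    ((volume : Measure (ModelE 2)).restrict (extChartAt (𝓡 2) x₀).target)
    (fun y ↦ ENNReal.ofReal (volumeDensity x₀ y))
  have hm := aemeasurable_extChartAt_symm x₀
  rw [chartVolume_eq_map, lintegral_map' hf.aemeasurable (hm.mono_ac hac)]
  exact lintegral_withDensity_eq_lintegral_mul₀
    ((continuousOn_volumeDensity x₀).aemeasurable hD).ennreal_ofReal (hf.comp_aemeasurable hm)

/-- Change of variables along the transition map. There is only an inequality because the chart at
`x₁` may miss part of `s`. -/
lemma chartVolume_le_of_subset [BorelSpace M] [IsManifold (𝓡 2) ∞ M] (x₀ x₁ : M) {s : Set M} (hs : MeasurableSet s)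
    (hsub : s ⊆ (extChartAt (𝓡 2) x₀).source) :
    chartVolume (m := 2) x₁ s ≤ chartVolume (m := 2) x₀ s := by
  set ψ₀ := extChartAt (𝓡 2) x₀ with hψ₀
  set ψ₁ := extChartAt (𝓡 2) x₁ with hψ₁
  have hO : MeasurableSet ψ₁.source := (isOpen_extChartAt_source (I := 𝓡 2) x₁).measurableSet
  set B := ψ₀.target ∩ ψ₀.symm ⁻¹' (s ∩ ψ₁.source) with hB
  have himg : ψ₁.target ∩ ψ₁.symm ⁻¹' s = transition x₀ x₁ '' B := by
    ext z
    constructor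
    · rintro ⟨hz, hzs⟩
      have h0 := ψ₀.left_inv (hsub hzs)
      refine ⟨ψ₀ (ψ₁.symm z), ⟨ψ₀.map_source (hsub hzs), ?_⟩, ?_⟩
      · rw [mem_preimage, h0]
        exact ⟨hzs, ψ₁.map_target hz⟩
      · change ψ₁ (ψ₀.symm _) = z
        rw [h0, ψ₁.right_inv hz]
    · rintro ⟨y, ⟨hy, hys, hy₁⟩, rfl⟩
      refine ⟨ψ₁.map_source hy₁, ?_⟩
      change ψ₁.symm (ψ₁ (ψ₀.symm y)) ∈ s
      rw [ψ₁.left_inv hy₁]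
      exact hys
  have hBm : MeasurableSet B := by
    rw [hB]
    classical
    have hD := (isOpen_extChartAt_target_model (m := 2) x₀).measurableSet
    -- The inverse chart is continuous only on its target. Extended by a constant it becomes
    -- measurable, and the preimage within the target does not change.
    have h1 := ((continuousOn_extChartAt_symm (I := 𝓡 2) x₀).measurable_piecewise
      (continuousOn_const (c := x₀)) hD) (hs.inter hO)
    have h2 : B = ψ₀.target ∩ ψ₀.target.piecewise ψ₀.symm (fun _ ↦ x₀) ⁻¹' (s ∩ ψ₁.source) := by
      ext y
      refine and_congr_right fun hy ↦ ?_
      rw [mem_preimage, mem_preimage, piecewise_eq_of_mem _ _ _ hy]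
    rw [← hB, h2]
    exact hD.inter h1
  have hder : ∀ y ∈ B, HasFDerivWithinAt (transition x₀ x₁) (fderiv ℝ (transition x₀ x₁) y) B y :=
    fun y hy ↦ ((mdifferentiableAt_transition x₀ x₁ hy.1 hy.2.2).differentiableAt).hasFDerivAt.hasFDerivWithinAt
  have hinj : InjOn (transition x₀ x₁) B := by
    intro y hy z hz h
    have := ψ₁.injOn hy.2.2 hz.2.2 h
    exact ψ₀.symm.injOn hy.1 hz.1 this
  rw [chartVolume_apply x₁ hs, ← hψ₁, himg, lintegral_image_eq_lintegral_abs_det_fderiv_mul volume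
    hBm hder hinj, chartVolume_apply x₀ hs]
  calc _ = ∫⁻ y in B, ENNReal.ofReal (volumeDensity x₀ y) := by
        refine setLIntegral_congr_fun hBm fun y hy ↦ ?_
        rw [volumeDensity_eq_abs_det_mul x₀ x₁ hy.1 hy.2.2, ENNReal.ofReal_mul (abs_nonneg _)]
    _ ≤ _ := lintegral_mono_set (inter_subset_inter_right _ (preimage_mono inter_subset_left))

lemma chartVolume_le_riemannianVolume (x₀ : M) :
    chartVolume (m := 2) x₀ ≤ riemannianVolume 2 M := le_iSup _ x₀

/-- The Riemannian volume agrees with the chart volume on the domain of the chart. -/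
lemma restrict_riemannianVolume [BorelSpace M] [IsManifold (𝓡 2) ∞ M] (x₀ : M) :
    (riemannianVolume 2 M).restrict (extChartAt (𝓡 2) x₀).source =
      (chartVolume (m := 2) x₀).restrict (extChartAt (𝓡 2) x₀).source := by
  have hO : MeasurableSet (extChartAt (𝓡 2) x₀).source :=
    (isOpen_extChartAt_source (I := 𝓡 2) x₀).measurableSet
  refine le_antisymm ?_ (Measure.restrict_mono_measure (chartVolume_le_riemannianVolume x₀) _)
  -- A supremum of measures is bounded by exhibiting a measure above each of them. The second
  -- summand disappears after restriction to the chart domain.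
  have h : riemannianVolume 2 M ≤ (chartVolume (m := 2) x₀) +
      (riemannianVolume 2 M).restrict (extChartAt (𝓡 2) x₀).sourceᶜ := by
    refine iSup_le fun x₁ ↦ Measure.le_iff.2 fun s hs ↦ ?_
    rw [← measure_inter_add_sdiff s hO, Measure.add_apply, Measure.restrict_apply hs]
    refine add_le_add ?_ ?_
    · exact (chartVolume_le_of_subset x₀ x₁ (hs.inter hO) inter_subset_right).trans
        (measure_mono inter_subset_left)
    · exact chartVolume_le_riemannianVolume x₁ _
  refine (Measure.restrict_mono_measure h _).trans ?_
  rw [Measure.restrict_add, Measure.restrict_restrict hO, inter_compl_self, Measure.restrict_empty,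
    add_zero]

lemma lintegral_chartVolume_indicator [BorelSpace M] [IsManifold (𝓡 2) ∞ M]
    [IsContMDiffRiemannianBundle (𝓡 2) ∞ (ModelE 2) (fun x : M ↦ TangentSpace (𝓡 2) x)] (x₀ : M)
    {f : ModelE 2 → ℝ≥0∞} (hf : ContinuousOn f (extChartAt (𝓡 2) x₀).target) :
    ∫⁻ x, (extChartAt (𝓡 2) x₀).source.indicator (fun x ↦ f (extChartAt (𝓡 2) x₀ x)) x
        ∂(chartVolume (m := 2) x₀) =
      ∫⁻ y in (extChartAt (𝓡 2) x₀).target, ENNReal.ofReal (volumeDensity x₀ y) * f y := by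
  rw [lintegral_chartVolume x₀ (measurable_indicator_extChartAt x₀ hf)]
  refine setLIntegral_congr_fun (isOpen_extChartAt_target_model (m := 2) x₀).measurableSet
    fun y hy ↦ ?_
  rw [indicator_of_mem ((extChartAt (𝓡 2) x₀).map_target hy), (extChartAt (𝓡 2) x₀).right_inv hy]

lemma lintegral_riemannianVolume_indicator [BorelSpace M] [IsManifold (𝓡 2) ∞ M]
    [IsContMDiffRiemannianBundle (𝓡 2) ∞ (ModelE 2) (fun x : M ↦ TangentSpace (𝓡 2) x)] (x₀ : M)
    {f : ModelE 2 → ℝ≥0∞} (hf : ContinuousOn f (extChartAt (𝓡 2) x₀).target) :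
    ∫⁻ x, (extChartAt (𝓡 2) x₀).source.indicator (fun x ↦ f (extChartAt (𝓡 2) x₀ x)) x
        ∂(riemannianVolume 2 M) =
      ∫⁻ y in (extChartAt (𝓡 2) x₀).target, ENNReal.ofReal (volumeDensity x₀ y) * f y := by
  have hO : MeasurableSet (extChartAt (𝓡 2) x₀).source :=
    (isOpen_extChartAt_source (I := 𝓡 2) x₀).measurableSet
  rw [← lintegral_chartVolume_indicator x₀ hf, lintegral_indicator hO, lintegral_indicator hO,
    restrict_riemannianVolume x₀]

end Volume

/-! ### Riemannian distance compared with coordinate distance. -/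

section Distance

variable {m : ℕ} {M : Type u} [EMetricSpace M] [ChartedSpace (ModelE m) M]
  [RiemannianBundle (fun x : M ↦ TangentSpace (𝓡 m) x)]
  {F : Type*} [NormedAddCommGroup F] [NormedSpace ℝ F]

/-- The distance of two points in a convex part of a chart is bounded by the length of the
coordinate segment. -/
lemma edist_extChartAt_symm_le [IsManifold (𝓡 m) ∞ M] [IsRiemannianManifold (𝓡 m) M] (x₀ : M) {V : Set (ModelE m)}
    (hV : Convex ℝ V) (hVD : V ⊆ (extChartAt (𝓡 m) x₀).target) (ℓ : ModelE m →L[ℝ] F) {c : ℝ}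
    (h : ∀ y ∈ V, ∀ v, ‖mfderiv (𝓡 m) (𝓡 m) (extChartAt (𝓡 m) x₀).symm y v‖ ≤ c * ‖ℓ v‖)
    {y z : ModelE m} (hy : y ∈ V) (hz : z ∈ V) :
    edist ((extChartAt (𝓡 m) x₀).symm y) ((extChartAt (𝓡 m) x₀).symm z) ≤
      ENNReal.ofReal (c * ‖ℓ (z - y)‖) := by
  set η : ℝ → ModelE m := fun t ↦ y + t • (z - y) with hη
  have hηd : ∀ t, HasDerivAt η (z - y) t := fun t ↦
    (((hasDerivAt_id t).smul_const (z - y)).const_add y).congr_deriv (one_smul _ _)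
  have hηV : ∀ t ∈ Icc (0 : ℝ) 1, η t ∈ V := fun t ht ↦
    hV.add_smul_sub_mem hy hz ht
  have hηs : ContMDiff 𝓘(ℝ, ℝ) (𝓡 m) 1 η := by
    rw [contMDiff_iff_contDiff]
    fun_prop
  rw [IsRiemannianManifold.out (I := 𝓡 m)]
  refine (riemannianEDist_le_pathELength (γ := (extChartAt (𝓡 m) x₀).symm ∘ η) (a := 0) (b := 1)
    ((contMDiffOn_extChartAt_symm (n := 1) x₀).comp hηs.contMDiffOn
      fun t ht ↦ hVD (hηV t ht)) (by simp [hη]) (by simp [hη]) zero_le_one).trans ?_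
  rw [pathELength_eq_lintegral_mfderiv_Icc]
  calc _ ≤ ∫⁻ _ in Icc (0 : ℝ) 1, ENNReal.ofReal (c * ‖ℓ (z - y)‖) := by
        refine setLIntegral_mono' measurableSet_Icc fun t ht ↦ ?_
        have h1 := mfderiv_comp_apply t
          (mdifferentiableAt_extChartAt_symm x₀ (hVD (hηV t ht)))
          ((hηd t).differentiableAt.mdifferentiableAt) (1 : ℝ)
        rw [mfderiv_eq_fderiv] at h1
        rw [← ofReal_norm]
        refine ENNReal.ofReal_le_ofReal ((congrArg norm h1).trans_le ?_)
        have h2 : fderiv ℝ η t (1 : ℝ) = z - y := by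
          rw [(hηd t).hasFDerivAt.fderiv]
          simp
        have h3 := h _ (hηV t ht) (fderiv ℝ η t (1 : ℝ))
        rw [h2] at h3
        refine le_trans (le_of_eq ?_) h3
        rw [← h2]
        rfl
    _ = _ := by simp

/-- The coordinate distance of the end points of a path is bounded by the length of the path. -/
lemma enorm_sub_extChartAt_le [IsManifold (𝓡 m) ∞ M] (x₀ : M) {V : Set (ModelE m)}
    (ℓ : ModelE m →L[ℝ] F) [CompleteSpace F] {c : ℝ} (hc : 0 ≤ c)
    (h : ∀ y ∈ V, ∀ v, ‖ℓ v‖ ≤ c * ‖mfderiv (𝓡 m) (𝓡 m) (extChartAt (𝓡 m) x₀).symm y v‖)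
    {γ : ℝ → M} (hγ : ContMDiffOn 𝓘(ℝ, ℝ) (𝓡 m) 1 γ (Icc 0 1))
    (hγs : ∀ t ∈ Icc (0 : ℝ) 1, γ t ∈ (extChartAt (𝓡 m) x₀).source)
    (hγV : ∀ t ∈ Icc (0 : ℝ) 1, extChartAt (𝓡 m) x₀ (γ t) ∈ V) :
    ‖ℓ (extChartAt (𝓡 m) x₀ (γ 1) - extChartAt (𝓡 m) x₀ (γ 0))‖ₑ ≤
      ENNReal.ofReal c * pathELength (𝓡 m) γ 0 1 := by
  have h1 : ContMDiffOn 𝓘(ℝ, ℝ) (𝓡 m) 1 (extChartAt (𝓡 m) x₀ ∘ γ) (Icc 0 1) :=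
    (contMDiffOn_extChartAt (n := 1) (x := x₀)).comp hγ fun t ht ↦ by simpa using hγs t ht
  have h2 : ContDiffOn ℝ 1 (fun t ↦ ℓ (extChartAt (𝓡 m) x₀ (γ t))) (Icc 0 1) :=
    ℓ.contDiff.comp_contDiffOn (contMDiffOn_iff_contDiffOn.1 h1)
  have h3 := enorm_sub_le_lintegral_derivWithin_Icc_of_contDiffOn_Icc h2 zero_le_one
  rw [← map_sub] at h3
  refine h3.trans ?_
  rw [pathELength_eq_lintegral_mfderiv_Icc, ← restrict_Ioo_eq_restrict_Icc,
    ← lintegral_const_mul' _ _ ENNReal.ofReal_ne_top]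
  refine setLIntegral_mono' measurableSet_Ioo fun t ht ↦ ?_
  have ht' := Ioo_subset_Icc_self ht
  have hn := Icc_mem_nhds ht.1 ht.2
  have hd := ((hγ t ht').contMDiffAt hn).mdifferentiableAt (by simp)
  have h4 := mfderiv_comp_apply t (mdifferentiableAt_extChartAt_of_mem x₀ (hγs t ht')) hd (1 : ℝ)
  have h5 : DifferentiableAt ℝ (extChartAt (𝓡 m) x₀ ∘ γ) t :=
    ((h1 t ht').contMDiffAt hn).mdifferentiableAt (by simp) |>.differentiableAt
  rw [mfderiv_eq_fderiv] at h4
  have h6 : derivWithin (fun t ↦ ℓ (extChartAt (𝓡 m) x₀ (γ t))) (Icc 0 1) t =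
      ℓ (fderiv ℝ (extChartAt (𝓡 m) x₀ ∘ γ) t (1 : ℝ)) := by
    rw [derivWithin_of_mem_nhds hn]
    exact (ℓ.hasFDerivAt.comp_hasDerivAt t h5.hasFDerivAt.hasDerivAt).deriv
  rw [h6, ← ofReal_norm, ← ofReal_norm, ← ENNReal.ofReal_mul hc]
  refine ENNReal.ofReal_le_ofReal ?_
  refine (h _ (hγV t ht') _).trans (mul_le_mul_of_nonneg_left (le_of_eq ?_) hc)
  have h7 : ∀ (x : M), x ∈ (extChartAt (𝓡 m) x₀).source → ∀ v : TangentSpace (𝓡 m) x,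
      ‖mfderiv (𝓡 m) (𝓡 m) (extChartAt (𝓡 m) x₀).symm (extChartAt (𝓡 m) x₀ x)
        (mfderiv (𝓡 m) (𝓡 m) (extChartAt (𝓡 m) x₀) x v)‖ = ‖v‖ := by
    intro x hx
    obtain ⟨y, hy, rfl⟩ : ∃ y ∈ (extChartAt (𝓡 m) x₀).target, (extChartAt (𝓡 m) x₀).symm y = x :=
      ⟨_, (extChartAt (𝓡 m) x₀).map_source hx, (extChartAt (𝓡 m) x₀).left_inv hx⟩
    intro v
    rw [(extChartAt (𝓡 m) x₀).right_inv hy]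
    exact congrArg norm (mfderiv_extChartAt_symm_comp x₀ hy v)
  refine Eq.trans ?_ (h7 _ (hγs t ht') (mfderiv 𝓘(ℝ, ℝ) (𝓡 m) γ t (1 : ℝ)))
  exact congrArg (fun w : ModelE m ↦ ‖mfderiv (𝓡 m) (𝓡 m) (extChartAt (𝓡 m) x₀).symm
    (extChartAt (𝓡 m) x₀ (γ t)) w‖) h4

lemma edist_le_pathELength [IsRiemannianManifold (𝓡 m) M] {γ : ℝ → M}
    (hγ : ContMDiffOn 𝓘(ℝ, ℝ) (𝓡 m) 1 γ (Icc 0 1)) {t : ℝ} (ht : t ∈ Icc (0 : ℝ) 1) :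
    edist (γ 0) (γ t) ≤ pathELength (𝓡 m) γ 0 1 := by
  rw [IsRiemannianManifold.out (I := 𝓡 m)]
  exact (riemannianEDist_le_pathELength (hγ.mono (Icc_subset_Icc_right ht.2)) rfl rfl ht.1).trans
    (pathELength_mono le_rfl ht.2)

/-- The coordinate distance of two points is bounded by their distance, if balls of that radius
lie in a part of the chart where the metric is controlled. -/
lemma norm_sub_extChartAt_le [IsManifold (𝓡 m) ∞ M] [IsRiemannianManifold (𝓡 m) M] [CompleteSpace F] (x₀ : M)
    {V : Set (ModelE m)} (ℓ : ModelE m →L[ℝ] F) {c : ℝ} (hc : 0 ≤ c)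
    (h : ∀ y ∈ V, ∀ v, ‖ℓ v‖ ≤ c * ‖mfderiv (𝓡 m) (𝓡 m) (extChartAt (𝓡 m) x₀).symm y v‖)
    {p : M} {s : ℝ} (hs : 0 ≤ s)
    (hball : ∀ x, edist p x < ENNReal.ofReal s →
      x ∈ (extChartAt (𝓡 m) x₀).source ∧ extChartAt (𝓡 m) x₀ x ∈ V)
    {x : M} (hx : edist p x < ENNReal.ofReal s) :
    ‖ℓ (extChartAt (𝓡 m) x₀ x - extChartAt (𝓡 m) x₀ p)‖ ≤ c * s := by
  rw [IsRiemannianManifold.out (I := 𝓡 m)] at hx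
  obtain ⟨γ, rfl, rfl, hγ, hlen⟩ := exists_lt_of_riemannianEDist_lt hx
  -- A path from `p` of length less than `s` never leaves the ball of radius `s`, so it stays in the
  -- controlled part of the chart.
  have hb := fun t ht ↦ hball _ ((edist_le_pathELength hγ (t := t) ht).trans_lt hlen)
  have h1 := enorm_sub_extChartAt_le x₀ ℓ hc h hγ (fun t ht ↦ (hb t ht).1)
    (fun t ht ↦ (hb t ht).2)
  have h2 := h1.trans (mul_le_mul_right hlen.le _)
  rw [← ENNReal.ofReal_mul hc, ← ofReal_norm,
    ENNReal.ofReal_le_ofReal_iff (mul_nonneg hc hs)] at h2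
  exact h2

end Distance

/-! ### Cutoff functions and their Hessians. -/

section Cutoff

/-- A smooth function which is `1` on `(-∞, 1/10]` and `0` on `[1/6, ∞)`. -/
def cutoffProfile (s : ℝ) : ℝ := Real.smoothTransition (5 / 2 - 15 * s)

lemma contDiff_cutoffProfile {n : ℕ∞} : ContDiff ℝ n cutoffProfile :=
  Real.smoothTransition.contDiff.comp (by fun_prop)

lemma cutoffProfile_nonneg (s : ℝ) : 0 ≤ cutoffProfile s := Real.smoothTransition.nonneg _

lemma cutoffProfile_le_one (s : ℝ) : cutoffProfile s ≤ 1 := Real.smoothTransition.le_one _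

lemma cutoffProfile_eq_one {s : ℝ} (hs : s ≤ 1 / 10) : cutoffProfile s = 1 :=
  Real.smoothTransition.one_of_one_le (by linarith)

lemma cutoffProfile_eq_zero {s : ℝ} (hs : 1 / 6 ≤ s) : cutoffProfile s = 0 :=
  Real.smoothTransition.zero_of_nonpos (by linarith)

lemma hasDerivAt_cutoffProfile (s : ℝ) : HasDerivAt cutoffProfile (deriv cutoffProfile s) s :=
  ((contDiff_cutoffProfile (n := 1)).differentiable (by simp) s).hasDerivAt

lemma contDiff_deriv_cutoffProfile : ContDiff ℝ 1 (deriv cutoffProfile) :=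
  (contDiff_succ_iff_deriv.1 (contDiff_cutoffProfile (n := 2))).2.2

lemma hasDerivAt_deriv_cutoffProfile (s : ℝ) :
    HasDerivAt (deriv cutoffProfile) (deriv (deriv cutoffProfile) s) s :=
  (contDiff_deriv_cutoffProfile.differentiable (by simp) s).hasDerivAt

lemma deriv_cutoffProfile_eq_zero {s : ℝ} (hs : 1 / 6 < s) : deriv cutoffProfile s = 0 := by
  have : cutoffProfile =ᶠ[𝓝 s] fun _ ↦ 0 := by
    filter_upwards [lt_mem_nhds hs] with x hx using cutoffProfile_eq_zero hx.le
  rw [this.deriv_eq, deriv_const]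

lemma deriv_deriv_cutoffProfile_eq_zero {s : ℝ} (hs : 1 / 6 < s) :
    deriv (deriv cutoffProfile) s = 0 := by
  have : deriv cutoffProfile =ᶠ[𝓝 s] fun _ ↦ 0 := by
    filter_upwards [lt_mem_nhds hs] with x hx using deriv_cutoffProfile_eq_zero hx
  rw [this.deriv_eq, deriv_const]

/-- A common bound of the first two derivatives of the profile, for nonnegative arguments. -/
lemma exists_bound_deriv_cutoffProfile : ∃ B : ℝ, 0 < B ∧ ∀ s, 0 ≤ s →
    |deriv cutoffProfile s| ≤ B ∧ |deriv (deriv cutoffProfile) s| ≤ B := by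
  obtain ⟨B₁, h₁⟩ := (isCompact_Icc (a := (0 : ℝ)) (b := 1)).exists_bound_of_continuousOn
    contDiff_deriv_cutoffProfile.continuous.continuousOn
  obtain ⟨B₂, h₂⟩ := (isCompact_Icc (a := (0 : ℝ)) (b := 1)).exists_bound_of_continuousOn
    (contDiff_deriv_cutoffProfile.continuous_deriv le_rfl).continuousOn
  refine ⟨max 1 (max B₁ B₂), by positivity, fun s hs ↦ ?_⟩
  rcases le_or_gt s (1 / 6) with h | h
  · have hs' : s ∈ Icc (0 : ℝ) 1 := ⟨hs, by linarith⟩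
    exact ⟨(h₁ s hs').trans (by simp), (h₂ s hs').trans (by simp)⟩
  · rw [deriv_cutoffProfile_eq_zero h, deriv_deriv_cutoffProfile_eq_zero h, abs_zero]
    exact ⟨by positivity, by positivity⟩

variable {m : ℕ} {F : Type*} [NormedAddCommGroup F] [InnerProductSpace ℝ F]

/-- The cutoff function centred at `z` whose scale is given by the linear map `ℓ`. -/
def cutoff (ℓ : ModelE m →L[ℝ] F) (z y : ModelE m) : ℝ := cutoffProfile (‖ℓ (y - z)‖ ^ 2)

lemma contDiff_cutoff (ℓ : ModelE m →L[ℝ] F) (z : ModelE m) : ContDiff ℝ ∞ (cutoff ℓ z) :=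
  (contDiff_cutoffProfile (n := ⊤)).comp
    ((ℓ.contDiff.comp (contDiff_id.sub contDiff_const)).norm_sq ℝ)

lemma hasFDerivAt_norm_sq_sub (ℓ : ModelE m →L[ℝ] F) (z y : ModelE m) :
    HasFDerivAt (fun y ↦ ‖ℓ (y - z)‖ ^ 2) (2 • (innerSL ℝ (ℓ (y - z))).comp ℓ) y :=
  ((ℓ.hasFDerivAt (x := y - z)).comp y ((hasFDerivAt_id y).sub_const z)).norm_sq

lemma pderiv_cutoff (ℓ : ModelE m →L[ℝ] F) (z : ModelE m) (i : Fin m) (y : ModelE m) :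
    pderiv i (cutoff ℓ z) y = deriv cutoffProfile (‖ℓ (y - z)‖ ^ 2) *
      (2 * inner ℝ (ℓ (y - z)) (ℓ (EuclideanSpace.single i (1 : ℝ)))) := by
  have h := (hasDerivAt_cutoffProfile (‖ℓ (y - z)‖ ^ 2)).comp_hasFDerivAt y
    (hasFDerivAt_norm_sq_sub ℓ z y)
  have h2 : fderiv ℝ (cutoff ℓ z) y = _ := h.fderiv
  rw [pderiv, h2]
  simp [-map_sub]

lemma pderiv_pderiv_cutoff (ℓ : ModelE m →L[ℝ] F) (z : ModelE m) (i j : Fin m) (y : ModelE m) :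
    pderiv i (pderiv j (cutoff ℓ z)) y =
      deriv (deriv cutoffProfile) (‖ℓ (y - z)‖ ^ 2) *
        (2 * inner ℝ (ℓ (y - z)) (ℓ (EuclideanSpace.single i (1 : ℝ)))) *
        (2 * inner ℝ (ℓ (y - z)) (ℓ (EuclideanSpace.single j (1 : ℝ)))) +
      deriv cutoffProfile (‖ℓ (y - z)‖ ^ 2) *
        (2 * inner ℝ (ℓ (EuclideanSpace.single i (1 : ℝ))) (ℓ (EuclideanSpace.single j (1 : ℝ)))) := by
  have h1 := (hasDerivAt_deriv_cutoffProfile (‖ℓ (y - z)‖ ^ 2)).comp_hasFDerivAt y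
    (hasFDerivAt_norm_sq_sub ℓ z y)
  have h2 : HasFDerivAt (fun y ↦ 2 * inner ℝ (ℓ (y - z)) (ℓ (EuclideanSpace.single j (1 : ℝ))))
      ((2 : ℝ) • (innerSL ℝ (ℓ (EuclideanSpace.single j (1 : ℝ)))).comp ℓ) y := by
    have h3 := ((innerSL ℝ (ℓ (EuclideanSpace.single j (1 : ℝ)))).comp ℓ).hasFDerivAt (x := y - z)
    have h4 := (h3.comp y ((hasFDerivAt_id y).sub_const z)).const_mul 2
    refine (h4.congr_fderiv rfl).congr_of_eventuallyEq (Eventually.of_forall fun w ↦ ?_)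
    simp [-map_sub, real_inner_comm]
  have h5 := (h1.mul h2).fderiv
  have h6 : pderiv j (cutoff ℓ z) = (deriv cutoffProfile ∘ fun y ↦ ‖ℓ (y - z)‖ ^ 2) *
      fun y ↦ 2 * inner ℝ (ℓ (y - z)) (ℓ (EuclideanSpace.single j (1 : ℝ))) := by
    ext w
    exact pderiv_cutoff ℓ z j w
  rw [pderiv, h6, h5]
  simp [-map_sub, real_inner_comm]
  ring

variable {M : Type u} [TopologicalSpace M] [ChartedSpace (ModelE 2) M]
  [RiemannianBundle (fun x : M ↦ TangentSpace (𝓡 2) x)]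

/-- The vector with components `Γᵏᵢⱼ vⁱ wʲ`. -/
def christoffelVec (x₀ : M) (y v w : ModelE 2) : ModelE 2 :=
  WithLp.toLp 2 fun k ↦ ∑ i, ∑ j, christoffel x₀ y k i j * (v i * w j)

lemma sum_hessian_cutoff (x₀ : M) (ℓ : ModelE 2 →L[ℝ] F) (z y v w : ModelE 2) :
    ∑ i, ∑ j, hessian x₀ (cutoff ℓ z) i j y * (v i * w j) =
      4 * deriv (deriv cutoffProfile) (‖ℓ (y - z)‖ ^ 2) *
        (inner ℝ (ℓ (y - z)) (ℓ v) * inner ℝ (ℓ (y - z)) (ℓ w)) +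
      2 * deriv cutoffProfile (‖ℓ (y - z)‖ ^ 2) *
        (inner ℝ (ℓ v) (ℓ w) - inner ℝ (ℓ (y - z)) (ℓ (christoffelVec x₀ y v w))) := by
  have hv : ∀ v : ModelE 2, ℓ v = v 0 • ℓ (EuclideanSpace.single 0 (1 : ℝ)) +
      v 1 • ℓ (EuclideanSpace.single 1 (1 : ℝ)) := by
    intro v
    rw [← map_smul, ← map_smul, ← map_add]
    congr 1
    ext i
    fin_cases i <;> simp
  rw [hv v, hv w, hv (christoffelVec x₀ y v w)]
  simp only [hessian, pderiv_pderiv_cutoff, pderiv_cutoff, Fin.sum_univ_two, inner_add_left,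
    inner_add_right, real_inner_smul_left, real_inner_smul_right, christoffelVec]
  ring

/-- Where the derivatives of the profile do not vanish, ‖ℓ(y − z)‖ is at most 1. The second
derivative of the profile then contributes 4B, and the first derivative 2B for the flat Hessian and
2B for the Christoffel term. -/
lemma abs_sum_hessian_cutoff_le (x₀ : M) (ℓ : ModelE 2 →L[ℝ] F) (z y v w : ModelE 2) {B : ℝ}
    (hB : 0 ≤ B) (h₁ : ∀ s, 0 ≤ s →
      |deriv cutoffProfile s| ≤ B ∧ |deriv (deriv cutoffProfile) s| ≤ B)
    (hΓ : ‖ℓ (christoffelVec x₀ y v w)‖ ≤ ‖ℓ v‖ * ‖ℓ w‖) :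
    |∑ i, ∑ j, hessian x₀ (cutoff ℓ z) i j y * (v i * w j)| ≤ 8 * B * (‖ℓ v‖ * ‖ℓ w‖) := by
  rw [sum_hessian_cutoff]
  set X := ℓ (y - z) with hX
  obtain ⟨hd, hdd⟩ := h₁ (‖X‖ ^ 2) (sq_nonneg _)
  rcases le_or_gt (‖X‖ ^ 2) (1 / 6) with h | h
  · have hX1 : ‖X‖ ≤ 1 := by nlinarith [norm_nonneg X]
    have e : ∀ Y : F, |inner ℝ X Y| ≤ ‖Y‖ := fun Y ↦ (abs_real_inner_le_norm X Y).trans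
      (mul_le_of_le_one_left (norm_nonneg _) hX1)
    have hvw : 0 ≤ ‖ℓ v‖ * ‖ℓ w‖ := by positivity
    have a1 : |inner ℝ X (ℓ v) * inner ℝ X (ℓ w)| ≤ ‖ℓ v‖ * ‖ℓ w‖ := by
      rw [abs_mul]
      exact mul_le_mul (e _) (e _) (abs_nonneg _) (norm_nonneg _)
    have a2 : |inner ℝ (ℓ v) (ℓ w) - inner ℝ X (ℓ (christoffelVec x₀ y v w))| ≤
        2 * (‖ℓ v‖ * ‖ℓ w‖) := by
      refine (abs_sub _ _).trans ?_
      linarith [abs_real_inner_le_norm (ℓ v) (ℓ w), (e (ℓ (christoffelVec x₀ y v w))).trans hΓ]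
    refine (abs_add_le _ _).trans ?_
    rw [abs_mul (4 * _), abs_mul (2 * _), abs_mul 4, abs_mul 2]
    have b1 := mul_le_mul hdd a1 (abs_nonneg _) hB
    have b2 := mul_le_mul hd a2 (abs_nonneg _) hB
    rw [abs_of_pos (by norm_num : (0 : ℝ) < 4), abs_of_pos (by norm_num : (0 : ℝ) < 2)]
    nlinarith
  · rw [deriv_cutoffProfile_eq_zero h, deriv_deriv_cutoffProfile_eq_zero h]
    simp only [mul_zero, zero_mul, add_zero, abs_zero]
    positivity

end Cutoff

/-! ### Linear maps that almost flatten the metric. -/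

section Frame

variable {M : Type u} [TopologicalSpace M] [ChartedSpace (ModelE 2) M]
  [RiemannianBundle (fun x : M ↦ TangentSpace (𝓡 2) x)]

/-- A linear map of the coordinates which approximates the metric on a set `V` of coordinates,
together with bounds for the volume density and the Christoffel symbols. -/
structure IsChartFrame (x₀ : M) (L : ModelE 2 →L[ℝ] ModelE 2) (A K : ℝ) (V : Set (ModelE 2)) :
    Prop where
  subset : V ⊆ (extChartAt (𝓡 2) x₀).target
  antilipschitz : ∀ v, ‖v‖ ≤ A * ‖L v‖
  det_ne_zero : L.det ≠ 0
  le_norm : ∀ y ∈ V, ∀ v : ModelE 2,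
    ‖L v‖ ≤ 9 / 8 * ‖mfderiv (𝓡 2) (𝓡 2) (extChartAt (𝓡 2) x₀).symm y v‖
  norm_le : ∀ y ∈ V, ∀ v : ModelE 2,
    ‖mfderiv (𝓡 2) (𝓡 2) (extChartAt (𝓡 2) x₀).symm y v‖ ≤ 9 / 8 * ‖L v‖
  volumeDensity_le : ∀ y ∈ V, volumeDensity x₀ y ≤ 2 * |L.det|
  christoffel_le : ∀ y ∈ V, ∀ v w, ‖L (christoffelVec x₀ y v w)‖ ≤ K * (‖L v‖ * ‖L w‖)

lemma norm_sq_mfderiv_extChartAt_symm (x₀ : M) (y v : ModelE 2) :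
    ‖mfderiv (𝓡 2) (𝓡 2) (extChartAt (𝓡 2) x₀).symm y v‖ ^ 2 =
      ∑ i, ∑ j, metricMatrix x₀ y i j * v i * v j := by
  rw [← inner_mfderiv_extChartAt_symm, real_inner_self_eq_norm_sq]

lemma norm_le_abs_add_abs (x : ModelE 2) : ‖x‖ ≤ |x 0| + |x 1| := by
  rw [EuclideanSpace.norm_eq, Fin.sum_univ_two]
  refine Real.sqrt_le_iff.2 ⟨by positivity, ?_⟩
  simp only [Real.norm_eq_abs]
  nlinarith [abs_nonneg (x 0), abs_nonneg (x 1)]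

/-- The map is the Cholesky factor of the metric matrix, written out explicitly. -/
lemma exists_linear_isometry_metricMatrix [IsManifold (𝓡 2) ∞ M] (x₀ : M) {y : ModelE 2}
    (hy : y ∈ (extChartAt (𝓡 2) x₀).target) : ∃ L : ModelE 2 →L[ℝ] ModelE 2,
      (∀ v, ‖L v‖ ^ 2 = ∑ i, ∑ j, metricMatrix x₀ y i j * v i * v j) ∧
        |L.det| = volumeDensity x₀ y := by
  obtain ⟨B, hB⟩ : ∃ B, metricMatrix x₀ y = Matrix.conjTranspose B * B := by
    have ha : 0 < metricMatrix x₀ y 0 0 := (metricMatrix_posDef x₀ hy).diag_pos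
    have hd := det_metricMatrix_pos x₀ hy
    have hs := Real.mul_self_sqrt ha.le
    have hs0 := (Real.sqrt_pos.2 ha).ne'
    have hc : 0 ≤ metricMatrix x₀ y 1 1 -
        metricMatrix x₀ y 0 1 * metricMatrix x₀ y 0 1 / metricMatrix x₀ y 0 0 := by
      rw [sub_nonneg, div_le_iff₀ ha]
      linarith
    have hs' := Real.mul_self_sqrt hc
    refine ⟨!![√(metricMatrix x₀ y 0 0), metricMatrix x₀ y 0 1 / √(metricMatrix x₀ y 0 0);
      0, √(metricMatrix x₀ y 1 1 -
        metricMatrix x₀ y 0 1 * metricMatrix x₀ y 0 1 / metricMatrix x₀ y 0 0)], ?_⟩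
    ext i j
    fin_cases i <;> fin_cases j <;>
      simp only [Matrix.mul_apply, Matrix.conjTranspose_apply, Fin.sum_univ_two, star_trivial,
        Matrix.of_apply, Matrix.cons_val', Matrix.cons_val_zero, Matrix.cons_val_one,
        Matrix.cons_val_fin_one, Fin.zero_eta, Fin.mk_one, Fin.isValue]
    · rw [hs]
      ring
    · field_simp
      ring
    · rw [metricMatrix_symm x₀ y 1 0]
      field_simp
      ring
    · rw [hs', div_mul_div_comm, hs]
      ring
  refine ⟨LinearMap.toContinuousLinearMap (Matrix.toEuclideanLin B), fun v ↦ ?_, ?_⟩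
  · rw [hB, EuclideanSpace.real_norm_sq_eq]
    simp only [LinearMap.coe_toContinuousLinearMap', Matrix.toLpLin_apply, Fin.sum_univ_two,
      Matrix.mul_apply, Matrix.conjTranspose_apply, Matrix.mulVec, dotProduct, star_trivial]
    ring
  · have h1 : (LinearMap.toContinuousLinearMap (Matrix.toEuclideanLin B)).det = B.det := by
      change LinearMap.det (Matrix.toEuclideanLin B) = _
      rw [Matrix.toEuclideanLin_eq_toLin_orthonormal, LinearMap.det_toLin]
    rw [h1, volumeDensity, hB, Matrix.det_mul, Matrix.det_conjTranspose, star_trivial,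
      Real.sqrt_mul_self_eq_abs]

/-- Take `L` to be an isometry for the metric at `y₀`. By continuity of the metric, its density and
the Christoffel symbols, the bounds persist near `y₀`. -/
lemma exists_isChartFrame [IsManifold (𝓡 2) ∞ M]
    [IsContMDiffRiemannianBundle (𝓡 2) ∞ (ModelE 2) (fun x : M ↦ TangentSpace (𝓡 2) x)]
    (x₀ : M) {y₀ : ModelE 2} (hy₀ : y₀ ∈ (extChartAt (𝓡 2) x₀).target) :
    ∃ (L : ModelE 2 →L[ℝ] ModelE 2) (A K δ : ℝ), 0 < A ∧ 0 < K ∧ 0 < δ ∧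
      IsChartFrame x₀ L A K (Metric.ball y₀ δ) := by
  obtain ⟨L, hL, hdet⟩ := exists_linear_isometry_metricMatrix x₀ hy₀
  have hw := volumeDensity_pos x₀ hy₀
  have hdet0 : L.det ≠ 0 := abs_pos.1 (hdet ▸ hw)
  have hker : LinearMap.ker (L : ModelE 2 →ₗ[ℝ] ModelE 2) = ⊥ :=
    LinearMap.ker_eq_bot.2 ((LinearMap.equivOfDetNeZero _ hdet0).injective)
  obtain ⟨A, hA, hAL⟩ := LinearMap.exists_antilipschitzWith (L : ModelE 2 →ₗ[ℝ] ModelE 2) hker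
  have hA0 : (0 : ℝ) < A := hA
  have hanti : ∀ v, ‖v‖ ≤ A * ‖L v‖ := fun v ↦ by
    simpa using hAL.le_mul_dist v 0
  have hD := (isOpen_extChartAt_target_model (m := 2) x₀).mem_nhds hy₀
  -- The four entries of the metric each vary by less than `θ`, and ‖v‖² ≤ A²‖Lv‖². So the squared
  -- norms differ by at most 4θA²‖Lv‖² = ‖Lv‖²/8, and both 8/7 and 9/8 are below (9/8)².
  set θ : ℝ := 1 / (32 * (A : ℝ) ^ 2) with hθ
  have hθ0 : 0 < θ := by positivity
  have hθA : 4 * θ * (A : ℝ) ^ 2 = 1 / 8 := by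
    rw [hθ]
    field_simp
    norm_num
  have e1 : ∀ᶠ y in 𝓝 y₀, ∀ i j, |metricMatrix x₀ y i j - metricMatrix x₀ y₀ i j| < θ := by
    rw [eventually_all]
    intro i
    rw [eventually_all]
    intro j
    have := ((contDiffOn_metricMatrix x₀ i j).continuousOn.continuousAt hD)
    exact Metric.continuousAt_iff'.1 this θ hθ0
  have e2 : ∀ᶠ y in 𝓝 y₀, volumeDensity x₀ y < 2 * |L.det| := by
    refine ((continuousOn_volumeDensity x₀).continuousAt hD).eventually_lt_const ?_
    rw [hdet]
    linarith
  have e3 : ∀ᶠ y in 𝓝 y₀, ∀ k i j, |christoffel x₀ y k i j| < |christoffel x₀ y₀ k i j| + 1 := by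
    rw [eventually_all]
    intro k
    rw [eventually_all]
    intro i
    rw [eventually_all]
    intro j
    exact ((continuousOn_christoffel x₀ k i j).continuousAt hD).abs.eventually_lt_const (by linarith)
  obtain ⟨δ, hδ, hball⟩ := Metric.eventually_nhds_iff_ball.1 (e1.and (e2.and (e3.and hD)))
  set S : ℝ := ∑ k, ∑ i, ∑ j, (|christoffel x₀ y₀ k i j| + 1) with hS
  have hS0 : 0 ≤ S := by positivity
  have hcoord : ∀ (v : ModelE 2) i, |v i| ≤ ‖v‖ := fun v i ↦ PiLp.norm_apply_le v i
  have hcmp : ∀ y ∈ Metric.ball y₀ δ, ∀ v : ModelE 2,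
      |‖mfderiv (𝓡 2) (𝓡 2) (extChartAt (𝓡 2) x₀).symm y v‖ ^ 2 - ‖L v‖ ^ 2| ≤
        1 / 8 * ‖L v‖ ^ 2 := by
    intro y hy v
    rw [norm_sq_mfderiv_extChartAt_symm, hL, ← Finset.sum_sub_distrib]
    simp only [← Finset.sum_sub_distrib, ← sub_mul]
    have hb : ∀ i j, |(metricMatrix x₀ y i j - metricMatrix x₀ y₀ i j) * v i * v j| ≤
        θ * ‖v‖ ^ 2 := by
      intro i j
      rw [abs_mul, abs_mul, mul_assoc, sq]
      exact mul_le_mul ((hball y hy).1 i j).le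
        (mul_le_mul (hcoord v i) (hcoord v j) (abs_nonneg _) (norm_nonneg _)) (by positivity)
        hθ0.le
    have h1 : |∑ i, ∑ j, (metricMatrix x₀ y i j - metricMatrix x₀ y₀ i j) * v i * v j| ≤
        ∑ _i : Fin 2, ∑ _j : Fin 2, θ * ‖v‖ ^ 2 :=
      (Finset.abs_sum_le_sum_abs _ _).trans (Finset.sum_le_sum fun i _ ↦
        (Finset.abs_sum_le_sum_abs _ _).trans (Finset.sum_le_sum fun j _ ↦ hb i j))
    rw [← hL]
    refine h1.trans ?_
    have h2 : ‖v‖ ^ 2 ≤ (A : ℝ) ^ 2 * ‖L v‖ ^ 2 := by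
      rw [← mul_pow]
      exact pow_le_pow_left₀ (norm_nonneg _) (hanti v) 2
    simp only [Fin.sum_univ_two]
    calc _ = 4 * θ * ‖v‖ ^ 2 := by ring
      _ ≤ 4 * θ * ((A : ℝ) ^ 2 * ‖L v‖ ^ 2) := mul_le_mul_of_nonneg_left h2 (by positivity)
      _ = _ := by rw [← mul_assoc, hθA]
  refine ⟨L, A, ‖L‖ * S * A ^ 2 + 1, δ, hA0, by positivity, hδ, ⟨fun y hy ↦ (hball y hy).2.2.2,
    hanti, hdet0, fun y hy v ↦ ?_, fun y hy v ↦ ?_, fun y hy ↦ (hball y hy).2.1.le,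
    fun y hy v w ↦ ?_⟩⟩
  · have := (abs_le.1 (hcmp y hy v)).1
    refine abs_le_of_sq_le_sq' ?_ (by positivity) |>.2
    nlinarith [sq_nonneg ‖L v‖]
  · have := (abs_le.1 (hcmp y hy v)).2
    refine abs_le_of_sq_le_sq' ?_ (by positivity) |>.2
    nlinarith [sq_nonneg ‖L v‖]
  · have h1 : ∀ k, |christoffelVec x₀ y v w k| ≤
        (∑ i, ∑ j, (|christoffel x₀ y₀ k i j| + 1)) * (‖v‖ * ‖w‖) := by
      intro k
      simp only [christoffelVec, Finset.sum_mul]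
      refine (Finset.abs_sum_le_sum_abs _ _).trans (Finset.sum_le_sum fun i _ ↦
        (Finset.abs_sum_le_sum_abs _ _).trans (Finset.sum_le_sum fun j _ ↦ ?_))
      rw [abs_mul, abs_mul]
      exact mul_le_mul ((hball y hy).2.2.1 k i j).le
        (mul_le_mul (hcoord v i) (hcoord w j) (abs_nonneg _) (norm_nonneg _)) (by positivity)
        (by positivity)
    have h2 : ‖christoffelVec x₀ y v w‖ ≤ S * (‖v‖ * ‖w‖) := by
      refine (norm_le_abs_add_abs _).trans ((add_le_add (h1 0) (h1 1)).trans (le_of_eq ?_))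
      rw [hS, Fin.sum_univ_two (f := fun k ↦ ∑ i, ∑ j, (|christoffel x₀ y₀ k i j| + 1)), add_mul]
    have h3 : ‖v‖ * ‖w‖ ≤ (A * ‖L v‖) * (A * ‖L w‖) :=
      mul_le_mul (hanti v) (hanti w) (norm_nonneg _) (by positivity)
    calc _ ≤ ‖L‖ * ‖christoffelVec x₀ y v w‖ := L.le_opNorm _
      _ ≤ ‖L‖ * (S * ((A * ‖L v‖) * (A * ‖L w‖))) := by
        gcongr
        exact h2.trans (mul_le_mul_of_nonneg_left h3 hS0)
      _ = (‖L‖ * S * A ^ 2) * (‖L v‖ * ‖L w‖) := by ring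
      _ ≤ _ := mul_le_mul_of_nonneg_right (by linarith) (by positivity)

end Frame

/-! ### Cutoff functions on a compact surface with absolute bounds. -/

section EnergyCutoff

variable {M : Type u} [EMetricSpace M] [ChartedSpace (ModelE 2) M]
  [RiemannianBundle (fun x : M ↦ TangentSpace (𝓡 2) x)]

/-- A cutoff function at scale `r` around `p`, in the coordinates of the chart at `x₀`. -/
structure IsEnergyCutoff (C : ℝ) (p : M) (r : ℝ) (x₀ : M) (φ : ModelE 2 → ℝ) : Prop where
  smooth : ContDiff ℝ ∞ φ
  nonneg : ∀ y, 0 ≤ φ y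
  le_one : ∀ y, φ y ≤ 1
  hasCompactSupport : HasCompactSupport φ
  tsupport_subset : tsupport φ ⊆ (extChartAt (𝓡 2) x₀).target
  hessian_le : ∀ y ∈ (extChartAt (𝓡 2) x₀).target, ∀ v w : ModelE 2,
    |∑ i, ∑ j, hessian x₀ φ i j y * (v i * w j)| ≤ C / r ^ 2 *
      (‖mfderiv (𝓡 2) (𝓡 2) (extChartAt (𝓡 2) x₀).symm y v‖ *
        ‖mfderiv (𝓡 2) (𝓡 2) (extChartAt (𝓡 2) x₀).symm y w‖)
  volume_le : ∫⁻ y in tsupport φ, ENNReal.ofReal (volumeDensity x₀ y) ≤ ENNReal.ofReal (C * r ^ 2)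
  eq_one : ∀ x, edist x p < ENNReal.ofReal (r / 4) →
    x ∈ (extChartAt (𝓡 2) x₀).source ∧ φ (extChartAt (𝓡 2) x₀ x) = 1
  edist_le : ∀ x ∈ (extChartAt (𝓡 2) x₀).source, φ (extChartAt (𝓡 2) x₀ x) ≠ 0 →
    edist x p ≤ ENNReal.ofReal (r / 2)

lemma tsupport_cutoff_subset {m : ℕ} {F : Type*} [NormedAddCommGroup F] [InnerProductSpace ℝ F]
    (ℓ : ModelE m →L[ℝ] F) (z : ModelE m) :
    tsupport (cutoff ℓ z) ⊆ {y | ‖ℓ (y - z)‖ ^ 2 ≤ 1 / 6} := by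
  refine closure_minimal (fun y hy ↦ ?_) (isClosed_le (by fun_prop) continuous_const)
  by_contra h
  exact hy (cutoffProfile_eq_zero (not_le.1 h).le)

/-- The thresholds 1/10 and 1/6 of the profile leave room for the distortion 9/8. On B_{r/4}(p) the
argument is at most (9/8 · 1/4)² < 1/10. On the support ‖L(y − z)‖ ≤ 5r/12, and 9/8 · 5/12 < 1/2.
The condition `K * r ≤ 1` makes the Christoffel term in the Hessian no larger than the flat one, and
8 · (9/8)² < 11. In the volume bound the determinant of `L` cancels, so the constant depends only on
the profile and on the unit disc. -/
lemma IsChartFrame.isEnergyCutoff [IsManifold (𝓡 2) ∞ M] [IsRiemannianManifold (𝓡 2) M]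
    {x₀ p : M} {L : ModelE 2 →L[ℝ] ModelE 2}
    {A K : ℝ} {V : Set (ModelE 2)} (hL : IsChartFrame x₀ L A K V) (hV : Convex ℝ V)
    {B : ℝ} (hB : 0 ≤ B) (hBη : ∀ s, 0 ≤ s →
      |deriv cutoffProfile s| ≤ B ∧ |deriv (deriv cutoffProfile) s| ≤ B)
    (hp : p ∈ (extChartAt (𝓡 2) x₀).source) {r : ℝ} (hr : 0 < r) (hKr : K * r ≤ 1)
    (hpV : ∀ y, ‖y - extChartAt (𝓡 2) x₀ p‖ ≤ A * r → y ∈ V)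
    (hball : ∀ x, edist p x < ENNReal.ofReal (r / 4) →
      x ∈ (extChartAt (𝓡 2) x₀).source ∧ extChartAt (𝓡 2) x₀ x ∈ V) :
    IsEnergyCutoff (11 * B + 2 * (volume (Metric.closedBall (0 : ModelE 2) 1)).toReal) p r x₀
      (cutoff (r⁻¹ • L) (extChartAt (𝓡 2) x₀ p)) := by
  set z := extChartAt (𝓡 2) x₀ p with hz
  set Vol := (volume (Metric.closedBall (0 : ModelE 2) 1)).toReal with hVol
  have hVol0 : 0 ≤ Vol := ENNReal.toReal_nonneg
  have hnorm : ∀ v, ‖(r⁻¹ • L) v‖ = r⁻¹ * ‖L v‖ := fun v ↦ by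
    rw [_root_.smul_apply, norm_smul, Real.norm_of_nonneg (inv_nonneg.2 hr.le)]
  have hA : 0 ≤ A := by
    have h1 := hL.antilipschitz (EuclideanSpace.single 0 (1 : ℝ))
    rw [EuclideanSpace.single, PiLp.norm_single, norm_one] at h1
    by_contra! h
    nlinarith [norm_nonneg (L (EuclideanSpace.single 0 (1 : ℝ)))]
  have hsub : ∀ {y}, ‖(r⁻¹ • L) (y - z)‖ ^ 2 ≤ 1 / 6 → ‖L (y - z)‖ ≤ r * (5 / 12) := by
    intro y hy
    rw [hnorm] at hy
    have h1 : r⁻¹ * ‖L (y - z)‖ ≤ 5 / 12 :=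
      abs_le_of_sq_le_sq' (by linarith) (by norm_num) |>.2
    rwa [inv_mul_le_iff₀ hr] at h1
  have hsubV : ∀ {y}, ‖L (y - z)‖ ≤ r * (5 / 12) → y ∈ V := fun {y} hy ↦
    hpV y ((hL.antilipschitz _).trans (mul_le_mul_of_nonneg_left (by linarith) hA))
  have hzV : z ∈ V := hpV z (by simpa using mul_nonneg hA hr.le)
  have hts := tsupport_cutoff_subset (r⁻¹ • L) z
  refine ⟨contDiff_cutoff _ _, fun _ ↦ cutoffProfile_nonneg _, fun _ ↦ cutoffProfile_le_one _,
    ?_, fun y hy ↦ hL.subset (hsubV (hsub (hts hy))), fun y hy v w ↦ ?_, ?_, fun x hx ↦ ?_,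
    fun x hx hφ ↦ ?_⟩
  · refine HasCompactSupport.of_support_subset_isCompact
      (isCompact_closedBall z (A * r)) fun y hy ↦ ?_
    have h1 := hsub (hts (subset_tsupport _ hy))
    rw [Metric.mem_closedBall, dist_eq_norm]
    exact (hL.antilipschitz _).trans (mul_le_mul_of_nonneg_left (by linarith) hA)
  · by_cases hyt : y ∈ tsupport (cutoff (r⁻¹ • L) z)
    · have hyV := hsubV (hsub (hts hyt))
      refine (abs_sum_hessian_cutoff_le x₀ (r⁻¹ • L) z y v w hB hBη ?_).trans ?_
      · rw [hnorm, hnorm, hnorm]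
        calc _ ≤ r⁻¹ * (K * (‖L v‖ * ‖L w‖)) :=
              mul_le_mul_of_nonneg_left (hL.christoffel_le y hyV v w) (inv_nonneg.2 hr.le)
          _ = (K * r) * ((r⁻¹ * ‖L v‖) * (r⁻¹ * ‖L w‖)) := by field_simp
          _ ≤ _ := mul_le_of_le_one_left (by positivity) hKr
      · rw [hnorm, hnorm]
        have h1 := mul_le_mul (hL.le_norm y hyV v) (hL.le_norm y hyV w) (norm_nonneg _)
          (by positivity)
        have hN := mul_nonneg (norm_nonneg (mfderiv (𝓡 2) (𝓡 2) (extChartAt (𝓡 2) x₀).symm y v))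
          (norm_nonneg (mfderiv (𝓡 2) (𝓡 2) (extChartAt (𝓡 2) x₀).symm y w))
        set N := ‖mfderiv (𝓡 2) (𝓡 2) (extChartAt (𝓡 2) x₀).symm y v‖ *
          ‖mfderiv (𝓡 2) (𝓡 2) (extChartAt (𝓡 2) x₀).symm y w‖
        calc _ = 8 * B / r ^ 2 * (‖L v‖ * ‖L w‖) := by field_simp
          _ ≤ 8 * B / r ^ 2 * (81 / 64 * N) :=
              mul_le_mul_of_nonneg_left (by linarith) (by positivity)
          _ = (81 / 8 * B) / r ^ 2 * N := by ring
          _ ≤ _ := by gcongr; linarith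
    · simp only [hessian_eq_zero x₀ _ _ hyt, zero_mul, Finset.sum_const_zero, abs_zero]
      positivity
  · have hsubs : tsupport (cutoff (r⁻¹ • L) z) ⊆
        (fun y ↦ y - z) ⁻¹' (L ⁻¹' Metric.closedBall (0 : ModelE 2) r) := fun y hy ↦ by
      rw [mem_preimage, mem_preimage, mem_closedBall_zero_iff]
      linarith [hsub (hts hy)]
    have hvol : volume ((fun y ↦ y - z) ⁻¹' (L ⁻¹' Metric.closedBall (0 : ModelE 2) r)) =
        ENNReal.ofReal (|L.det|⁻¹ * (r ^ 2 * Vol)) := by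
      simp only [sub_eq_add_neg]
      rw [measure_preimage_add_right, Measure.addHaar_preimage_continuousLinearMap _ hL.det_ne_zero,
        Measure.addHaar_closedBall' _ _ hr.le, finrank_euclideanSpace_fin, abs_inv,
        ENNReal.ofReal_mul (by positivity), ENNReal.ofReal_mul (by positivity), hVol,
        ENNReal.ofReal_toReal measure_closedBall_lt_top.ne]
    have hdet := abs_pos.2 hL.det_ne_zero
    calc _ ≤ ∫⁻ _ in tsupport (cutoff (r⁻¹ • L) z), ENNReal.ofReal (2 * |L.det|) :=
          setLIntegral_mono' (isClosed_tsupport _).measurableSet fun y hy ↦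
            ENNReal.ofReal_le_ofReal (hL.volumeDensity_le y (hsubV (hsub (hts hy))))
      _ = ENNReal.ofReal (2 * |L.det|) * volume (tsupport (cutoff (r⁻¹ • L) z)) :=
          setLIntegral_const _ _
      _ ≤ ENNReal.ofReal (2 * |L.det|) * ENNReal.ofReal (|L.det|⁻¹ * (r ^ 2 * Vol)) := by
          gcongr
          exact (measure_mono hsubs).trans hvol.le
      _ = ENNReal.ofReal (2 * Vol * r ^ 2) := by
          rw [← ENNReal.ofReal_mul (by positivity)]
          congr 1
          field_simp
      _ ≤ _ := by
          apply ENNReal.ofReal_le_ofReal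
          gcongr
          linarith
  · rw [edist_comm] at hx
    refine ⟨(hball x hx).1, cutoffProfile_eq_one ?_⟩
    have h1 := norm_sub_extChartAt_le x₀ L (by norm_num) hL.le_norm (by positivity) hball hx
    rw [hnorm]
    have h2 : r⁻¹ * ‖L (extChartAt (𝓡 2) x₀ x - z)‖ ≤ 9 / 32 := by
      rw [inv_mul_le_iff₀ hr]
      linarith
    have h3 : 0 ≤ r⁻¹ * ‖L (extChartAt (𝓡 2) x₀ x - z)‖ := by positivity
    nlinarith
  · have h1 : ‖(r⁻¹ • L) (extChartAt (𝓡 2) x₀ x - z)‖ ^ 2 ≤ 1 / 6 := by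
      by_contra h
      exact hφ (cutoffProfile_eq_zero (not_le.1 h).le)
    have h2 := hsub h1
    have h3 := edist_extChartAt_symm_le x₀ hV hL.subset L hL.norm_le hzV (hsubV h2)
    rw [hz, (extChartAt (𝓡 2) x₀).left_inv hp, (extChartAt (𝓡 2) x₀).left_inv hx,
      edist_comm] at h3
    exact h3.trans (ENNReal.ofReal_le_ofReal (by linarith))

/-- On a compact surface, there are cutoff functions around all points and at all small scales,
with bounds by an absolute constant. -/
lemma exists_isEnergyCutoff : ∃ C : ℝ, 0 < C ∧
    ∀ (M : Type u) [EMetricSpace M] [CompactSpace M] [ChartedSpace (ModelE 2) M]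
      [IsManifold (𝓡 2) ∞ M] [RiemannianBundle (fun x : M ↦ TangentSpace (𝓡 2) x)]
      [IsContMDiffRiemannianBundle (𝓡 2) ∞ (ModelE 2) (fun x : M ↦ TangentSpace (𝓡 2) x)]
      [IsRiemannianManifold (𝓡 2) M],
    ∃ R₀ : ℝ, 0 < R₀ ∧ ∀ (p : M) (r : ℝ), 0 < r → r < R₀ →
      ∃ (x₀ : M) (φ : ModelE 2 → ℝ), IsEnergyCutoff C p r x₀ φ := by
  obtain ⟨B, hB, hBη⟩ := exists_bound_deriv_cutoffProfile
  refine ⟨11 * B + 2 * (volume (Metric.closedBall (0 : ModelE 2) 1)).toReal, by positivity, ?_⟩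
  intro M _ _ _ _ _ _ _
  have hloc : ∀ x₀ : M, ∃ U ∈ 𝓝 x₀, ∃ R : ℝ, 0 < R ∧ ∀ p ∈ U, ∀ r : ℝ, 0 < r → r < R →
      ∃ φ, IsEnergyCutoff (11 * B + 2 * (volume (Metric.closedBall (0 : ModelE 2) 1)).toReal)
        p r x₀ φ := by
    intro x₀
    obtain ⟨L, A, K, δ, hA, hK, hδ, hL⟩ := exists_isChartFrame x₀ (mem_extChartAt_target x₀)
    have hsrc := extChartAt_source_mem_nhds (I := 𝓡 2) x₀
    have hV := (continuousAt_extChartAt (I := 𝓡 2) x₀).preimage_mem_nhds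
      (Metric.ball_mem_nhds _ hδ)
    have hV2 := (continuousAt_extChartAt (I := 𝓡 2) x₀).preimage_mem_nhds
      (Metric.ball_mem_nhds _ (half_pos hδ))
    obtain ⟨s, hs, hsub⟩ := EMetric.mem_nhds_iff.1 (inter_mem hsrc hV)
    -- The radius `s` may be infinite, so a finite `s'` below `s / 2` is used to bound `r`.
    obtain ⟨s', hs', hs's⟩ := ENNReal.lt_iff_exists_nnreal_btwn.1 (ENNReal.half_pos hs.ne')
    have hs'0 : (0 : ℝ) < s' := by exact_mod_cast hs'
    refine ⟨Metric.eball x₀ (s / 2) ∩ ((extChartAt (𝓡 2) x₀).source ∩ _),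
      inter_mem (Metric.eball_mem_nhds _ (ENNReal.half_pos hs.ne')) (inter_mem hsrc hV2),
      -- The three bounds on `r` give `K * r ≤ 1`, keep the support within δ/2 of the coordinates of
      -- `p`, and keep B_{r/4}(p) inside the ball of radius `s` around `x₀`.
      min (1 / K) (min (δ / (2 * A)) (4 * s')), by positivity, fun p hp r hr hrR ↦ ?_⟩
    obtain ⟨h1, h2, h3⟩ : r < 1 / K ∧ r < δ / (2 * A) ∧ r < 4 * s' := by
      simpa only [lt_min_iff] using hrR
    refine ⟨_, hL.isEnergyCutoff (convex_ball _ _) hB.le hBη hp.2.1 hr ?_ (fun y hy ↦ ?_)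
      fun x hx ↦ hsub ?_⟩
    · rw [lt_div_iff₀ hK] at h1
      linarith
    · have h4 := hp.2.2
      rw [mem_preimage, Metric.mem_ball] at h4
      rw [lt_div_iff₀ (by positivity)] at h2
      rw [Metric.mem_ball]
      rw [← dist_eq_norm] at hy
      linarith [dist_triangle y (extChartAt (𝓡 2) x₀ p) (extChartAt (𝓡 2) x₀ x₀)]
    · have h5 : ENNReal.ofReal (r / 4) ≤ s / 2 := by
        refine le_trans ?_ hs's.le
        rw [← ENNReal.ofReal_coe_nnreal]
        exact ENNReal.ofReal_le_ofReal (by linarith)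
      rw [Metric.mem_eball]
      calc edist x x₀ ≤ edist x p + edist p x₀ := edist_triangle _ _ _
        _ < s / 2 + s / 2 := by
          rw [edist_comm x p]
          exact ENNReal.add_lt_add (hx.trans_le h5) hp.1
        _ = s := ENNReal.add_halves s
  choose U hU R hR hφ using hloc
  obtain ⟨t, ht⟩ := CompactSpace.elim_nhds_subcover U hU
  have hpos : ∃ R₀ : ℝ, 0 < R₀ ∧ ∀ x ∈ t, R₀ ≤ R x := by
    clear ht
    classical
    induction t using Finset.induction_on with
    | empty => exact ⟨1, one_pos, by simp⟩
    | insert a t _ ih =>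
      obtain ⟨R₁, h1, h2⟩ := ih
      refine ⟨min R₁ (R a), lt_min h1 (hR a), fun x hx ↦ ?_⟩
      rcases Finset.mem_insert.1 hx with rfl | hx
      · exact min_le_right _ _
      · exact (min_le_left _ _).trans (h2 x hx)
  obtain ⟨R₀, hR₀, hle⟩ := hpos
  refine ⟨R₀, hR₀, fun p r hr hrR ↦ ?_⟩
  have hp : p ∈ ⋃ x ∈ t, U x := ht ▸ mem_univ p
  obtain ⟨x₀, hx₀, hpU⟩ := mem_iUnion₂.1 hp
  obtain ⟨φ, h⟩ := hφ x₀ p hpU r hr (hrR.trans_le (hle x₀ hx₀))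
  exact ⟨x₀, φ, h⟩

end EnergyCutoff

/-! ### Almost monotonicity of the weighted energy. -/

section LocalEnergyEstimate

variable {n : ℕ} {M : Type u} [EMetricSpace M] [ChartedSpace (ModelE 2) M]
  [IsManifold (𝓡 2) ∞ M] [RiemannianBundle (fun x : M ↦ TangentSpace (𝓡 2) x)]
  {N : Type v} [TopologicalSpace N] [ChartedSpace (ModelE n) N] [IsManifold (𝓡 n) ∞ N]
  [RiemannianBundle (fun y : N ↦ TangentSpace (𝓡 n) y)]
  {u : ℝ → M → N} {T : EReal} {φ : ModelE 2 → ℝ}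

lemma IsHarmonicMapFlow.localEnergy_nonneg (hu : IsHarmonicMapFlow 2 n u T) (x₀ : M) {t : ℝ}
    (ht : t ∈ timeInterval T) {y : ModelE 2} (hy : y ∈ (extChartAt (𝓡 2) x₀).target) :
    0 ≤ localEnergy n u x₀ T t y := by
  rw [← hu.energyDensity_eq_localEnergy x₀ ht hy, energyDensity, normSqDu]
  positivity

variable [IsContMDiffRiemannianBundle (𝓡 2) ∞ (ModelE 2) (fun x : M ↦ TangentSpace (𝓡 2) x)]
  [MeasurableSpace M] [BorelSpace M]
  [IsContMDiffRiemannianBundle (𝓡 n) ∞ (ModelE n) (fun y : N ↦ TangentSpace (𝓡 n) y)]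

/-- The energy weighted by a test function supported in a chart, computed in the chart. -/
lemma IsHarmonicMapFlow.lintegral_indicator_mul_energyDensity (hu : IsHarmonicMapFlow 2 n u T)
    (x₀ : M) (hφ : ContDiff ℝ ∞ φ) (hφ0 : ∀ y, 0 ≤ φ y) (hc : HasCompactSupport φ)
    (hsupp : tsupport φ ⊆ (extChartAt (𝓡 2) x₀).target) {t : ℝ} (ht : t ∈ timeInterval T) :
    0 ≤ ∫ y, φ y * localEnergy n u x₀ T t y * volumeDensity x₀ y ∧
    ∫⁻ x, ENNReal.ofReal ((extChartAt (𝓡 2) x₀).source.indicator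
        (fun x ↦ φ (extChartAt (𝓡 2) x₀ x)) x * energyDensity 2 n (u t) x)
          ∂(riemannianVolume 2 M) =
      ENNReal.ofReal (∫ y, φ y * localEnergy n u x₀ T t y * volumeDensity x₀ y) := by
  have hD := isOpen_extChartAt_target_model (m := 2) x₀
  have hcE := hu.continuousOn_localEnergy_slice x₀ ht
  have hcw := continuousOn_volumeDensity x₀
  have h0 : ∀ y ∉ tsupport φ, φ y * localEnergy n u x₀ T t y * volumeDensity x₀ y = 0 := by
    intro y hy
    rw [image_eq_zero_of_notMem_tsupport hy, zero_mul, zero_mul]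
  have hcont : Continuous fun y ↦ φ y * localEnergy n u x₀ T t y * volumeDensity x₀ y :=
    continuous_of_eq_zero_of_notMem hD (isClosed_tsupport φ) hsupp
      ((hφ.continuous.continuousOn.mul hcE).mul hcw) h0
  have hint := hcont.integrable_of_hasCompactSupport (μ := volume)
    (HasCompactSupport.intro (K := tsupport φ) hc h0)
  have hnn : ∀ y, 0 ≤ φ y * localEnergy n u x₀ T t y * volumeDensity x₀ y := by
    intro y
    by_cases hy : y ∈ (extChartAt (𝓡 2) x₀).target
    · exact mul_nonneg (mul_nonneg (hφ0 y) (hu.localEnergy_nonneg x₀ ht hy))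
        (volumeDensity_pos x₀ hy).le
    · rw [h0 y fun h ↦ hy (hsupp h)]
  refine ⟨integral_nonneg hnn, ?_⟩
  set f : ModelE 2 → ℝ≥0∞ := fun y ↦ ENNReal.ofReal (φ y * localEnergy n u x₀ T t y) with hf
  have hfc : ContinuousOn f (extChartAt (𝓡 2) x₀).target :=
    ENNReal.continuous_ofReal.comp_continuousOn (hφ.continuous.continuousOn.mul hcE)
  have h1 : (fun x ↦ ENNReal.ofReal ((extChartAt (𝓡 2) x₀).source.indicator
        (fun x ↦ φ (extChartAt (𝓡 2) x₀ x)) x * energyDensity 2 n (u t) x)) =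
      fun x ↦ (extChartAt (𝓡 2) x₀).source.indicator (fun x ↦ f (extChartAt (𝓡 2) x₀ x)) x := by
    ext x
    by_cases hx : x ∈ (extChartAt (𝓡 2) x₀).source
    · rw [indicator_of_mem hx, indicator_of_mem hx, hf]
      dsimp only
      rw [← hu.energyDensity_eq_localEnergy x₀ ht ((extChartAt (𝓡 2) x₀).map_source hx),
        (extChartAt (𝓡 2) x₀).left_inv hx]
    · rw [indicator_of_notMem hx, indicator_of_notMem hx, zero_mul, ENNReal.ofReal_zero]
  rw [h1, lintegral_riemannianVolume_indicator x₀ hfc,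
    ofReal_integral_eq_lintegral_ofReal hint (Eventually.of_forall hnn)]
  refine Eq.trans ?_ (setLIntegral_eq_of_support_subset (s := (extChartAt (𝓡 2) x₀).target) ?_)
  · refine setLIntegral_congr_fun hD.measurableSet fun y hy ↦ ?_
    rw [ENNReal.ofReal_mul (mul_nonneg (hφ0 y) (hu.localEnergy_nonneg x₀ ht hy)), mul_comm]
  · intro y hy
    by_contra h
    refine hy ?_
    dsimp only
    rw [h0 y fun h' ↦ h (hsupp h'), ENNReal.ofReal_zero]

/-- The pairing of the Hessian of a cutoff function with the stress-energy tensor is bounded by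
Hölder's inequality. -/
lemma IsHarmonicMapFlow.integral_hessianStress_le (hu : IsHarmonicMapFlow 2 n u T)
    {C : ℝ} (hC : 0 < C) {p x₀ : M} {r : ℝ} (hr : 0 < r) (hφ : IsEnergyCutoff C p r x₀ φ)
    {t : ℝ} (ht : t ∈ timeInterval T) {q σ : ℝ} (hq : 1 ≤ q) (hσ : 0 ≤ σ)
    (hS : stressLq 2 n (u t) q ≤ ENNReal.ofReal σ) :
    ∫ y, volumeDensity x₀ y * hessianStress n u x₀ T φ t y ≤
      2 * C * (C + 1) * σ / r ^ (2 / q) := by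
  set D := (extChartAt (𝓡 2) x₀).target with hDdef
  set O := (extChartAt (𝓡 2) x₀).source with hOdef
  have hD : IsOpen D := isOpen_extChartAt_target_model (m := 2) x₀
  have hO : IsOpen O := isOpen_extChartAt_source (I := 𝓡 2) x₀
  set k := hessianStress n u x₀ T φ t with hk
  have hkc : ContinuousOn k D := hu.continuousOn_hessianStress x₀ hφ.smooth ht
  have hk0 : ∀ y ∉ tsupport φ, k y = 0 := fun y hy ↦ hessianStress_eq_zero u x₀ T t hy
  set κ : M → ℝ := O.indicator (fun x ↦ k (extChartAt (𝓡 2) x₀ x)) with hκ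
  have hκm : Measurable κ := measurable_indicator_extChartAt x₀ hkc
  set ν := chartVolume (m := 2) x₀ with hν
  set K : Set M := O ∩ extChartAt (𝓡 2) x₀ ⁻¹' tsupport φ with hKdef
  have hKm : MeasurableSet K := by
    have h1 : K = O \ (O ∩ extChartAt (𝓡 2) x₀ ⁻¹' (tsupport φ)ᶜ) := by
      rw [sdiff_self_inter, preimage_compl, sdiff_compl]
    rw [h1]
    exact hO.measurableSet.diff ((continuousOn_extChartAt (I := 𝓡 2) x₀).isOpen_inter_preimage hO
      (isClosed_tsupport φ).isOpen_compl).measurableSet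
  have hκK : Function.support κ ⊆ K := by
    intro x hx
    have hxO : x ∈ O := by
      by_contra h
      exact hx (indicator_of_notMem h _)
    refine ⟨hxO, ?_⟩
    by_contra h
    refine hx ?_
    rw [hκ, indicator_of_mem hxO, hk0 _ h]
  have hνK : ν K ≤ ENNReal.ofReal (C * r ^ 2) := by
    rw [hν, chartVolume_apply x₀ hKm]
    refine (lintegral_mono_set fun y hy ↦ ?_).trans hφ.volume_le
    have h1 := hy.2.2
    rwa [mem_preimage, (extChartAt (𝓡 2) x₀).right_inv hy.1] at h1
  have hq0 : 0 < q := by linarith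
  have hqt : (ENNReal.ofReal q).toReal = q := ENNReal.toReal_ofReal hq0.le
  -- Hölder is applied to `κ`, which is continuous in the chart. The norm of the stress-energy
  -- tensor enters only through this pointwise bound, so its measurability plays no role.
  have hkey : ∀ x, ‖κ x‖ ≤ 2 * (C / r ^ 2) * ‖stressNorm 2 n (u t) x‖ := by
    intro x
    by_cases hx : x ∈ O
    · rw [hκ, indicator_of_mem hx, Real.norm_eq_abs]
      have hy := (extChartAt (𝓡 2) x₀).map_source hx
      have h1 := hu.abs_hessianStress_le x₀ hφ.smooth ht hy (by positivity)
        (hφ.hessian_le _ hy)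
      rw [(extChartAt (𝓡 2) x₀).left_inv hx] at h1
      exact h1.trans (mul_le_mul_of_nonneg_left (le_abs_self _) (by positivity))
    · rw [hκ, indicator_of_notMem hx, norm_zero]
      positivity
  have e1 : eLpNorm κ (ENNReal.ofReal q) ν ≤
      ENNReal.ofReal (2 * (C / r ^ 2)) * ENNReal.ofReal σ := by
    refine (eLpNorm_mono_measure κ (chartVolume_le_riemannianVolume x₀)).trans ?_
    refine (eLpNorm_le_mul_eLpNorm_of_ae_le_mul (Eventually.of_forall hkey) _).trans ?_
    gcongr
    exact hS
  have e2 : ∫⁻ x, ‖κ x‖ₑ ∂ν ≤ ENNReal.ofReal (2 * (C / r ^ 2)) * ENNReal.ofReal σ *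
      ENNReal.ofReal (C * r ^ 2) ^ (1 - 1 / q) := by
    rw [← eLpNorm_one_eq_lintegral_enorm, ← eLpNorm_restrict_eq_of_support_subset hκK]
    refine (eLpNorm_le_eLpNorm_mul_rpow_measure_univ (q := ENNReal.ofReal q)
      (by rw [← ENNReal.ofReal_one]; exact ENNReal.ofReal_le_ofReal hq)
      hκm.aestronglyMeasurable).trans ?_
    rw [eLpNorm_restrict_eq_of_support_subset hκK, hqt, ENNReal.toReal_one,
      Measure.restrict_apply_univ, div_one]
    have hexp : 0 ≤ 1 - 1 / q := by
      rw [sub_nonneg, div_le_one hq0]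
      exact hq
    gcongr
  have e3 : ENNReal.ofReal (∫ y, volumeDensity x₀ y * k y) ≤ ∫⁻ x, ‖κ x‖ₑ ∂ν := by
    have h1 : (fun x ↦ ‖κ x‖ₑ) =
        fun x ↦ O.indicator (fun x ↦ (fun y ↦ ‖k y‖ₑ) (extChartAt (𝓡 2) x₀ x)) x := by
      ext x
      by_cases hx : x ∈ O
      · rw [hκ, indicator_of_mem hx, indicator_of_mem hx]
      · rw [hκ, indicator_of_notMem hx, indicator_of_notMem hx, enorm_zero]
    rw [h1, hν, lintegral_chartVolume_indicator x₀ hkc.enorm]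
    refine (Real.ofReal_le_enorm _).trans ((enorm_integral_le_lintegral_enorm _).trans (le_of_eq ?_))
    rw [← setLIntegral_eq_of_support_subset (s := D)]
    · refine setLIntegral_congr_fun hD.measurableSet fun y hy ↦ ?_
      rw [enorm_mul, Real.enorm_eq_ofReal (volumeDensity_pos x₀ hy).le]
    · intro y hy
      by_contra h
      refine hy ?_
      dsimp only
      rw [hk0 y fun h' ↦ h (hφ.tsupport_subset h'), mul_zero, enorm_zero]
  have hexp : 0 ≤ 1 - 1 / q := by
    rw [sub_nonneg, div_le_one hq0]
    exact hq
  have e4 := e3.trans e2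
  rw [ENNReal.ofReal_rpow_of_nonneg (by positivity) hexp, ← ENNReal.ofReal_mul (by positivity),
    ← ENNReal.ofReal_mul (by positivity), ENNReal.ofReal_le_ofReal_iff (by positivity)] at e4
  refine e4.trans ?_
  have h1 : (C * r ^ 2) ^ (1 - 1 / q) = C ^ (1 - 1 / q) * (r ^ 2 / r ^ (2 / q)) := by
    have h2 : (r ^ 2) ^ (1 / q) = r ^ (2 / q) := by
      rw [← Real.rpow_natCast, ← Real.rpow_mul hr.le]
      congr 1
      push_cast
      ring
    rw [Real.mul_rpow hC.le (sq_nonneg r), Real.rpow_sub (x := r ^ 2) (by positivity),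
      Real.rpow_one, h2]
  -- This makes the constant independent of `q`.
  have h2 : C ^ (1 - 1 / q) ≤ C + 1 := by
    calc C ^ (1 - 1 / q) ≤ (C + 1) ^ (1 - 1 / q) :=
          Real.rpow_le_rpow hC.le (by linarith) hexp
      _ ≤ (C + 1) ^ (1 : ℝ) := Real.rpow_le_rpow_of_exponent_le (by linarith)
          (by have : 0 < 1 / q := by positivity
              linarith)
      _ = C + 1 := Real.rpow_one _
  have hrq : 0 < r ^ (2 / q) := Real.rpow_pos_of_pos hr _
  rw [h1]
  calc _ = 2 * C * C ^ (1 - 1 / q) * σ / r ^ (2 / q) := by field_simp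
    _ ≤ _ := by gcongr

/-- Almost monotonicity of the energy weighted by a cutoff function. -/
lemma IsHarmonicMapFlow.integral_localEnergy_le (hu : IsHarmonicMapFlow 2 n u T)
    {C : ℝ} (hC : 0 < C) {p x₀ : M} {r : ℝ} (hr : 0 < r) (hφ : IsEnergyCutoff C p r x₀ φ)
    {q σ τ : ℝ} (hq : 1 ≤ q) (hσ : 0 ≤ σ) (hτ : 0 ≤ τ)
    (hS : ∀ t : ℝ, τ ≤ t → (t : EReal) < T → stressLq 2 n (u t) q ≤ ENNReal.ofReal σ)
    {t t' : ℝ} (ht : τ ≤ t) (htt' : t ≤ t') (ht' : (t' : EReal) < T) :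
    ∫ y, φ y * localEnergy n u x₀ T t' y * volumeDensity x₀ y ≤
      (∫ y, φ y * localEnergy n u x₀ T t y * volumeDensity x₀ y) +
        2 * C * (C + 1) * σ / r ^ (2 / q) * (t' - t) := by
  set F : ℝ → ℝ := fun t ↦ ∫ y, φ y * localEnergy n u x₀ T t y * volumeDensity x₀ y with hF
  set K := 2 * C * (C + 1) * σ / r ^ (2 / q) with hK
  have hlt : ∀ s ∈ Icc t t', (s : EReal) < T := fun s hs ↦
    (EReal.coe_le_coe_iff.2 hs.2).trans_lt ht'
  have hsub : Icc t t' ⊆ timeInterval T := fun s hs ↦ ⟨by linarith [hs.1], hlt s hs⟩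
  have hcont : ContinuousOn (fun s ↦ F s - K * s) (Icc t t') :=
    ((hu.continuousOn_integral_localEnergy x₀ hφ.smooth hφ.hasCompactSupport
      hφ.tsupport_subset).mono hsub).sub (by fun_prop)
  -- Interior times are positive even if `t = 0`. Together with continuity on the closed interval
  -- this suffices for monotonicity.
  have hder : ∀ s ∈ interior (Icc t t'), ∃ F', HasDerivAt (fun s ↦ F s - K * s) F' s ∧ F' ≤ 0 := by
    intro s hs
    rw [interior_Icc] at hs
    have hs' := Ioo_subset_Icc_self hs
    obtain ⟨F', h1, h2⟩ := hu.exists_hasDerivAt_integral_localEnergy x₀ hφ.smooth hφ.nonneg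
      hφ.hasCompactSupport hφ.tsupport_subset (by linarith [hs.1] : 0 < s) (hlt s hs')
    have h3 := h2.trans (hu.integral_hessianStress_le hC hr hφ (hsub hs') hq hσ
      (hS s (ht.trans hs'.1) (hlt s hs')))
    refine ⟨F' - K * 1, h1.sub ((hasDerivAt_id s).const_mul K), by linarith⟩
  have hanti := antitoneOn_of_deriv_nonpos (convex_Icc t t') hcont
    (fun s hs ↦ (hder s hs).choose_spec.1.differentiableAt.differentiableWithinAt)
    (fun s hs ↦ by
      obtain ⟨F', h1, h2⟩ := hder s hs
      rw [h1.deriv]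
      exact h2)
  have := hanti (left_mem_Icc.2 htt') (right_mem_Icc.2 htt') htt'
  simp only at this
  linarith

end LocalEnergyEstimate

/-! ### Ball weights, free of charts. -/

/-- A weight which is `1` on the ball of radius `r / 4` and vanishes outside the closed ball of
radius `r / 2`. -/
structure IsBallWeight {M : Type u} [EMetricSpace M] (p : M) (r : ℝ) (χ : M → ℝ) : Prop where
  le_one : ∀ x, χ x ≤ 1
  eq_one : ∀ x, edist x p < ENNReal.ofReal (r / 4) → χ x = 1
  edist_le : ∀ x, χ x ≠ 0 → edist x p ≤ ENNReal.ofReal (r / 2)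

lemma IsEnergyCutoff.isBallWeight {M : Type u} [EMetricSpace M] [ChartedSpace (ModelE 2) M]
    [RiemannianBundle (fun x : M ↦ TangentSpace (𝓡 2) x)] {C : ℝ} {p : M} {r : ℝ} {x₀ : M}
    {φ : ModelE 2 → ℝ} (h : IsEnergyCutoff C p r x₀ φ) :
    IsBallWeight p r ((extChartAt (𝓡 2) x₀).source.indicator
      fun x ↦ φ (extChartAt (𝓡 2) x₀ x)) where
  le_one x := indicator_le_self' (fun _ _ ↦ h.nonneg _) x |>.trans (h.le_one _)
  eq_one x hx := by rw [indicator_of_mem (h.eq_one x hx).1, (h.eq_one x hx).2]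
  edist_le x hx := by
    have hs : x ∈ (extChartAt (𝓡 2) x₀).source := by
      by_contra h'
      exact hx (indicator_of_notMem h' _)
    rw [indicator_of_mem hs] at hx
    exact h.edist_le x hs hx

/-- Almost monotonicity of the local energy of harmonic map flows: the weighted energy increases at
most at the rate `C σ r^{-2/q}`. -/
lemma exists_isBallWeight : ∃ C : ℝ, 0 < C ∧
    ∀ (M : Type u) [EMetricSpace M] [CompactSpace M] [ChartedSpace (ModelE 2) M]
      [IsManifold (𝓡 2) ∞ M] [MeasurableSpace M] [BorelSpace M]
      [RiemannianBundle (fun x : M ↦ TangentSpace (𝓡 2) x)]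
      [IsContMDiffRiemannianBundle (𝓡 2) ∞ (ModelE 2) (fun x : M ↦ TangentSpace (𝓡 2) x)]
      [IsRiemannianManifold (𝓡 2) M],
    ∃ R₀ : ℝ, 0 < R₀ ∧ ∀ (p : M) (r : ℝ), 0 < r → r < R₀ →
      ∃ χ : M → ℝ, IsBallWeight p r χ ∧
      ∀ (n : ℕ) (N : Type v) [TopologicalSpace N] [ChartedSpace (ModelE n) N]
        [IsManifold (𝓡 n) ∞ N] [RiemannianBundle (fun y : N ↦ TangentSpace (𝓡 n) y)]
        [IsContMDiffRiemannianBundle (𝓡 n) ∞ (ModelE n) (fun y : N ↦ TangentSpace (𝓡 n) y)]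
        (T : EReal) (u : ℝ → M → N), IsHarmonicMapFlow 2 n u T →
      ∃ F : ℝ → ℝ, (∀ t ∈ timeInterval T, 0 ≤ F t ∧
        ∫⁻ x, ENNReal.ofReal (χ x * energyDensity 2 n (u t) x) ∂(riemannianVolume 2 M) =
          ENNReal.ofReal (F t)) ∧
        ∀ q σ τ : ℝ, 1 ≤ q → 0 ≤ σ → 0 ≤ τ →
          (∀ t : ℝ, τ ≤ t → (t : EReal) < T → stressLq 2 n (u t) q ≤ ENNReal.ofReal σ) →
          ∀ t t' : ℝ, τ ≤ t → t ≤ t' → (t' : EReal) < T →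
            F t' ≤ F t + C * σ / r ^ (2 / q) * (t' - t) := by
  obtain ⟨C, hC, H⟩ := exists_isEnergyCutoff.{u}
  refine ⟨2 * C * (C + 1), by positivity, ?_⟩
  intro M _ _ _ _ _ _ _ _ _
  obtain ⟨R₀, hR₀, h⟩ := H M
  refine ⟨R₀, hR₀, fun p r hr hrR ↦ ?_⟩
  obtain ⟨x₀, φ, hφ⟩ := h p r hr hrR
  refine ⟨_, hφ.isBallWeight, ?_⟩
  intro n N _ _ _ _ _ T u hu
  exact ⟨_, fun t ht ↦ hu.lintegral_indicator_mul_energyDensity x₀ hφ.smooth hφ.nonneg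
    hφ.hasCompactSupport hφ.tsupport_subset ht,
    fun q σ τ hq hσ hτ hS t t' ht htt' ht' ↦
      hu.integral_localEnergy_le hC hr hφ hq hσ hτ hS ht htt' ht'⟩

/-! ### Weighted energies, annuli and the energy scale. -/

section Scale

variable {m n : ℕ} {M : Type u} [EMetricSpace M] [ChartedSpace (ModelE m) M]
  [RiemannianBundle (fun x : M ↦ TangentSpace (𝓡 m) x)]
  {N : Type v} [TopologicalSpace N] [ChartedSpace (ModelE n) N]
  [RiemannianBundle (fun y : N ↦ TangentSpace (𝓡 n) y)] {f : M → N} {p : M}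

lemma energyDensity_nonneg (f : M → N) (x : M) : 0 ≤ energyDensity m n f x := by
  rw [energyDensity, normSqDu]
  positivity

lemma gball_subset_gball {M : Type u} [EMetricSpace M] (p : M) {r s : ℝ} (h : r ≤ s) : gball p r ⊆ gball p s :=
  fun _ hx ↦ lt_of_lt_of_le hx (ENNReal.ofReal_le_ofReal h)

variable [MeasurableSpace M]

lemma measurableSet_gball [BorelSpace M] (p : M) (r : ℝ) : MeasurableSet (gball p r) := by
  have : gball p r = Metric.eball p (ENNReal.ofReal r) := rfl
  rw [this]
  exact Metric.isOpen_eball.measurableSet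

lemma energyOn_gball_le [BorelSpace M] {r s : ℝ} {χ : M → ℝ} (hχ : IsBallWeight p r χ)
    (hs : s ≤ r / 4) :
    energyOn m n f (gball p s) ≤
      ∫⁻ x, ENNReal.ofReal (χ x * energyDensity m n f x) ∂(riemannianVolume m M) := by
  refine le_trans (setLIntegral_mono' (measurableSet_gball p s) fun x hx ↦ ?_)
    (setLIntegral_le_lintegral (gball p s) _)
  rw [hχ.eq_one x (gball_subset_gball p hs hx), one_mul]

/-- The weight lives on the closed ball of radius `r / 2`, which the annulus excludes, and both lie
in the ball of radius `ρ`. -/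
lemma energyOn_annulus_add_le [BorelSpace M] {r ρ : ℝ} {χ : M → ℝ} (hχ : IsBallWeight p r χ)
    (hr : 0 < r) (hρ : r < ρ) :
    energyOn m n f (annulus p (r / 2) r) +
      ∫⁻ x, ENNReal.ofReal (χ x * energyDensity m n f x) ∂(riemannianVolume m M) ≤
    energyOn m n f (gball p ρ) := by
  have hm : MeasurableSet (annulus p (r / 2) r) :=
    (measurableSet_gball p r).diff (Metric.isClosed_closedEBall (a := p)).measurableSet
  rw [energyOn, energyOn, ← lintegral_indicator hm, ← lintegral_indicator (measurableSet_gball p ρ)]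
  -- Superadditivity of the lower integral needs no measurability of the energy density.
  refine (le_lintegral_add _ _).trans (lintegral_mono fun x ↦ ?_)
  dsimp only
  by_cases hx : χ x = 0
  · rw [hx, zero_mul, ENNReal.ofReal_zero, add_zero]
    exact indicator_le_indicator_of_subset
      (sdiff_subset.trans (gball_subset_gball p hρ.le)) (fun _ ↦ zero_le) x
  · have h1 := hχ.edist_le x hx
    rw [indicator_of_notMem fun h : x ∈ annulus p (r / 2) r ↦ h.2 h1, zero_add, indicator_of_mem]
    · exact ENNReal.ofReal_le_ofReal (mul_le_of_le_one_left (energyDensity_nonneg f x) (hχ.le_one x))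
    · exact h1.trans_lt ((ENNReal.ofReal_lt_ofReal_iff (hr.trans hρ)).2 (by linarith))

lemma energyScale_nonneg (ε ρ : ℝ) (p : M) (f : M → N) : 0 ≤ energyScale m n ε ρ p f :=
  Real.sInf_nonneg fun _ h ↦ h.1.1

/-- The margin `δ < ε` is needed because the supremum must be strictly less than `ε`. If `l > ρ`,
then `ρ` itself is admissible, as the supremum over the empty range is zero. -/
lemma energyScale_le {ε ρ l δ : ℝ} (hε : 0 < ε) (hδ : δ < ε) (hρ : 0 ≤ ρ) (hl : 0 ≤ l)
    (h : ∀ r ∈ Ioo l ρ, energyOn m n f (annulus p (r / 2) r) ≤ ENNReal.ofReal δ) :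
    energyScale m n ε ρ p f ≤ l := by
  have hb : BddBelow {l : ℝ | l ∈ Icc 0 ρ ∧
      (⨆ r ∈ Ioo l ρ, energyOn m n f (annulus p (r / 2) r)) < ENNReal.ofReal ε} :=
    ⟨0, fun _ h ↦ h.1.1⟩
  have hm : ∀ l' : ℝ, l ≤ l' → (⨆ r ∈ Ioo l' ρ, energyOn m n f (annulus p (r / 2) r)) <
      ENNReal.ofReal ε := fun l' hl' ↦
    (iSup₂_le fun r hr ↦ h r ⟨hl'.trans_lt hr.1, hr.2⟩).trans_lt
      ((ENNReal.ofReal_lt_ofReal_iff hε).2 hδ)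
  rcases le_total l ρ with h' | h'
  · exact csInf_le hb ⟨⟨hl, h'⟩, hm l le_rfl⟩
  · refine (csInf_le hb (a := ρ) ⟨⟨hρ, le_rfl⟩, ?_⟩).trans h'
    rw [Ioo_self]
    simpa using hε

end Scale

end HMFlow

end

/-! ### The main theorem. -/

open HMFlow

theorem mainTheorem4 :
    ∃ C : ℝ, 0 < C ∧
    ∀ (S : Type*) [EMetricSpace S] [CompactSpace S] [ChartedSpace (ModelE 2) S]
      [IsManifold (𝓡 2) ∞ S] [MeasurableSpace S] [BorelSpace S]
      [RiemannianBundle (fun x : S ↦ TangentSpace (𝓡 2) x)]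
      [IsContMDiffRiemannianBundle (𝓡 2) ∞ (ModelE 2) (fun x : S ↦ TangentSpace (𝓡 2) x)]
      [IsRiemannianManifold (𝓡 2) S],
    ∃ R₀ : ℝ, 0 < R₀ ∧
    ∀ (n : ℕ) (N : Type*) [TopologicalSpace N] [T2Space N] [CompactSpace N]
      [ChartedSpace (ModelE n) N] [IsManifold (𝓡 n) ∞ N]
      [RiemannianBundle (fun y : N ↦ TangentSpace (𝓡 n) y)]
      [IsContMDiffRiemannianBundle (𝓡 n) ∞ (ModelE n) (fun y : N ↦ TangentSpace (𝓡 n) y)]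
      (T : EReal) (u : ℝ → S → N), HMFlow.IsHarmonicMapFlow 2 n u T →
    ∀ (q σ τ : ℝ), 1 ≤ q → 0 ≤ σ → 0 ≤ τ → (τ : EReal) < T →
      (∀ t : ℝ, τ ≤ t → (t : EReal) < T → HMFlow.stressLq 2 n (u t) q ≤ ENNReal.ofReal σ) →
    ∀ (ε : ℝ), 0 < ε → ∀ p : S,
      (∀ (R ρ t₁ t₂ : ℝ), 0 < R → R ≤ ρ → ρ < R₀ → τ ≤ t₁ → t₁ ≤ t₂ → (t₂ : EReal) < T →
        (⨆ t ∈ Icc t₁ t₂, HMFlow.energyOn 2 n (u t) (HMFlow.gball p ρ)) ≤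
          HMFlow.energyOn 2 n (u t₂) (HMFlow.gball p R) + ENNReal.ofReal (ε / 2) →
        ∀ t ∈ Icc t₁ t₂,
          HMFlow.energyScale 2 n ε ρ p (u t) ≤ max (4 * R) ((C * σ * (t₂ - t) / ε) ^ (q / 2))) ∧
      (∀ T' : ℝ, T = (T' : EReal) →
        ∃ ρ : ℝ, 0 < ρ ∧ ρ < R₀ ∧
          (fun t : ℝ ↦ HMFlow.energyScale 2 n ε ρ p (u t)) =O[𝓝[<] T']
            (fun t : ℝ ↦ (T' - t) ^ (q / 2))) := by
  obtain ⟨C, hC, H⟩ := exists_isBallWeight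
  -- The factor 4 makes the growth of the weighted energy at most a quarter of `ε` at all scales
  -- above the bound; this is `hrate`.
  refine ⟨4 * C, by positivity, ?_⟩
  intro S _ _ _ _ _ _ _ _ _
  obtain ⟨R₀, hR₀, h⟩ := H S
  refine ⟨R₀, hR₀, ?_⟩
  intro n N _ _ _ _ _ _ _ T u hu q σ τ hq hσ hτ hτT hS ε hε p
  have hq0 : 0 < q := by linarith
  have hrate : ∀ {r s : ℝ}, 0 < r → 0 ≤ s → (4 * C * σ * s / ε) ^ (q / 2) ≤ r →
      C * σ / r ^ (2 / q) * s ≤ ε / 4 := by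
    intro r s hr hs hle
    have h1 : 4 * C * σ * s / ε ≤ r ^ (2 / q) := by
      have h2 := Real.rpow_le_rpow (by positivity) hle (by positivity : (0 : ℝ) ≤ 2 / q)
      rwa [← Real.rpow_mul (by positivity), div_mul_div_cancel₀ two_ne_zero, div_self hq0.ne',
        Real.rpow_one] at h2
    have h3 : 0 < r ^ (2 / q) := Real.rpow_pos_of_pos hr _
    rw [div_le_iff₀ hε] at h1
    rw [div_mul_eq_mul_div, div_le_iff₀ h3]
    linarith
  constructor
  · intro R ρ t₁ t₂ hR hRρ hρ hτ₁ h₁₂ h₂T hsup t ht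
    have hRpos : 0 < max (4 * R) ((4 * C * σ * (t₂ - t) / ε) ^ (q / 2)) :=
      lt_max_of_lt_left (by positivity)
    -- The excess is ε/2 from the hypothesis plus ε/4 from the growth between `t` and `t₂`.
    refine energyScale_le (δ := 3 / 4 * ε) hε (by linarith) (by linarith) hRpos.le fun r hr ↦ ?_
    obtain ⟨hr4, hrX⟩ := max_lt_iff.1 hr.1
    have hr0 : 0 < r := hRpos.trans hr.1
    obtain ⟨χ, hχ, hF⟩ := h p r hr0 (hr.2.trans hρ)
    obtain ⟨F, hF1, hF2⟩ := hF n N T u hu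
    have htT : (t : EReal) < T := (EReal.coe_le_coe_iff.2 ht.2).trans_lt h₂T
    obtain ⟨hFt, hFe⟩ := hF1 t ⟨by linarith [ht.1], htT⟩
    obtain ⟨hFt₂, hFe₂⟩ := hF1 t₂ ⟨by linarith [ht.1, ht.2], h₂T⟩
    have e1 := hF2 q σ τ hq hσ hτ hS t t₂ (by linarith [ht.1]) ht.2 h₂T
    have e2 := hrate hr0 (sub_nonneg.2 ht.2) hrX.le
    have e3 := energyOn_annulus_add_le (m := 2) (n := n) (f := u t) hχ hr0 hr.2
    have e4 := energyOn_gball_le (m := 2) (n := n) (f := u t₂) hχ (s := R) (by linarith)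
    have e5 := (le_iSup₂ (f := fun t (_ : t ∈ Icc t₁ t₂) ↦ energyOn 2 n (u t) (gball p ρ)) t
      ht).trans hsup
    rw [hFe] at e3
    rw [hFe₂] at e4
    have e6 : energyOn 2 n (u t) (annulus p (r / 2) r) + ENNReal.ofReal (F t) ≤
        ENNReal.ofReal (3 / 4 * ε) + ENNReal.ofReal (F t) := by
      refine (e3.trans e5).trans ((add_le_add_left e4 _).trans ?_)
      rw [← ENNReal.ofReal_add hFt₂ (by positivity), ← ENNReal.ofReal_add (by positivity) hFt]
      exact ENNReal.ofReal_le_ofReal (by linarith)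
    exact (ENNReal.add_le_add_iff_right ENNReal.ofReal_ne_top).1 e6
  · rintro T' rfl
    have hτT' : τ < T' := EReal.coe_lt_coe_iff.1 hτT
    have hweight : ∀ r : Ioo 0 R₀, ∃ (χ : S → ℝ) (F : ℝ → ℝ), IsBallWeight p r χ ∧
        (∀ t ∈ Ico τ T', 0 ≤ F t ∧
          ∫⁻ x, ENNReal.ofReal (χ x * energyDensity 2 n (u t) x) ∂(riemannianVolume 2 S) =
            ENNReal.ofReal (F t)) ∧
        ∀ t ∈ Ico τ T', ∀ t' ∈ Ico τ T', t ≤ t' →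
          F t' ≤ F t + C * σ / (r : ℝ) ^ (2 / q) * (t' - t) := by
      intro r
      obtain ⟨χ, hχ, hF⟩ := h p r r.2.1 r.2.2
      obtain ⟨F, hF1, hF2⟩ := hF n N _ u hu
      exact ⟨χ, F, hχ, fun t ht ↦ hF1 t ⟨by linarith [ht.1], EReal.coe_lt_coe_iff.2 ht.2⟩,
        fun t ht t' ht' htt' ↦ hF2 q σ τ hq hσ hτ hS t t' ht.1 htt' (EReal.coe_lt_coe_iff.2 ht'.2)⟩
    choose χ F hχ hF hmono using hweight
    set K : Ioo 0 R₀ → ℝ := fun r ↦ C * σ / (r : ℝ) ^ (2 / q) with hK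
    have hK0 : ∀ r, 0 ≤ K r := fun r ↦
      div_nonneg (by positivity) (Real.rpow_nonneg r.2.1.le _)
    -- For fixed `r` these numbers do not increase with `t`. Their infimum over all `r` and `t`
    -- plays the role of the energy concentrated at `p` at time `T'`.
    set V : Set ℝ := {a | ∃ (r : Ioo 0 R₀) (t : ℝ), t ∈ Ico τ T' ∧ a = F r t + K r * (T' - t)}
      with hV
    have hV0 : ∀ a ∈ V, 0 ≤ a := by
      rintro _ ⟨r, t, ht, rfl⟩
      exact add_nonneg (hF r t ht).1 (mul_nonneg (hK0 r) (by linarith [ht.2]))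
    have hVb : BddBelow V := ⟨0, hV0⟩
    have hVne : V.Nonempty := ⟨_, ⟨R₀ / 2, by constructor <;> linarith⟩, τ, ⟨le_rfl, hτT'⟩, rfl⟩
    obtain ⟨_, ⟨r₀, t₁, ht₁, rfl⟩, hlt⟩ := exists_lt_of_csInf_lt hVne
      (show sInf V < sInf V + ε / 8 by linarith)
    -- On the ball of radius `r₀ / 4` the weight at scale `r₀` equals 1, so the energy there is at
    -- most `F r₀ t`.
    refine ⟨r₀ / 4, by linarith [r₀.2.1], by linarith [r₀.2.1, r₀.2.2], ?_⟩
    have hscale : ∀ t ∈ Ioo t₁ T', energyScale 2 n ε (r₀ / 4) p (u t) ≤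
        (4 * C * σ * (T' - t) / ε) ^ (q / 2) := by
      intro t ht
      have htI : t ∈ Ico τ T' := ⟨by linarith [ht₁.1, ht.1], ht.2⟩
      have hnn : 0 ≤ T' - t := by linarith [ht.2]
      -- From `t₁` on, `F r₀ t` stays below inf V + ε/8, and inf V ≤ F r t + ε/4 at the scale `r =
      -- s` by the growth bound. The excess is therefore at most 3ε/8.
      refine energyScale_le (δ := 3 / 8 * ε) hε (by linarith) (by linarith [r₀.2.1])
        (by positivity) fun s hs ↦ ?_
      have hs0 : 0 < s := lt_of_le_of_lt (by positivity) hs.1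
      set r : Ioo 0 R₀ := ⟨s, hs0, by linarith [hs.2, r₀.2.1, r₀.2.2]⟩ with hr
      have e0 : sInf V ≤ F r t + K r * (T' - t) := csInf_le hVb ⟨r, t, htI, rfl⟩
      have e1 := hmono r₀ t₁ ht₁ t htI ht.1.le
      have e2 : K r * (T' - t) ≤ ε / 4 := hrate hs0 hnn hs.1.le
      have e3 := energyOn_annulus_add_le (m := 2) (n := n) (f := u t) (hχ r) hs0 hs.2
      have e4 := energyOn_gball_le (m := 2) (n := n) (f := u t) (hχ r₀) le_rfl
      rw [(hF r t htI).2] at e3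
      rw [(hF r₀ t htI).2] at e4
      have e5 : energyOn 2 n (u t) (annulus p (s / 2) s) + ENNReal.ofReal (F r t) ≤
          ENNReal.ofReal (3 / 8 * ε) + ENNReal.ofReal (F r t) := by
        refine (e3.trans e4).trans ?_
        rw [← ENNReal.ofReal_add (by positivity) (hF r t htI).1]
        refine ENNReal.ofReal_le_ofReal ?_
        have e6 : F r₀ t ≤ F r₀ t₁ + K r₀ * (t - t₁) := e1
        have e7 := mul_nonneg (hK0 r₀) hnn
        nlinarith
      exact (ENNReal.add_le_add_iff_right ENNReal.ofReal_ne_top).1 e5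
    refine IsBigO.of_bound ((4 * C * σ / ε) ^ (q / 2)) ?_
    filter_upwards [Ioo_mem_nhdsLT ht₁.2] with t ht
    have hnn : 0 ≤ T' - t := by linarith [ht.2]
    rw [Real.norm_of_nonneg (energyScale_nonneg _ _ _ _),
      Real.norm_of_nonneg (Real.rpow_nonneg hnn _), ← Real.mul_rpow (by positivity) hnn]
    refine (hscale t ht).trans (le_of_eq ?_)
    congr 1
    ring
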